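/- Let $n\ge 2$, $1<p<\infty$. Let $\Omega\subseteq\mathbb{R}^n$ be a bounded open set whose boundary is flat near $0\in\partial\Omega$, in the sense that for some $r>0$, $\Omega\cap B(0,r)=\{x\in B(0,r): x_n>0\}$, and let $\gamma\in C(\overline\Omega)$ be positive. For $f,g\in W^{1,p}(\Omega;\mathbb{C})$ (thought of as representing their boundary values, i.e. their classes modulo $W^{1,p}_0(\Omega;\mathbb{C})$) the nonlinear complex Dirichlet-to-Neumann map $\Lambda_\gamma$ is defined weakly by $$\int_{\partial\Omega}\Lambda_\gamma(f)\,\bar g\,dS=\int_\Omega\gamma|\nabla u|^{p-2}\nabla u\cdot\nabla\bar v\,dx,$$ where $u\in W^{1,p}(\Omega;\mathbb{C})$ is the weak solution of $\mathrm{div}(\gamma|\nabla u|^{p-2}\nabla u)=0$ in $\Omega$ with $u-f\in W^{1,p}_0(\Omega;\mathbb{C})$, and $v\in W^{1,p}(\Omega;\mathbb{C})$ is any function with $v-g\in W^{1,p}_0(\Omega;\mathbb{C})$. Let $\eta\in C^\infty(\mathbb{R}^n)$ be nonnegative with $\eta(x)=1$ for $|x|\le 1/2$ and $\eta(x)=0$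 for $|x|\ge 1$, let $\beta\in\mathbb{R}^n$ satisfy $|\beta|^2=p-1$ and $\beta\cdot e_n=0$, and let $N=N(M)>0$ ($M=1,2,\dots$) satisfy $M/N\to0$ as $M\to\infty$. Define $$v_M(x)=\left(\frac{M^{n-1}N^{1-p}}{c_p}\right)^{1/p}\eta(Mx)\,e^{N(i\beta-e_n)\cdot x},\qquad c_p=p^{\frac{p-2}{2}}\int_{\mathbb{R}^{n-1}}\eta(x',0)^p\,dx',$$ and $f_M=v_M|_{\partial\Omega}$. (These functions do not depend on $\gamma$ or on $\Omega$.) Then, for every such choice of $\eta$, $\beta$, $N$: 1. $v_M\in C^\infty_c(\mathbb{R}^n)$ and $\mathrm{supp}(f_M)\subseteq\overline{B}(0,1/M)\cap\partial\Omega$ for all $M\ge1$; if moreover $\mathrm{supp}(\eta)\subseteq B(0,1)$ (open ball), then $\mathrm{supp}(f_M)\subseteq B(0,1/M)\cap\partial\Omega$. 2. The number $\int_{\partial\Omega}\Lambda_\gamma(f_M)\bar f_M\,dS$ is well defined (it exists and is unique) for all $M\ge 1$, and $$\lim_{M\to\infty}\int_{\partial\Omega}\Lambda_\gamma(f_M)\,\bar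 f_M\,dS=\gamma(0).$$ Finally, choices of $\eta$, $\beta$, $N$ as above with $\mathrm{supp}(\eta)\subseteq B(0,1)$ exist; in particular there is such a sequence $(v_M)\subseteq C_c^\infty(\mathbb{R}^n)$ with $\mathrm{supp}(f_M)\subseteq B(0,1/M)\cap\partial\Omega$. -/

import Mathlib

open Filter Topology MeasureTheory
open scoped ContDiff

namespace PLaplaceBoundary

/-- Test functions: smooth complex valued functions with compact support contained in `Ω`. -/
structure IsTestFunction {n : ℕ} (Ω : Set (EuclideanSpace ℝ (Fin n)))
    (φ : EuclideanSpace ℝ (Fin n) → ℂ) : Prop where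
  smooth : ContDiff ℝ ∞ φ
  compact : HasCompactSupport φ
  subset : tsupport φ ⊆ Ω

/-- The classical gradient `(∂₁φ, …, ∂ₙφ)` of a complex valued function on `ℝⁿ`. -/
noncomputable def grad {n : ℕ} (φ : EuclideanSpace ℝ (Fin n) → ℂ)
    (x : EuclideanSpace ℝ (Fin n)) : EuclideanSpace ℂ (Fin n) :=
  WithLp.toLp 2 fun j => fderiv ℝ φ x (EuclideanSpace.single j 1)

/-- `u ∈ W^{1,p}(Ω; ℂ)` with weak gradient `U`. -/
structure IsSobolev {n : ℕ} (p : ℝ) (Ω : Set (EuclideanSpace ℝ (Fin n)))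
    (u : EuclideanSpace ℝ (Fin n) → ℂ)
    (U : EuclideanSpace ℝ (Fin n) → EuclideanSpace ℂ (Fin n)) : Prop where
  memLp : MemLp u (ENNReal.ofReal p) (volume.restrict Ω)
  memLp_grad : MemLp U (ENNReal.ofReal p) (volume.restrict Ω)
  weak : ∀ φ : EuclideanSpace ℝ (Fin n) → ℂ, IsTestFunction Ω φ → ∀ j : Fin n,
    ∫ x in Ω, u x * grad φ x j = -∫ x in Ω, U x j * φ x

/-- `u ∈ W^{1,p}_0(Ω; ℂ)` with weak gradient `U`: the pair `(u, U)` is a limit in `L^p(Ω)` of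
pairs `(φ, ∇φ)` with `φ` a test function. -/
structure IsSobolevZero {n : ℕ} (p : ℝ) (Ω : Set (EuclideanSpace ℝ (Fin n)))
    (u : EuclideanSpace ℝ (Fin n) → ℂ)
    (U : EuclideanSpace ℝ (Fin n) → EuclideanSpace ℂ (Fin n)) : Prop where
  sobolev : IsSobolev p Ω u U
  approx : ∃ φ : ℕ → EuclideanSpace ℝ (Fin n) → ℂ,
    (∀ k, IsTestFunction Ω (φ k)) ∧
    Tendsto (fun k => eLpNorm (fun x => u x - φ k x) (ENNReal.ofReal p) (volume.restrict Ω))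
      atTop (𝓝 0) ∧
    Tendsto (fun k => eLpNorm (fun x => U x - grad (φ k) x) (ENNReal.ofReal p)
      (volume.restrict Ω)) atTop (𝓝 0)

/-- `u = f` on `∂Ω` in the sense of the abstract trace space `W^{1,p}(Ω) / W^{1,p}_0(Ω)`,
that is, `u - f ∈ W^{1,p}_0(Ω; ℂ)`. -/
def SameTrace {n : ℕ} (p : ℝ) (Ω : Set (EuclideanSpace ℝ (Fin n)))
    (u f : EuclideanSpace ℝ (Fin n) → ℂ) : Prop :=
  ∃ W : EuclideanSpace ℝ (Fin n) → EuclideanSpace ℂ (Fin n),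
    IsSobolevZero p Ω (fun x => u x - f x) W

/-- The nonlinear current `γ |U|^{p-2} U`. -/
noncomputable def flux {n : ℕ} (p : ℝ) (γ : EuclideanSpace ℝ (Fin n) → ℝ)
    (U : EuclideanSpace ℝ (Fin n) → EuclideanSpace ℂ (Fin n))
    (x : EuclideanSpace ℝ (Fin n)) : EuclideanSpace ℂ (Fin n) :=
  ((γ x * ‖U x‖ ^ (p - 2) : ℝ) : ℂ) • U x

/-- `u ∈ W^{1,p}(Ω; ℂ)`, with weak gradient `U`, is a weak solution of
`div(γ |∇u|^{p-2} ∇u) = 0` in `Ω` with `u = f` on `∂Ω`. -/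
structure IsDirichletSolution {n : ℕ} (p : ℝ) (γ : EuclideanSpace ℝ (Fin n) → ℝ)
    (Ω : Set (EuclideanSpace ℝ (Fin n))) (f u : EuclideanSpace ℝ (Fin n) → ℂ)
    (U : EuclideanSpace ℝ (Fin n) → EuclideanSpace ℂ (Fin n)) : Prop where
  sobolev : IsSobolev p Ω u U
  equation : ∀ (φ : EuclideanSpace ℝ (Fin n) → ℂ)
    (Φ : EuclideanSpace ℝ (Fin n) → EuclideanSpace ℂ (Fin n)), IsSobolevZero p Ω φ Φ →
    ∫ x in Ω, ∑ j, flux p γ U x j * Φ x j = 0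
  boundary : SameTrace p Ω u f

/-- `ℓ` is a value of the pairing `∫_{∂Ω} Λ_γ(f) ḡ dS`, in its weak definition:
`ℓ = ∫_Ω γ |∇u|^{p-2} ∇u · ∇v̄ dx` where `u` solves the Dirichlet problem with boundary value `f`
and `v ∈ W^{1,p}(Ω; ℂ)` is an extension of the boundary value of `g`. -/
def IsDNValue {n : ℕ} (p : ℝ) (γ : EuclideanSpace ℝ (Fin n) → ℝ)
    (Ω : Set (EuclideanSpace ℝ (Fin n))) (f g : EuclideanSpace ℝ (Fin n) → ℂ) (ℓ : ℂ) : Prop :=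
  ∃ (u v : EuclideanSpace ℝ (Fin n) → ℂ)
    (U V : EuclideanSpace ℝ (Fin n) → EuclideanSpace ℂ (Fin n)),
    IsDirichletSolution p γ Ω f u U ∧ IsSobolev p Ω v V ∧ SameTrace p Ω v g ∧
    ℓ = ∫ x in Ω, ∑ j, flux p γ U x j * (starRingEnd ℂ) (V x j)

/-- The pairing `∫_{∂Ω} Λ_γ(f) ḡ dS` defining the complex Dirichlet-to-Neumann map. It is
meaningful when there is exactly one value in the sense of `IsDNValue`. -/
noncomputable def dnPairing {n : ℕ} (p : ℝ) (γ : EuclideanSpace ℝ (Fin n) → ℝ)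
    (Ω : Set (EuclideanSpace ℝ (Fin n))) (f g : EuclideanSpace ℝ (Fin n) → ℂ) : ℂ :=
  Classical.epsilon fun ℓ => IsDNValue p γ Ω f g ℓ

/- From here on the dimension is `n = d + 1`, and `x (Fin.last d)` is the last coordinate `xₙ`. -/

/-- The data of the construction: the cutoff `η`, the frequency `β` and the scales `N(M)`. -/
structure IsAdmissible {d : ℕ} (p : ℝ) (η : EuclideanSpace ℝ (Fin (d + 1)) → ℝ)
    (β : EuclideanSpace ℝ (Fin (d + 1))) (N : ℕ → ℝ) : Prop where
  smooth : ContDiff ℝ ∞ η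
  nonneg : ∀ x, 0 ≤ η x
  eq_one : ∀ x, ‖x‖ ≤ 1 / 2 → η x = 1
  eq_zero : ∀ x, 1 ≤ ‖x‖ → η x = 0
  norm_sq : ‖β‖ ^ 2 = p - 1
  last_eq : β (Fin.last d) = 0
  scale_pos : ∀ M : ℕ, 1 ≤ M → 0 < N M
  scale : Tendsto (fun M : ℕ => (M : ℝ) / N M) atTop (𝓝 0)

/-- The `p`-harmonic complex exponential `h(x) = e^{(iβ - eₙ)·x}`. -/
noncomputable def cexpWave {d : ℕ} (β x : EuclideanSpace ℝ (Fin (d + 1))) : ℂ :=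
  Complex.exp (Complex.I * ((∑ j, β j * x j : ℝ) : ℂ) - ((x (Fin.last d) : ℝ) : ℂ))

/-- The constant `c_p = p^{(p-2)/2} ∫_{ℝ^{n-1}} η(x',0)^p dx'`. -/
noncomputable def normConst {d : ℕ} (p : ℝ) (η : EuclideanSpace ℝ (Fin (d + 1)) → ℝ) : ℝ :=
  p ^ ((p - 2) / 2) *
    ∫ y : EuclideanSpace ℝ (Fin d),
      η (WithLp.toLp 2 (Fin.snoc (α := fun _ => ℝ) (fun i : Fin d => y i) 0)) ^ p

/-- The explicit functions
`v_M(x) = (M^{n-1} N^{1-p} / c_p)^{1/p} η(Mx) e^{N(iβ - eₙ)·x}`, with `N = N(M)`. -/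
noncomputable def boundaryWave {d : ℕ} (p : ℝ) (η : EuclideanSpace ℝ (Fin (d + 1)) → ℝ)
    (β : EuclideanSpace ℝ (Fin (d + 1))) (N : ℕ → ℝ) (M : ℕ)
    (x : EuclideanSpace ℝ (Fin (d + 1))) : ℂ :=
  ((((M : ℝ) ^ d * N M ^ (1 - p) / normConst p η) ^ (1 / p) : ℝ) : ℂ) *
    ((η ((M : ℝ) • x) : ℝ) : ℂ) * cexpWave β (N M • x)

end PLaplaceBoundary

namespace PLaplaceBoundary

section Basics

variable {n : ℕ}

/-- Componentwise complex conjugation. -/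
noncomputable def conjVec (a : EuclideanSpace ℂ (Fin n)) : EuclideanSpace ℂ (Fin n) :=
  WithLp.toLp 2 fun j => (starRingEnd ℂ) (a j)

@[simp] lemma conjVec_apply (a : EuclideanSpace ℂ (Fin n)) (j : Fin n) :
    conjVec a j = (starRingEnd ℂ) (a j) := rfl

@[simp] lemma norm_conjVec (a : EuclideanSpace ℂ (Fin n)) : ‖conjVec a‖ = ‖a‖ := by
  simp [EuclideanSpace.norm_eq]

lemma conjVec_sub (a b : EuclideanSpace ℂ (Fin n)) :
    conjVec (a - b) = conjVec a - conjVec b := by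
  ext j; simp

lemma continuous_conjVec : Continuous (conjVec (n := n)) := by
  have h : Isometry (conjVec (n := n)) := by
    refine Isometry.of_dist_eq fun a b => ?_
    rw [dist_eq_norm, dist_eq_norm, ← conjVec_sub, norm_conjVec]
  exact h.continuous

lemma sum_mul_eq_inner (a b : EuclideanSpace ℂ (Fin n)) :
    ∑ j, a j * b j = inner ℂ (conjVec a) b := by
  rw [PiLp.inner_apply]
  refine Finset.sum_congr rfl fun j _ => ?_
  simp [mul_comm]

lemma norm_sum_mul_le (a b : EuclideanSpace ℂ (Fin n)) :
    ‖∑ j, a j * b j‖ ≤ ‖a‖ * ‖b‖ := by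
  rw [sum_mul_eq_inner]
  exact (norm_inner_le_norm _ _).trans (by rw [norm_conjVec])

lemma sum_mul_conj_self (a : EuclideanSpace ℂ (Fin n)) :
    ∑ j, a j * (starRingEnd ℂ) (a j) = ((‖a‖ ^ 2 : ℝ) : ℂ) := by
  rw [EuclideanSpace.norm_sq_eq]
  push_cast
  exact Finset.sum_congr rfl fun j _ => by rw [Complex.mul_conj, Complex.normSq_eq_norm_sq]; simp

lemma norm_coord_le (a : EuclideanSpace ℂ (Fin n)) (j : Fin n) : ‖a j‖ ≤ ‖a‖ :=
  PiLp.norm_apply_le a j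

variable {φ ψ : EuclideanSpace ℝ (Fin n) → ℂ}

lemma grad_add (hφ : Differentiable ℝ φ) (hψ : Differentiable ℝ ψ) (x) :
    grad (fun x => φ x + ψ x) x = grad φ x + grad ψ x := by
  ext j
  simp only [grad, PiLp.add_apply]
  rw [fderiv_fun_add (hφ x) (hψ x)]; rfl

lemma grad_sub (hφ : Differentiable ℝ φ) (hψ : Differentiable ℝ ψ) (x) :
    grad (fun x => φ x - ψ x) x = grad φ x - grad ψ x := by
  ext j
  simp only [grad, PiLp.sub_apply]
  rw [fderiv_fun_sub (hφ x) (hψ x)]; rfl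

lemma grad_smul (c : ℂ) (hφ : Differentiable ℝ φ) (x) :
    grad (fun x => c * φ x) x = c • grad φ x := by
  ext j
  simp only [grad, PiLp.smul_apply, smul_eq_mul]
  rw [fderiv_const_mul (hφ x)]; rfl

lemma grad_conj (hφ : Differentiable ℝ φ) (x) :
    grad (fun x => (starRingEnd ℂ) (φ x)) x = conjVec (grad φ x) := by
  ext j
  have h := (Complex.conjCLE.toContinuousLinearMap.hasFDerivAt (x := φ x)).comp x (hφ x).hasFDerivAt
  simp only [grad, conjVec_apply]
  have h2 : fderiv ℝ (fun x => (starRingEnd ℂ) (φ x)) x = _ := h.fderiv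
  rw [h2]; simp

lemma continuous_grad (hφ : ContDiff ℝ ∞ φ) : Continuous (grad φ) := by
  have h := hφ.continuous_fderiv (by simp)
  unfold grad
  refine (PiLp.continuous_toLp 2 _).comp ?_
  exact continuous_pi fun j => h.clm_apply continuous_const

lemma hasCompactSupport_grad (hφ : HasCompactSupport φ) : HasCompactSupport (grad φ) := by
  refine (hφ.fderiv (𝕜 := ℝ)).comp_left
    (g := fun L => WithLp.toLp 2 fun j => L (EuclideanSpace.single j 1)) ?_
  ext j; simp

lemma norm_fderiv_le_grad (x) (j : Fin n) :
    ‖fderiv ℝ φ x (EuclideanSpace.single j 1)‖ ≤ ‖grad φ x‖ :=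
  norm_coord_le (grad φ x) j

variable {Ω : Set (EuclideanSpace ℝ (Fin n))}

namespace IsTestFunction

lemma differentiable (h : IsTestFunction Ω φ) : Differentiable ℝ φ :=
  h.smooth.differentiable (by simp)

lemma zero : IsTestFunction Ω (fun _ => 0) where
  smooth := contDiff_const
  compact := HasCompactSupport.zero
  subset := by
    have : tsupport (fun _ : EuclideanSpace ℝ (Fin n) => (0 : ℂ)) = ∅ :=
      tsupport_eq_empty_iff.2 rfl
    rw [this]; exact Set.empty_subset _

lemma add (h : IsTestFunction Ω φ) (h' : IsTestFunction Ω ψ) :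
    IsTestFunction Ω (fun x => φ x + ψ x) where
  smooth := h.smooth.add h'.smooth
  compact := h.compact.add h'.compact
  subset := (tsupport_add φ ψ).trans (Set.union_subset h.subset h'.subset)

lemma const_mul (c : ℂ) (h : IsTestFunction Ω φ) : IsTestFunction Ω (fun x => c * φ x) where
  smooth := contDiff_const.mul h.smooth
  compact := h.compact.mul_left (f := fun _ => c)
  subset := (tsupport_mul_subset_right (f := fun _ => c)).trans h.subset

lemma sub (h : IsTestFunction Ω φ) (h' : IsTestFunction Ω ψ) :
    IsTestFunction Ω (fun x => φ x - ψ x) := by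
  have := h.add (h'.const_mul (-1))
  simpa [sub_eq_add_neg] using this

lemma conj (h : IsTestFunction Ω φ) : IsTestFunction Ω (fun x => (starRingEnd ℂ) (φ x)) where
  smooth := Complex.conjCLE.contDiff.comp h.smooth
  compact := h.compact.comp_left (g := (starRingEnd ℂ)) (by simp)
  subset := by
    refine subset_trans (closure_mono fun x hx => ?_) h.subset
    simpa using hx

lemma eq_zero (h : IsTestFunction Ω φ) {x} (hx : x ∉ Ω) : φ x = 0 :=
  image_eq_zero_of_notMem_tsupport fun h' => hx (h.subset h')

lemma fderiv_eq_zero (h : IsTestFunction Ω φ) {x} (hx : x ∉ Ω) : fderiv ℝ φ x = 0 := by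
  have : x ∉ tsupport (fderiv ℝ φ) := fun h' => hx (h.subset (tsupport_fderiv_subset ℝ h'))
  exact image_eq_zero_of_notMem_tsupport this

lemma grad_eq_zero (h : IsTestFunction Ω φ) {x} (hx : x ∉ Ω) : grad φ x = 0 := by
  ext j; simp [grad, h.fderiv_eq_zero hx]

lemma memLp (h : IsTestFunction Ω φ) (q : ENNReal) (μ : Measure (EuclideanSpace ℝ (Fin n)))
    [IsFiniteMeasureOnCompacts μ] : MemLp φ q μ :=
  h.smooth.continuous.memLp_of_hasCompactSupport h.compact

lemma memLp_grad (h : IsTestFunction Ω φ) (q : ENNReal)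
    (μ : Measure (EuclideanSpace ℝ (Fin n))) [IsFiniteMeasureOnCompacts μ] : MemLp (grad φ) q μ :=
  (continuous_grad h.smooth).memLp_of_hasCompactSupport (hasCompactSupport_grad h.compact)

end IsTestFunction

/-- A smooth compactly supported function belongs to every Sobolev space. -/
lemma isSobolev_of_contDiff (p : ℝ) (hφ : ContDiff ℝ ∞ φ) (hc : HasCompactSupport φ) :
    IsSobolev p Ω φ (grad φ) where
  memLp := hφ.continuous.memLp_of_hasCompactSupport hc
  memLp_grad := (continuous_grad hφ).memLp_of_hasCompactSupport (hasCompactSupport_grad hc)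
  weak := by
    intro ψ hψ j
    have hφ' : Continuous fun x => fderiv ℝ φ x (EuclideanSpace.single j 1) :=
      (hφ.continuous_fderiv (by simp)).clm_apply continuous_const
    have hψ' : Continuous fun x => fderiv ℝ ψ x (EuclideanSpace.single j 1) :=
      (hψ.smooth.continuous_fderiv (by simp)).clm_apply continuous_const
    have hdc : HasCompactSupport fun x => fderiv ℝ φ x (EuclideanSpace.single j 1) :=
      hc.fderiv_apply (𝕜 := ℝ) _
    have key := integral_mul_fderiv_eq_neg_fderiv_mul_of_integrable (𝕜 := ℂ) (μ := volume)
      (f := φ) (g := ψ) (v := EuclideanSpace.single j (1 : ℝ))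
      ((hφ'.mul hψ.smooth.continuous).integrable_of_hasCompactSupport hdc.mul_right)
      ((hφ.continuous.mul hψ').integrable_of_hasCompactSupport hc.mul_right)
      ((hφ.continuous.mul hψ.smooth.continuous).integrable_of_hasCompactSupport hc.mul_right)
      (fun x _ => hφ.differentiable (by simp) x) (fun x _ => hψ.differentiable x)
    rw [setIntegral_eq_integral_of_forall_compl_eq_zero,
      setIntegral_eq_integral_of_forall_compl_eq_zero]
    · exact key
    · intro x hx; simp [hψ.eq_zero hx]
    · intro x hx; simp [hψ.grad_eq_zero hx]

variable {p : ℝ} {u v : EuclideanSpace ℝ (Fin n) → ℂ}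
  {U V : EuclideanSpace ℝ (Fin n) → EuclideanSpace ℂ (Fin n)}

lemma memLp_coord {μ : Measure (EuclideanSpace ℝ (Fin n))} {q : ENNReal} (hU : MemLp U q μ)
    (j : Fin n) : MemLp (fun x => U x j) q μ := by
  refine hU.of_le ?_ (ae_of_all _ fun x => norm_coord_le _ j)
  exact (PiLp.continuous_apply 2 _ j).comp_aestronglyMeasurable hU.1

lemma memLp_conjVec {μ : Measure (EuclideanSpace ℝ (Fin n))} {q : ENNReal} (hU : MemLp U q μ) :
    MemLp (fun x => conjVec (U x)) q μ :=
  hU.of_le (continuous_conjVec.comp_aestronglyMeasurable hU.1) (ae_of_all _ fun x => by simp)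

lemma MemLp.integrable_mul_bounded {μ : Measure (EuclideanSpace ℝ (Fin n))} [IsFiniteMeasure μ]
    (hp : 1 ≤ p) (hu : MemLp u (ENNReal.ofReal p) μ) (hv : Continuous v)
    (hc : HasCompactSupport v) : Integrable (fun x => u x * v x) μ := by
  obtain ⟨C, hC⟩ := hv.bounded_above_of_compact_support hc
  have : Integrable u μ := hu.integrable (by simpa using hp)
  exact this.mul_bdd hv.aestronglyMeasurable (ae_of_all _ hC)

namespace IsSobolev

lemma continuous_grad_coord (hφ : IsTestFunction Ω φ) (j : Fin n) :
    Continuous fun x => grad φ x j :=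
  (PiLp.continuous_apply 2 _ j).comp (continuous_grad hφ.smooth)

lemma hasCompactSupport_grad_coord (hφ : IsTestFunction Ω φ) (j : Fin n) :
    HasCompactSupport fun x => grad φ x j :=
  (hasCompactSupport_grad hφ.compact).comp_left (g := fun a : EuclideanSpace ℂ (Fin n) => a j)
    (by simp)

lemma add [IsFiniteMeasure (volume.restrict Ω)] (hp : 1 ≤ p) (hu : IsSobolev p Ω u U)
    (hv : IsSobolev p Ω v V) :
    IsSobolev p Ω (fun x => u x + v x) (fun x => U x + V x) where
  memLp := hu.memLp.add hv.memLp
  memLp_grad := hu.memLp_grad.add hv.memLp_grad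
  weak := by
    intro φ hφ j
    have h1 := continuous_grad_coord hφ j
    have h2 := hasCompactSupport_grad_coord hφ j
    simp only [PiLp.add_apply, add_mul]
    rw [integral_add (MemLp.integrable_mul_bounded hp hu.memLp h1 h2)
        (MemLp.integrable_mul_bounded hp hv.memLp h1 h2),
      integral_add (MemLp.integrable_mul_bounded hp (memLp_coord hu.memLp_grad j)
          hφ.smooth.continuous hφ.compact)
        (MemLp.integrable_mul_bounded hp (memLp_coord hv.memLp_grad j)
          hφ.smooth.continuous hφ.compact), hu.weak φ hφ j, hv.weak φ hφ j]
    ring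

lemma const_mul (c : ℂ) (hu : IsSobolev p Ω u U) :
    IsSobolev p Ω (fun x => c * u x) (fun x => c • U x) where
  memLp := hu.memLp.const_mul c
  memLp_grad := hu.memLp_grad.const_smul c
  weak := by
    intro φ hφ j
    simp only [PiLp.smul_apply, smul_eq_mul, mul_assoc]
    rw [integral_const_mul, integral_const_mul, hu.weak φ hφ j]
    ring

lemma sub [IsFiniteMeasure (volume.restrict Ω)] (hp : 1 ≤ p) (hu : IsSobolev p Ω u U)
    (hv : IsSobolev p Ω v V) :
    IsSobolev p Ω (fun x => u x - v x) (fun x => U x - V x) := by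
  have := hu.add hp (hv.const_mul (-1))
  simpa [sub_eq_add_neg] using this

lemma conj (hu : IsSobolev p Ω u U) :
    IsSobolev p Ω (fun x => (starRingEnd ℂ) (u x)) (fun x => conjVec (U x)) where
  memLp := hu.memLp.of_le (Complex.continuous_conj.comp_aestronglyMeasurable hu.memLp.1)
    (ae_of_all _ fun x => by simp)
  memLp_grad := memLp_conjVec hu.memLp_grad
  weak := by
    intro φ hφ j
    have h := hu.weak _ hφ.conj j
    have h' := congrArg (starRingEnd ℂ) h
    rw [map_neg, ← integral_conj, ← integral_conj] at h'
    simpa [grad_conj hφ.differentiable] using h'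

lemma congr_grad (hu : IsSobolev p Ω u U) (h : U =ᵐ[volume.restrict Ω] V) :
    IsSobolev p Ω u V where
  memLp := hu.memLp
  memLp_grad := hu.memLp_grad.ae_eq h
  weak := by
    intro φ hφ j
    rw [hu.weak φ hφ j]
    congr 1
    exact integral_congr_ae (h.mono fun x hx => by simp [hx])

/-- Weak gradients are unique. -/
lemma grad_unique [IsFiniteMeasure (volume.restrict Ω)] (hΩ : IsOpen Ω) (hp : 1 ≤ p)
    (hu : IsSobolev p Ω u U) (hv : IsSobolev p Ω u V) : U =ᵐ[volume.restrict Ω] V := by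
  have key : ∀ j, ∀ᵐ x ∂volume.restrict Ω, U x j = V x j := by
    intro j
    have hUj := memLp_coord hu.memLp_grad j
    have hVj := memLp_coord hv.memLp_grad j
    have hp' : (1 : ENNReal) ≤ ENNReal.ofReal p := by simpa using hp
    have hint : IntegrableOn (fun x => U x j - V x j) Ω :=
      (hUj.integrable hp').sub (hVj.integrable hp')
    have := hΩ.ae_eq_zero_of_integral_contDiff_smul_eq_zero (μ := volume)
      (f := fun x => U x j - V x j) hint.locallyIntegrableOn ?_
    · rw [ae_restrict_iff' hΩ.measurableSet]
      filter_upwards [this] with x hx hxΩ using sub_eq_zero.1 (hx hxΩ)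
    intro g hg hgc hgs
    have hsupp : Function.support (fun x => (g x : ℂ)) = Function.support g := by
      ext x; simp
    have hts : tsupport (fun x => (g x : ℂ)) = tsupport g := by
      rw [tsupport, tsupport, hsupp]
    have hφ : IsTestFunction Ω (fun x => (g x : ℂ)) :=
      ⟨Complex.ofRealCLM.contDiff.comp hg, by rw [HasCompactSupport, hts]; exact hgc,
        by rw [hts]; exact hgs⟩
    have e1 := hu.weak _ hφ j
    have e2 := hv.weak _ hφ j
    have e3 : ∫ x in Ω, U x j * (g x : ℂ) = ∫ x in Ω, V x j * (g x : ℂ) := by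
      rw [e1] at e2; exact neg_injective e2
    have hcont : Continuous fun x => (g x : ℂ) := hφ.smooth.continuous
    rw [← setIntegral_eq_integral_of_forall_compl_eq_zero (s := Ω)]
    · have : ∀ x, g x • (U x j - V x j) = U x j * (g x : ℂ) - V x j * (g x : ℂ) := by
        intro x; rw [Complex.real_smul]; ring
      simp only [this]
      rw [integral_sub (MemLp.integrable_mul_bounded hp hUj hcont hφ.compact)
        (MemLp.integrable_mul_bounded hp hVj hcont hφ.compact), e3, sub_self]
    · intro x hx
      have : g x = 0 := by simpa using hφ.eq_zero hx
      simp [this]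
  filter_upwards [ae_all_iff.2 key] with x hx
  ext j; exact hx j

end IsSobolev

/-- Integrals against a fixed bounded continuous function pass to `L^p` limits. -/
lemma tendsto_setIntegral_mul [IsFiniteMeasure (volume.restrict Ω)] (hp : 1 ≤ p)
    {w g : EuclideanSpace ℝ (Fin n) → ℂ} {wk : ℕ → EuclideanSpace ℝ (Fin n) → ℂ}
    (hw : MemLp w (ENNReal.ofReal p) (volume.restrict Ω))
    (hwk : ∀ k, MemLp (wk k) (ENNReal.ofReal p) (volume.restrict Ω)) (hg : Continuous g)
    (hgc : HasCompactSupport g)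
    (ht : Tendsto (fun k => eLpNorm (fun x => w x - wk k x) (ENNReal.ofReal p)
      (volume.restrict Ω)) atTop (𝓝 0)) :
    Tendsto (fun k => ∫ x in Ω, wk k x * g x) atTop (𝓝 (∫ x in Ω, w x * g x)) := by
  have hp' : (1 : ENNReal) ≤ ENNReal.ofReal p := by simpa using hp
  obtain ⟨C, hC⟩ := hg.bounded_above_of_compact_support hgc
  have hC0 : 0 ≤ C := (norm_nonneg _).trans (hC 0)
  refine tendsto_integral_of_L1' _ (MemLp.integrable_mul_bounded hp hw hg hgc).1
    (Eventually.of_forall fun k => MemLp.integrable_mul_bounded hp (hwk k) hg hgc) ?_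
  set K : ENNReal := (volume.restrict Ω) Set.univ ^ (1 - 1 / (ENNReal.ofReal p).toReal)
  have hK : K ≠ ⊤ := by
    refine ENNReal.rpow_ne_top_of_nonneg ?_ (measure_ne_top _ _)
    rw [ENNReal.toReal_ofReal (by linarith), sub_nonneg]
    exact div_le_one_of_le₀ hp (by linarith)
  have bound : ∀ k, eLpNorm ((fun x => wk k x * g x) - fun x => w x * g x) 1
      (volume.restrict Ω) ≤ ENNReal.ofReal C *
        (eLpNorm (fun x => w x - wk k x) (ENNReal.ofReal p) (volume.restrict Ω) * K) := by
    intro k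
    have hm : AEStronglyMeasurable (fun x => w x - wk k x) (volume.restrict Ω) :=
      hw.1.sub (hwk k).1
    have := eLpNorm_le_eLpNorm_mul_rpow_measure_univ (μ := volume.restrict Ω) hp' hm
    simp only [ENNReal.toReal_one, div_one] at this
    refine le_trans ?_ (mul_le_mul_right this _)
    refine eLpNorm_le_mul_eLpNorm_of_ae_le_mul (ae_of_all _ fun x => ?_) 1
    simp only [Pi.sub_apply]
    rw [← sub_mul, norm_mul, mul_comm, norm_sub_rev]
    exact mul_le_mul_of_nonneg_right (hC x) (norm_nonneg _)
  refine tendsto_of_tendsto_of_tendsto_of_le_of_le tendsto_const_nhds ?_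
    (fun _ => zero_le) bound
  have t1 := ENNReal.Tendsto.mul_const (b := K) ht (Or.inr hK)
  have t2 := ENNReal.Tendsto.const_mul (a := ENNReal.ofReal C) t1 (Or.inr ENNReal.ofReal_ne_top)
  simpa using t2

/-- The defining relation of weak gradients passes to `L^p` limits. -/
lemma isSobolev_of_tendsto [IsFiniteMeasure (volume.restrict Ω)] (hp : 1 ≤ p)
    (hu : MemLp u (ENNReal.ofReal p) (volume.restrict Ω))
    (hU : MemLp U (ENNReal.ofReal p) (volume.restrict Ω))
    (φ : ℕ → EuclideanSpace ℝ (Fin n) → ℂ) (hφ : ∀ k, IsTestFunction Ω (φ k))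
    (h1 : Tendsto (fun k => eLpNorm (fun x => u x - φ k x) (ENNReal.ofReal p)
      (volume.restrict Ω)) atTop (𝓝 0))
    (h2 : Tendsto (fun k => eLpNorm (fun x => U x - grad (φ k) x) (ENNReal.ofReal p)
      (volume.restrict Ω)) atTop (𝓝 0)) : IsSobolev p Ω u U where
  memLp := hu
  memLp_grad := hU
  weak := by
    intro ψ hψ j
    have c1 := tendsto_setIntegral_mul hp hu (fun k => (hφ k).memLp _ _)
      (IsSobolev.continuous_grad_coord hψ j) (IsSobolev.hasCompactSupport_grad_coord hψ j) h1
    have c2 := tendsto_setIntegral_mul hp (memLp_coord hU j)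
      (fun k => memLp_coord ((hφ k).memLp_grad _ _) j) hψ.smooth.continuous hψ.compact ?_
    · have e : ∀ k, ∫ x in Ω, φ k x * grad ψ x j = -∫ x in Ω, grad (φ k) x j * ψ x := fun k =>
        (isSobolev_of_contDiff p (hφ k).smooth (hφ k).compact).weak ψ hψ j
      simp only [e] at c1
      exact tendsto_nhds_unique c1 c2.neg
    · refine tendsto_of_tendsto_of_tendsto_of_le_of_le tendsto_const_nhds h2
        (fun _ => zero_le) fun k => eLpNorm_mono fun x => ?_
      exact norm_coord_le (U x - grad (φ k) x) j

end Basics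

end PLaplaceBoundary

namespace PLaplaceBoundary

section Energy

variable {n : ℕ} {Ω : Set (EuclideanSpace ℝ (Fin n))} {p : ℝ}
  {u v φ ψ : EuclideanSpace ℝ (Fin n) → ℂ}
  {U V Φ Ψ : EuclideanSpace ℝ (Fin n) → EuclideanSpace ℂ (Fin n)}

lemma IsTestFunction.isSobolevZero (h : IsTestFunction Ω φ) : IsSobolevZero p Ω φ (grad φ) where
  sobolev := isSobolev_of_contDiff p h.smooth h.compact
  approx := ⟨fun _ => φ, fun _ => h, by simp, by simp⟩

lemma isSobolevZero_of_tendsto [IsFiniteMeasure (volume.restrict Ω)] (hp : 1 ≤ p)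
    (hu : MemLp u (ENNReal.ofReal p) (volume.restrict Ω))
    (hU : MemLp U (ENNReal.ofReal p) (volume.restrict Ω))
    (φ : ℕ → EuclideanSpace ℝ (Fin n) → ℂ) (hφ : ∀ k, IsTestFunction Ω (φ k))
    (h1 : Tendsto (fun k => eLpNorm (fun x => u x - φ k x) (ENNReal.ofReal p)
      (volume.restrict Ω)) atTop (𝓝 0))
    (h2 : Tendsto (fun k => eLpNorm (fun x => U x - grad (φ k) x) (ENNReal.ofReal p)
      (volume.restrict Ω)) atTop (𝓝 0)) : IsSobolevZero p Ω u U where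
  sobolev := isSobolev_of_tendsto hp hu hU φ hφ h1 h2
  approx := ⟨φ, hφ, h1, h2⟩

namespace IsSobolevZero

lemma add [IsFiniteMeasure (volume.restrict Ω)] (hp : 1 ≤ p) (hu : IsSobolevZero p Ω u U)
    (hv : IsSobolevZero p Ω v V) :
    IsSobolevZero p Ω (fun x => u x + v x) (fun x => U x + V x) where
  sobolev := hu.sobolev.add hp hv.sobolev
  approx := by
    have hp' : (1 : ENNReal) ≤ ENNReal.ofReal p := by simpa using hp
    obtain ⟨φ, hφ, a1, a2⟩ := hu.approx
    obtain ⟨ψ, hψ, b1, b2⟩ := hv.approx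
    refine ⟨fun k x => φ k x + ψ k x, fun k => (hφ k).add (hψ k), ?_, ?_⟩
    · refine tendsto_of_tendsto_of_tendsto_of_le_of_le tendsto_const_nhds
        (by simpa using a1.add b1) (fun _ => zero_le) fun k => ?_
      have e : (fun x => u x + v x - (φ k x + ψ k x)) =
          (fun x => u x - φ k x) + fun x => v x - ψ k x := by
        ext x; simp only [Pi.add_apply]; ring
      simp only [e]
      exact eLpNorm_add_le (hu.sobolev.memLp.1.sub ((hφ k).memLp 1 _).1)
        (hv.sobolev.memLp.1.sub ((hψ k).memLp 1 _).1) hp'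
    · refine tendsto_of_tendsto_of_tendsto_of_le_of_le tendsto_const_nhds
        (by simpa using a2.add b2) (fun _ => zero_le) fun k => ?_
      have e : (fun x => U x + V x - grad (fun x => φ k x + ψ k x) x) =
          (fun x => U x - grad (φ k) x) + fun x => V x - grad (ψ k) x := by
        ext1 x
        rw [grad_add (hφ k).differentiable (hψ k).differentiable]
        simp only [Pi.add_apply]; abel
      simp only [e]
      exact eLpNorm_add_le (hu.sobolev.memLp_grad.1.sub ((hφ k).memLp_grad 1 _).1)
        (hv.sobolev.memLp_grad.1.sub ((hψ k).memLp_grad 1 _).1) hp'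

lemma const_mul (c : ℂ) (hu : IsSobolevZero p Ω u U) :
    IsSobolevZero p Ω (fun x => c * u x) (fun x => c • U x) where
  sobolev := hu.sobolev.const_mul c
  approx := by
    obtain ⟨φ, hφ, a1, a2⟩ := hu.approx
    refine ⟨fun k x => c * φ k x, fun k => (hφ k).const_mul c, ?_, ?_⟩
    · have e : ∀ k, (fun x => c * u x - c * φ k x) = c • fun x => u x - φ k x := by
        intro k; ext x; simp [mul_sub]
      simp only [e, eLpNorm_const_smul]
      simpa using ENNReal.Tendsto.const_mul a1 (Or.inr (enorm_ne_top (x := c)))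
    · have e : ∀ k, (fun x => c • U x - grad (fun x => c * φ k x) x) =
          c • fun x => U x - grad (φ k) x := by
        intro k; ext1 x; rw [grad_smul c (hφ k).differentiable]; simp [smul_sub]
      simp only [e, eLpNorm_const_smul]
      simpa using ENNReal.Tendsto.const_mul a2 (Or.inr (enorm_ne_top (x := c)))

lemma sub [IsFiniteMeasure (volume.restrict Ω)] (hp : 1 ≤ p) (hu : IsSobolevZero p Ω u U)
    (hv : IsSobolevZero p Ω v V) :
    IsSobolevZero p Ω (fun x => u x - v x) (fun x => U x - V x) := by
  have := hu.add hp (hv.const_mul (-1))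
  simpa [sub_eq_add_neg] using this

lemma conj (hu : IsSobolevZero p Ω u U) :
    IsSobolevZero p Ω (fun x => (starRingEnd ℂ) (u x)) (fun x => conjVec (U x)) where
  sobolev := hu.sobolev.conj
  approx := by
    obtain ⟨φ, hφ, a1, a2⟩ := hu.approx
    refine ⟨fun k x => (starRingEnd ℂ) (φ k x), fun k => (hφ k).conj, ?_, ?_⟩
    · refine a1.congr fun k => eLpNorm_congr_norm_ae (ae_of_all _ fun x => ?_)
      rw [← map_sub, Complex.norm_conj]
    · refine a2.congr fun k => eLpNorm_congr_norm_ae (ae_of_all _ fun x => ?_)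
      rw [grad_conj (hφ k).differentiable, ← conjVec_sub, norm_conjVec]

lemma congr_grad (hu : IsSobolevZero p Ω u U) (h : U =ᵐ[volume.restrict Ω] V) :
    IsSobolevZero p Ω u V where
  sobolev := hu.sobolev.congr_grad h
  approx := by
    obtain ⟨φ, hφ, a1, a2⟩ := hu.approx
    refine ⟨φ, hφ, a1, a2.congr fun k => eLpNorm_congr_ae (h.mono fun x hx => ?_)⟩
    simp [hx]

end IsSobolevZero

lemma SameTrace.isSobolevZero [IsFiniteMeasure (volume.restrict Ω)] (hΩ : IsOpen Ω) (hp : 1 ≤ p)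
    (h : SameTrace p Ω u v) (hu : IsSobolev p Ω u U) (hv : IsSobolev p Ω v V) :
    IsSobolevZero p Ω (fun x => u x - v x) (fun x => U x - V x) := by
  obtain ⟨W, hW⟩ := h
  exact hW.congr_grad (hW.sobolev.grad_unique hΩ hp (hu.sub hp hv))

/-- A measurable coefficient on `Ω` with values between two positive constants. -/
structure IsBoundedCoeff (γ : EuclideanSpace ℝ (Fin n) → ℝ) (Ω : Set (EuclideanSpace ℝ (Fin n)))
    (c C : ℝ) : Prop where
  pos : 0 < c
  meas : AEStronglyMeasurable γ (volume.restrict Ω)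
  lower : ∀ x ∈ Ω, c ≤ γ x
  upper : ∀ x ∈ Ω, γ x ≤ C

lemma exists_isBoundedCoeff {γ : EuclideanSpace ℝ (Fin n) → ℝ} (hΩ : IsOpen Ω)
    (hb : Bornology.IsBounded Ω) (hne : Ω.Nonempty) (hγ : ContinuousOn γ (closure Ω))
    (hpos : ∀ x ∈ closure Ω, 0 < γ x) : ∃ c C, IsBoundedCoeff γ Ω c C := by
  have hK : IsCompact (closure Ω) := hb.isCompact_closure
  have hne' := hne.closure
  obtain ⟨x₀, hx₀, hmin⟩ := hK.exists_isMinOn hne' hγ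
  obtain ⟨x₁, hx₁, hmax⟩ := hK.exists_isMaxOn hne' hγ
  exact ⟨γ x₀, γ x₁, hpos x₀ hx₀,
    (hγ.mono subset_closure).aestronglyMeasurable hΩ.measurableSet,
    fun x hx => hmin (subset_closure hx), fun x hx => hmax (subset_closure hx)⟩

/-- The weighted `p`-energy of a vector field. -/
noncomputable def energy (p : ℝ) (γ : EuclideanSpace ℝ (Fin n) → ℝ)
    (Ω : Set (EuclideanSpace ℝ (Fin n)))
    (U : EuclideanSpace ℝ (Fin n) → EuclideanSpace ℂ (Fin n)) : ℝ :=
  ∫ x in Ω, γ x * ‖U x‖ ^ p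

lemma rpow_sub_two_mul_self {t : ℝ} (ht : 0 ≤ t) (hp : 1 < p) : t ^ (p - 2) * t = t ^ (p - 1) := by
  rcases ht.eq_or_lt with rfl | h
  · rw [mul_zero, Real.zero_rpow (by linarith)]
  · rw [← Real.rpow_add_one h.ne']; ring_nf

lemma rpow_sub_one_mul_self {t : ℝ} (ht : 0 ≤ t) (hp : 1 < p) : t ^ (p - 1) * t = t ^ p := by
  rcases ht.eq_or_lt with rfl | h
  · rw [mul_zero, Real.zero_rpow (by linarith)]
  · rw [← Real.rpow_add_one h.ne']; ring_nf

lemma rpow_sub_one_mul_le {s t : ℝ} (hs : 0 ≤ s) (ht : 0 ≤ t) (hp : 1 < p) :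
    s ^ (p - 1) * t ≤ s ^ p + t ^ p := by
  rcases le_total s t with h | h
  · calc s ^ (p - 1) * t ≤ t ^ (p - 1) * t := by gcongr
      _ = t ^ p := rpow_sub_one_mul_self ht hp
      _ ≤ _ := le_add_of_nonneg_left (Real.rpow_nonneg hs _)
  · calc s ^ (p - 1) * t ≤ s ^ (p - 1) * s := by gcongr
      _ = s ^ p := rpow_sub_one_mul_self hs hp
      _ ≤ _ := le_add_of_nonneg_right (Real.rpow_nonneg ht _)

/-- The tangent line inequality for `t ↦ t ^ p`. -/
lemma rpow_tangent_le {s t : ℝ} (hs : 0 ≤ s) (ht : 0 ≤ t) (hp : 1 < p) :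
    s ^ p + p * s ^ (p - 1) * (t - s) ≤ t ^ p := by
  rcases hs.eq_or_lt with rfl | h
  · rw [Real.zero_rpow (by linarith), Real.zero_rpow (by linarith)]
    simpa using Real.rpow_nonneg ht _
  · have hb := one_add_mul_self_le_rpow_one_add (s := t / s - 1) (p := p)
      (by linarith [div_nonneg ht hs]) hp.le
    rw [add_sub_cancel, Real.div_rpow ht hs, le_div_iff₀ (Real.rpow_pos_of_pos h p)] at hb
    refine le_trans (le_of_eq ?_) hb
    rw [← rpow_sub_one_mul_self hs hp]
    field_simp

lemma norm_rpow_tangent_le {n : ℕ} (a b : EuclideanSpace ℂ (Fin n)) (hp : 1 < p) :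
    ‖a‖ ^ p + p * (‖a‖ ^ (p - 2) * (∑ j, a j * (starRingEnd ℂ) (b j)).re) ≤ ‖a + b‖ ^ p := by
  have h1 : (∑ j, a j * (starRingEnd ℂ) (b j)).re ≤ ‖a‖ * ‖a + b‖ - ‖a‖ * ‖a‖ := by
    have e : ∑ j, a j * (starRingEnd ℂ) (b j) =
        ∑ j, a j * conjVec (a + b) j - ∑ j, a j * (starRingEnd ℂ) (a j) := by
      rw [← Finset.sum_sub_distrib]
      refine Finset.sum_congr rfl fun j _ => ?_
      simp only [conjVec_apply, PiLp.add_apply, map_add]; ring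
    rw [e, sum_mul_conj_self, Complex.sub_re, Complex.ofReal_re, ← sq]
    gcongr
    exact (Complex.re_le_norm _).trans ((norm_sum_mul_le _ _).trans (by rw [norm_conjVec]))
  have h2 := rpow_tangent_le (norm_nonneg a) (norm_nonneg (a + b)) hp
  refine le_trans ?_ h2
  rw [mul_assoc p]
  refine add_le_add_right (mul_le_mul_of_nonneg_left ?_ (by linarith)) _
  calc ‖a‖ ^ (p - 2) * (∑ j, a j * (starRingEnd ℂ) (b j)).re
      ≤ ‖a‖ ^ (p - 2) * (‖a‖ * ‖a + b‖ - ‖a‖ * ‖a‖) := by gcongr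
    _ = ‖a‖ ^ (p - 2) * ‖a‖ * (‖a + b‖ - ‖a‖) := by ring
    _ = _ := by rw [rpow_sub_two_mul_self (norm_nonneg a) hp]

variable {γ : EuclideanSpace ℝ (Fin n) → ℝ} {c C : ℝ}

lemma integrable_norm_rpow (hp : 1 < p) (hU : MemLp U (ENNReal.ofReal p) (volume.restrict Ω)) :
    Integrable (fun x => ‖U x‖ ^ p) (volume.restrict Ω) := by
  have := hU.integrable_norm_rpow (by simpa using by linarith) ENNReal.ofReal_ne_top
  rwa [ENNReal.toReal_ofReal (by linarith)] at this

namespace IsBoundedCoeff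

lemma ae_bounds (hγ : IsBoundedCoeff γ Ω c C) (hΩ : IsOpen Ω) :
    ∀ᵐ x ∂volume.restrict Ω, c ≤ γ x ∧ γ x ≤ C := by
  filter_upwards [ae_restrict_mem hΩ.measurableSet] with x hx using ⟨hγ.lower x hx, hγ.upper x hx⟩

lemma integrable_energy (hγ : IsBoundedCoeff γ Ω c C) (hΩ : IsOpen Ω) (hp : 1 < p)
    (hU : MemLp U (ENNReal.ofReal p) (volume.restrict Ω)) :
    Integrable (fun x => γ x * ‖U x‖ ^ p) (volume.restrict Ω) := by
  refine (integrable_norm_rpow hp hU).bdd_mul (c := C) hγ.meas ?_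
  filter_upwards [hγ.ae_bounds hΩ] with x hx
  rw [Real.norm_of_nonneg (hγ.pos.le.trans hx.1)]; exact hx.2

lemma aestronglyMeasurable_flux (hγ : IsBoundedCoeff γ Ω c C)
    (hU : AEStronglyMeasurable U (volume.restrict Ω)) :
    AEStronglyMeasurable (flux p γ U) (volume.restrict Ω) := by
  have h1 : AEMeasurable (fun x => γ x * ‖U x‖ ^ (p - 2)) (volume.restrict Ω) :=
    hγ.meas.aemeasurable.mul (hU.norm.aemeasurable.pow_const _)
  exact (Complex.continuous_ofReal.comp_aestronglyMeasurable h1.aestronglyMeasurable).smul hU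

lemma norm_flux (hγ : IsBoundedCoeff γ Ω c C) (hp : 1 < p) {x} (hx : x ∈ Ω) :
    ‖flux p γ U x‖ = γ x * ‖U x‖ ^ (p - 1) := by
  have h0 : 0 ≤ γ x := hγ.pos.le.trans (hγ.lower x hx)
  rw [flux, norm_smul, Complex.norm_real, Real.norm_of_nonneg (by positivity), mul_assoc,
    rpow_sub_two_mul_self (norm_nonneg _) hp]

lemma integrable_flux_mul (hγ : IsBoundedCoeff γ Ω c C) (hΩ : IsOpen Ω) (hp : 1 < p)
    (hU : MemLp U (ENNReal.ofReal p) (volume.restrict Ω))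
    (hΦ : MemLp Φ (ENNReal.ofReal p) (volume.restrict Ω)) :
    Integrable (fun x => ∑ j, flux p γ U x j * Φ x j) (volume.restrict Ω) := by
  have hi := ((integrable_norm_rpow hp hU).add (integrable_norm_rpow hp hΦ)).const_mul C
  refine hi.mono' ?_ ?_
  · have hF := hγ.aestronglyMeasurable_flux (p := p) hU.1
    simp only [sum_mul_eq_inner]
    exact (continuous_conjVec.comp_aestronglyMeasurable hF).inner hΦ.1
  · filter_upwards [ae_restrict_mem hΩ.measurableSet] with x hx
    have h0 : 0 ≤ γ x := hγ.pos.le.trans (hγ.lower x hx)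
    calc ‖∑ j, flux p γ U x j * Φ x j‖ ≤ ‖flux p γ U x‖ * ‖Φ x‖ := norm_sum_mul_le _ _
      _ = γ x * (‖U x‖ ^ (p - 1) * ‖Φ x‖) := by rw [hγ.norm_flux hp hx]; ring
      _ ≤ C * (‖U x‖ ^ p + ‖Φ x‖ ^ p) := by
        refine mul_le_mul (hγ.upper x hx)
          (rpow_sub_one_mul_le (norm_nonneg _) (norm_nonneg _) hp) (by positivity)
          (h0.trans (hγ.upper x hx))

end IsBoundedCoeff

lemma flux_mul_conj_self (hp : 1 < p) (x : EuclideanSpace ℝ (Fin n)) :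
    ∑ j, flux p γ U x j * (starRingEnd ℂ) (U x j) = ((γ x * ‖U x‖ ^ p : ℝ) : ℂ) := by
  simp only [flux, PiLp.smul_apply, smul_eq_mul, mul_assoc]
  rw [← Finset.mul_sum, sum_mul_conj_self, ← Complex.ofReal_mul, mul_assoc, sq, ← mul_assoc _ ‖U x‖,
    rpow_sub_two_mul_self (norm_nonneg _) hp, rpow_sub_one_mul_self (norm_nonneg _) hp]

/-- Weak solutions minimize the energy among competitors with the same boundary values. -/
lemma energy_le_of_equation (hγ : IsBoundedCoeff γ Ω c C) (hΩ : IsOpen Ω) (hp : 1 < p)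
    (hU : MemLp U (ENNReal.ofReal p) (volume.restrict Ω))
    (hΦ : MemLp Φ (ENNReal.ofReal p) (volume.restrict Ω))
    (heq : ∫ x in Ω, ∑ j, flux p γ U x j * (starRingEnd ℂ) (Φ x j) = 0) :
    energy p γ Ω U ≤ energy p γ Ω (fun x => U x + Φ x) := by
  have hi := hγ.integrable_flux_mul hΩ hp hU (memLp_conjVec hΦ)
  simp only [conjVec_apply] at hi
  have hire : Integrable (fun x => p * (∑ j, flux p γ U x j * (starRingEnd ℂ) (Φ x j)).re)
      (volume.restrict Ω) := hi.re.const_mul p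
  have h0 : ∫ x in Ω, (∑ j, flux p γ U x j * (starRingEnd ℂ) (Φ x j)).re = 0 := by
    have := integral_re hi
    simp only [RCLike.re_to_complex] at this
    rw [this, heq]; simp
  have e : energy p γ Ω U = ∫ x in Ω, (γ x * ‖U x‖ ^ p +
      p * (∑ j, flux p γ U x j * (starRingEnd ℂ) (Φ x j)).re) := by
    rw [integral_add (hγ.integrable_energy hΩ hp hU) hire, integral_const_mul, h0,
      mul_zero, add_zero, energy]
  rw [e, energy]
  refine setIntegral_mono_on ((hγ.integrable_energy hΩ hp hU).add hire)
    (hγ.integrable_energy hΩ hp (hU.add hΦ)) hΩ.measurableSet fun x hx => ?_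
  have h0 : 0 ≤ γ x := hγ.pos.le.trans (hγ.lower x hx)
  have key := mul_le_mul_of_nonneg_left (norm_rpow_tangent_le (U x) (Φ x) hp) h0
  refine le_trans (le_of_eq ?_) key
  simp only [flux, PiLp.smul_apply, smul_eq_mul, mul_assoc]
  rw [← Finset.mul_sum, Complex.re_ofReal_mul]
  ring

/-- A value of the Dirichlet-to-Neumann pairing of `f` with itself is the minimal energy. -/
lemma IsDNValue.exists_minimizer [IsFiniteMeasure (volume.restrict Ω)]
    (hγ : IsBoundedCoeff γ Ω c C) (hΩ : IsOpen Ω) (hp : 1 < p) (hφ : ContDiff ℝ ∞ φ)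
    (hc : HasCompactSupport φ) {ℓ : ℂ} (h : IsDNValue p γ Ω φ φ ℓ) :
    ∃ w W, IsSobolevZero p Ω w W ∧ ℓ = ((energy p γ Ω (fun x => grad φ x + W x) : ℝ) : ℂ) ∧
      ∀ ψ Ψ, IsSobolevZero p Ω ψ Ψ →
        energy p γ Ω (fun x => grad φ x + W x) ≤ energy p γ Ω (fun x => grad φ x + Ψ x) := by
  obtain ⟨u, v, U, V, hu, hv, hvφ, rfl⟩ := h
  have hsφ : IsSobolev p Ω φ (grad φ) := isSobolev_of_contDiff p hφ hc
  have hw := hu.boundary.isSobolevZero hΩ hp.le hu.sobolev hsφ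
  have hz := hvφ.isSobolevZero hΩ hp.le hv hsφ
  refine ⟨_, _, hw, ?_, ?_⟩
  · have hd := (hz.sub hp.le hw).conj
    have h0 := hu.equation _ _ hd
    have hi1 := hγ.integrable_flux_mul hΩ hp hu.sobolev.memLp_grad
      (memLp_conjVec hu.sobolev.memLp_grad)
    have hi2 := hγ.integrable_flux_mul hΩ hp hu.sobolev.memLp_grad hd.sobolev.memLp_grad
    have e : ∀ x, ∑ j, flux p γ U x j * (starRingEnd ℂ) (V x j) =
        ∑ j, flux p γ U x j * conjVec (U x) j +
        ∑ j, flux p γ U x j * conjVec (V x - grad φ x - (U x - grad φ x)) j := by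
      intro x
      rw [← Finset.sum_add_distrib]
      refine Finset.sum_congr rfl fun j _ => ?_
      simp only [conjVec_apply, PiLp.sub_apply, map_sub]; ring
    simp only [e]
    rw [integral_add hi1 hi2, h0, add_zero]
    simp only [conjVec_apply, flux_mul_conj_self hp, add_sub_cancel]
    rw [integral_complex_ofReal, energy]
  · intro ψ Ψ hψ
    have hd := hψ.sub hp.le hw
    have h1 := energy_le_of_equation hγ hΩ hp hu.sobolev.memLp_grad hd.sobolev.memLp_grad
      (hu.equation _ _ hd.conj)
    have e1 : ∀ x, grad φ x + (U x - grad φ x) = U x := fun x => by abel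
    have e2 : ∀ x, U x + (Ψ x - (U x - grad φ x)) = grad φ x + Ψ x := fun x => by abel
    simp only [e1]
    simpa only [e2] using h1

lemma IsDNValue.unique [IsFiniteMeasure (volume.restrict Ω)]
    (hγ : IsBoundedCoeff γ Ω c C) (hΩ : IsOpen Ω) (hp : 1 < p) (hφ : ContDiff ℝ ∞ φ)
    (hc : HasCompactSupport φ) {ℓ ℓ' : ℂ} (h : IsDNValue p γ Ω φ φ ℓ)
    (h' : IsDNValue p γ Ω φ φ ℓ') : ℓ = ℓ' := by
  obtain ⟨w, W, hW, rfl, hmin⟩ := h.exists_minimizer hγ hΩ hp hφ hc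
  obtain ⟨w', W', hW', rfl, hmin'⟩ := h'.exists_minimizer hγ hΩ hp hφ hc
  rw [le_antisymm (hmin _ _ hW') (hmin' _ _ hW)]

end Energy

end PLaplaceBoundary

namespace PLaplaceBoundary

section Hardy

variable {n : ℕ} {Ω : Set (EuclideanSpace ℝ (Fin n))} {p : ℝ}
  {φ : EuclideanSpace ℝ (Fin n) → ℂ}

lemma rpow_sub_one_mul_le_half {a b : ℝ} (ha : 0 ≤ a) (hb : 0 ≤ b) (hp : 1 < p) :
    a ^ (p - 1) * b ≤ a ^ p / 2 + 2 ^ (p - 1) * b ^ p := by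
  have hap := Real.rpow_nonneg ha p
  have hbp := Real.rpow_nonneg hb p
  have h2p : (0 : ℝ) < 2 ^ (p - 1) := by positivity
  rcases le_total b (a / 2) with h | h
  · calc a ^ (p - 1) * b ≤ a ^ (p - 1) * (a / 2) := by gcongr
      _ = a ^ (p - 1) * a / 2 := by ring
      _ = a ^ p / 2 := by rw [rpow_sub_one_mul_self ha hp]
      _ ≤ _ := le_add_of_nonneg_right (by positivity)
  · calc a ^ (p - 1) * b ≤ (2 * b) ^ (p - 1) * b := by
          gcongr; linarith
      _ = 2 ^ (p - 1) * (b ^ (p - 1) * b) := by rw [Real.mul_rpow two_pos.le hb]; ring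
      _ = 2 ^ (p - 1) * b ^ p := by rw [rpow_sub_one_mul_self hb hp]
      _ ≤ _ := le_add_of_nonneg_left (by positivity)

lemma norm_fderiv_norm_rpow_single_le (hp : 1 < p) (hφ : Differentiable ℝ φ) (j : Fin n)
    (x : EuclideanSpace ℝ (Fin n)) :
    |fderiv ℝ (fun x => ‖φ x‖ ^ p) x (EuclideanSpace.single j 1)| ≤
      p * (‖φ x‖ ^ (p - 1) * ‖grad φ x‖) := by
  rw [hφ.fderiv_norm_rpow hp]
  simp only [_root_.smul_apply, ContinuousLinearMap.comp_apply, innerSL_apply_apply,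
    smul_eq_mul, abs_mul]
  rw [abs_of_nonneg (by linarith : (0 : ℝ) ≤ p), abs_of_nonneg (by positivity), mul_assoc,
    ← rpow_sub_two_mul_self (norm_nonneg _) hp, mul_assoc]
  have h1 := abs_real_inner_le_norm (φ x) (fderiv ℝ φ x (EuclideanSpace.single j 1))
  have h2 := norm_fderiv_le_grad (φ := φ) x j
  have hp0 : 0 ≤ p := by linarith
  gcongr
  exact h1.trans (by gcongr)

/-- A weighted Hardy type inequality obtained from one integration by parts. -/
lemma weighted_hardy (hΩ : IsOpen Ω) (hp : 1 < p) {F : EuclideanSpace ℝ (Fin n) → ℝ}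
    (hF : ContDiff ℝ 1 F) (hφ : IsTestFunction Ω φ) (j : Fin n) {K : ℝ} (hK : 0 < K)
    (h : ∀ x ∈ Ω, |F x| ≤ K * fderiv ℝ F x (EuclideanSpace.single j 1)) :
    ∫ x in Ω, fderiv ℝ F x (EuclideanSpace.single j 1) * ‖φ x‖ ^ p ≤
      (2 * p * K) ^ p *
        ∫ x in Ω, fderiv ℝ F x (EuclideanSpace.single j 1) * ‖grad φ x‖ ^ p := by
  have hp0 : 0 < p := by linarith
  have hgc : ContDiff ℝ 1 fun x => ‖φ x‖ ^ p := (hφ.smooth.of_le (by simp)).norm_rpow hp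
  have hgs : HasCompactSupport fun x => ‖φ x‖ ^ p :=
    hφ.compact.comp_left (g := fun z : ℂ => ‖z‖ ^ p) (by simp [hp0.ne'])
  have hGs : HasCompactSupport fun x => ‖grad φ x‖ ^ p :=
    (hasCompactSupport_grad hφ.compact).comp_left
      (g := fun z : EuclideanSpace ℂ (Fin n) => ‖z‖ ^ p) (by simp [hp0.ne'])
  have hGc : Continuous fun x => ‖grad φ x‖ ^ p :=
    (continuous_grad hφ.smooth).norm.rpow_const fun _ => Or.inr hp0.le
  have hF' : Continuous fun x => fderiv ℝ F x (EuclideanSpace.single j 1) :=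
    (hF.continuous_fderiv (by simp)).clm_apply continuous_const
  have hg' : Continuous fun x =>
      fderiv ℝ (fun x => ‖φ x‖ ^ p) x (EuclideanSpace.single j 1) :=
    (hgc.continuous_fderiv (by simp)).clm_apply continuous_const
  have i1 := (hF'.mul hgc.continuous).integrable_of_hasCompactSupport (μ := volume) hgs.mul_left
  have i2 := (hF.continuous.mul hg').integrable_of_hasCompactSupport (μ := volume)
    ((hgs.fderiv_apply (𝕜 := ℝ) _).mul_left)
  have i3 := (hF'.mul hGc).integrable_of_hasCompactSupport (μ := volume) hGs.mul_left
  simp only [Pi.mul_def] at i1 i2 i3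
  have ibp := integral_mul_fderiv_eq_neg_fderiv_mul_of_integrable (𝕜 := ℝ) (μ := volume)
    (f := F) (g := fun x => ‖φ x‖ ^ p) (v := EuclideanSpace.single j (1 : ℝ)) i1 i2
    ((hF.continuous.mul hgc.continuous).integrable_of_hasCompactSupport hgs.mul_left)
    (fun x _ => hF.differentiable (by simp) x) (fun x _ => hgc.differentiable (by simp) x)
  have hout : ∀ x, x ∉ Ω → φ x = 0 := fun x hx => hφ.eq_zero hx
  rw [← setIntegral_eq_integral_of_forall_compl_eq_zero (s := Ω),
    ← setIntegral_eq_integral_of_forall_compl_eq_zero (s := Ω) (f := fun x => _ * ‖φ x‖ ^ p)] at ibp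
  rotate_left
  · intro x hx; simp [hout x hx, hp0.ne']
  · intro x hx
    have := norm_fderiv_norm_rpow_single_le hp hφ.differentiable j x
    rw [hφ.grad_eq_zero hx, norm_zero, mul_zero, mul_zero] at this
    rw [abs_nonpos_iff.1 this, mul_zero]
  have hmono : -∫ x in Ω, F x * fderiv ℝ (fun x => ‖φ x‖ ^ p) x (EuclideanSpace.single j 1) ≤
      ∫ x in Ω, (fderiv ℝ F x (EuclideanSpace.single j 1) * ‖φ x‖ ^ p / 2 +
        2 ^ (p - 1) * (p * K) ^ p *
          (fderiv ℝ F x (EuclideanSpace.single j 1) * ‖grad φ x‖ ^ p)) := by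
    rw [← integral_neg]
    refine setIntegral_mono_on i2.neg.integrableOn
      ((i1.div_const 2).add (i3.const_mul _)).integrableOn hΩ.measurableSet fun x hx => ?_
    have hD := h x hx
    set D := fderiv ℝ F x (EuclideanSpace.single j 1)
    have hD0 : 0 ≤ D := by
      have := (abs_nonneg _).trans hD
      exact nonneg_of_mul_nonneg_right this hK
    have hd := norm_fderiv_norm_rpow_single_le hp hφ.differentiable j x
    have hy := rpow_sub_one_mul_le_half (norm_nonneg (φ x))
      (by positivity : 0 ≤ p * K * ‖grad φ x‖) hp
    calc -(F x * fderiv ℝ (fun x => ‖φ x‖ ^ p) x (EuclideanSpace.single j 1))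
        ≤ |F x| * |fderiv ℝ (fun x => ‖φ x‖ ^ p) x (EuclideanSpace.single j 1)| := by
          rw [← abs_mul]; exact neg_le_abs _
      _ ≤ K * D * (p * (‖φ x‖ ^ (p - 1) * ‖grad φ x‖)) :=
          mul_le_mul hD hd (abs_nonneg _) (by positivity)
      _ = D * (‖φ x‖ ^ (p - 1) * (p * K * ‖grad φ x‖)) := by ring
      _ ≤ D * (‖φ x‖ ^ p / 2 + 2 ^ (p - 1) * (p * K * ‖grad φ x‖) ^ p) := by gcongr
      _ = _ := by rw [Real.mul_rpow (by positivity) (norm_nonneg _)]; ring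
  rw [integral_add (i1.div_const 2).integrableOn (i3.const_mul _).integrableOn,
    integral_div, integral_const_mul, ibp, neg_neg] at hmono
  have e : (2 * p * K) ^ p = 2 * (2 ^ (p - 1) * (p * K) ^ p) := by
    rw [mul_assoc 2 p K, Real.mul_rpow two_pos.le (by positivity), Real.rpow_sub_one two_ne_zero]
    ring
  rw [e]
  linarith

/-- The Poincaré inequality on a bounded open set. -/
lemma poincare (hΩ : IsOpen Ω) (hp : 1 < p) {R : ℝ} (hR : 0 < R) (hb : Ω ⊆ Metric.ball 0 R)
    (j : Fin n) (hφ : IsTestFunction Ω φ) :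
    ∫ x in Ω, ‖φ x‖ ^ p ≤ (2 * p * (2 * R)) ^ p * ∫ x in Ω, ‖grad φ x‖ ^ p := by
  have hd : ∀ x : EuclideanSpace ℝ (Fin n), HasFDerivAt
      (fun x : EuclideanSpace ℝ (Fin n) => x j + R)
      (EuclideanSpace.proj j : EuclideanSpace ℝ (Fin n) →L[ℝ] ℝ) x :=
    fun x =>
    ((EuclideanSpace.proj j : EuclideanSpace ℝ (Fin n) →L[ℝ] ℝ).hasFDerivAt).add_const R
  have h1 : ∀ x : EuclideanSpace ℝ (Fin n), fderiv ℝ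
      (fun x : EuclideanSpace ℝ (Fin n) => x j + R) x (EuclideanSpace.single j 1) = 1 := by
    intro x; rw [(hd x).fderiv]; simp
  have hF : ContDiff ℝ 1 (fun x : EuclideanSpace ℝ (Fin n) => x j + R) :=
    (EuclideanSpace.proj j : EuclideanSpace ℝ (Fin n) →L[ℝ] ℝ).contDiff.add contDiff_const
  have := weighted_hardy hΩ hp hF hφ j (K := 2 * R) (by positivity) fun x hx => by
    rw [h1, mul_one]
    have h2 : |x j| ≤ ‖x‖ := by simpa using PiLp.norm_apply_le x j
    have h3 : ‖x‖ < R := by simpa using hb hx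
    rw [abs_le] at h2 ⊢
    constructor <;> linarith [h2.1, h2.2]
  simpa only [h1, one_mul] using this

lemma eLpNorm_le_of_integral_le {F G : Type*} [NormedAddCommGroup F] [NormedAddCommGroup G]
    {α : Type*} [MeasurableSpace α] {μ : Measure α} {f : α → F} {g : α → G} (hp : 1 < p) {K : ℝ}
    (hK : 0 ≤ K) (hf : MemLp f (ENNReal.ofReal p) μ) (hg : MemLp g (ENNReal.ofReal p) μ)
    (h : ∫ x, ‖f x‖ ^ p ∂μ ≤ K ^ p * ∫ x, ‖g x‖ ^ p ∂μ) :
    eLpNorm f (ENNReal.ofReal p) μ ≤ ENNReal.ofReal K * eLpNorm g (ENNReal.ofReal p) μ := by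
  have hp0 : 0 < p := by linarith
  have h0 : ENNReal.ofReal p ≠ 0 := by simpa using hp0
  rw [hf.eLpNorm_eq_integral_rpow_norm h0 ENNReal.ofReal_ne_top,
    hg.eLpNorm_eq_integral_rpow_norm h0 ENNReal.ofReal_ne_top, ENNReal.toReal_ofReal hp0.le,
    ← ENNReal.ofReal_mul hK]
  refine ENNReal.ofReal_le_ofReal ?_
  have hI : 0 ≤ ∫ x, ‖g x‖ ^ p ∂μ := integral_nonneg fun x => by positivity
  calc (∫ x, ‖f x‖ ^ p ∂μ) ^ p⁻¹ ≤ (K ^ p * ∫ x, ‖g x‖ ^ p ∂μ) ^ p⁻¹ :=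
        Real.rpow_le_rpow (integral_nonneg fun x => by positivity) h (by positivity)
    _ = _ := by
      rw [Real.mul_rpow (by positivity) hI, Real.rpow_rpow_inv hK hp0.ne']

end Hardy

end PLaplaceBoundary

namespace PLaplaceBoundary

section UniformConvexity

variable {V : Type*} [NormedAddCommGroup V] {p : ℝ}

lemma norm_sub_rpow_le (hp : 1 < p) (a b : V) :
    ‖a - b‖ ^ p ≤ 2 ^ p * (‖a‖ ^ p + ‖b‖ ^ p) := by
  have hp0 : 0 ≤ p := by linarith
  have hm : ‖a - b‖ ≤ 2 * max ‖a‖ ‖b‖ := by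
    linarith [norm_sub_le a b, le_max_left ‖a‖ ‖b‖, le_max_right ‖a‖ ‖b‖]
  have hx : (max ‖a‖ ‖b‖) ^ p ≤ ‖a‖ ^ p + ‖b‖ ^ p := by
    rcases max_choice ‖a‖ ‖b‖ with h | h <;> rw [h]
    · exact le_add_of_nonneg_right (by positivity)
    · exact le_add_of_nonneg_left (by positivity)
  calc ‖a - b‖ ^ p ≤ (2 * max ‖a‖ ‖b‖) ^ p := by gcongr
    _ = 2 ^ p * (max ‖a‖ ‖b‖) ^ p := Real.mul_rpow two_pos.le (by positivity)
    _ ≤ _ := by gcongr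

variable [NormedSpace ℝ V]

lemma norm_midpoint_rpow_le (hp : 1 < p) (a b : V) :
    ‖(1 / 2 : ℝ) • (a + b)‖ ^ p ≤ (‖a‖ ^ p + ‖b‖ ^ p) / 2 := by
  have h1 : ‖(1 / 2 : ℝ) • (a + b)‖ ≤ (1 / 2 : ℝ) • ‖a‖ + (1 / 2 : ℝ) • ‖b‖ := by
    rw [norm_smul, Real.norm_of_nonneg (by norm_num), smul_eq_mul, smul_eq_mul, ← mul_add]
    gcongr; exact norm_add_le a b
  have h2 := (convexOn_rpow hp.le).2 (Set.mem_Ici.2 (norm_nonneg a)) (Set.mem_Ici.2 (norm_nonneg b))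
    (by norm_num : (0 : ℝ) ≤ 1 / 2) (by norm_num : (0 : ℝ) ≤ 1 / 2) (by norm_num)
  refine (Real.rpow_le_rpow (norm_nonneg _) h1 (by linarith)).trans (h2.trans (le_of_eq ?_))
  simp only [smul_eq_mul]; ring

lemma norm_midpoint_rpow_lt [StrictConvexSpace ℝ V] (hp : 1 < p) {a b : V} (hab : a ≠ b) :
    ‖(1 / 2 : ℝ) • (a + b)‖ ^ p < (‖a‖ ^ p + ‖b‖ ^ p) / 2 := by
  by_cases h : ‖a‖ = ‖b‖
  · have h1 := (norm_midpoint_lt_iff h).2 hab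
    calc _ < ‖a‖ ^ p := Real.rpow_lt_rpow (norm_nonneg _) h1 (by linarith)
      _ = _ := by rw [← h]; ring
  · have h1 : ‖(1 / 2 : ℝ) • (a + b)‖ ≤ (1 / 2 : ℝ) • ‖a‖ + (1 / 2 : ℝ) • ‖b‖ := by
      rw [norm_smul, Real.norm_of_nonneg (by norm_num), smul_eq_mul, smul_eq_mul, ← mul_add]
      gcongr; exact norm_add_le a b
    have h2 := (strictConvexOn_rpow hp).2 (Set.mem_Ici.2 (norm_nonneg a))
      (Set.mem_Ici.2 (norm_nonneg b))
      h (by norm_num : (0 : ℝ) < 1 / 2) (by norm_num : (0 : ℝ) < 1 / 2) (by norm_num)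
    refine (Real.rpow_le_rpow (norm_nonneg _) h1 (by linarith)).trans_lt (h2.trans_eq ?_)
    simp only [smul_eq_mul]; ring

/-- A quantitative form of the strict convexity of `a ↦ ‖a‖ ^ p`, by compactness and
homogeneity. -/
lemma exists_norm_sub_rpow_le [StrictConvexSpace ℝ V] [ProperSpace V] (hp : 1 < p) {ε : ℝ}
    (hε : 0 < ε) : ∃ C : ℝ, 0 ≤ C ∧ ∀ a b : V, ‖a - b‖ ^ p ≤ ε * (‖a‖ ^ p + ‖b‖ ^ p) +
      C * ((‖a‖ ^ p + ‖b‖ ^ p) / 2 - ‖(1 / 2 : ℝ) • (a + b)‖ ^ p) := by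
  have hp0 : 0 < p := by linarith
  have cont : ∀ f : V × V → V, Continuous f → Continuous fun z => ‖f z‖ ^ p := fun f hf =>
    hf.norm.rpow_const fun _ => Or.inr hp0.le
  have c1 := cont (fun z => z.1) continuous_fst
  have c2 := cont (fun z => z.2) continuous_snd
  have c3 := cont (fun z => z.1 - z.2) (by fun_prop)
  have c4 := cont (fun z => (1 / 2 : ℝ) • (z.1 + z.2)) (by fun_prop)
  set K : Set (V × V) := {z | ‖z.1‖ ^ p + ‖z.2‖ ^ p = 1 ∧ ε ≤ ‖z.1 - z.2‖ ^ p}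
  have hK : IsCompact K := by
    refine Metric.isCompact_of_isClosed_isBounded ?_ ?_
    · exact (isClosed_eq (c1.add c2) continuous_const).inter (isClosed_le continuous_const c3)
    · refine (Metric.isBounded_closedBall (x := (0 : V × V)) (r := 1)).subset fun z hz => ?_
      have h1 : 0 ≤ ‖z.1‖ ^ p := by positivity
      have h2 : 0 ≤ ‖z.2‖ ^ p := by positivity
      have h3 := hz.1
      rw [mem_closedBall_zero_iff, Prod.norm_def, max_le_iff]
      constructor
      · exact (Real.rpow_le_rpow_iff (norm_nonneg _) zero_le_one hp0).1
          (by rw [Real.one_rpow]; linarith)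
      · exact (Real.rpow_le_rpow_iff (norm_nonneg _) zero_le_one hp0).1
          (by rw [Real.one_rpow]; linarith)
  have hpos : ∀ z ∈ K, 0 < (‖z.1‖ ^ p + ‖z.2‖ ^ p) / 2 - ‖(1 / 2 : ℝ) • (z.1 + z.2)‖ ^ p := by
    intro z hz
    refine sub_pos.2 (norm_midpoint_rpow_lt hp fun h => ?_)
    have := hz.2
    rw [h, sub_self, norm_zero, Real.zero_rpow hp0.ne'] at this
    linarith
  obtain ⟨m, hm, hmK⟩ : ∃ m : ℝ, 0 < m ∧ ∀ z ∈ K,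
      m ≤ (‖z.1‖ ^ p + ‖z.2‖ ^ p) / 2 - ‖(1 / 2 : ℝ) • (z.1 + z.2)‖ ^ p := by
    rcases K.eq_empty_or_nonempty with h | h
    · exact ⟨1, one_pos, by simp [h]⟩
    · obtain ⟨z, hz, hmin⟩ := hK.exists_isMinOn h
        (((c1.add c2).div_const 2).sub c4).continuousOn
      exact ⟨_, hpos z hz, fun w hw => hmin hw⟩
  refine ⟨2 ^ p / m, by positivity, fun a b => ?_⟩
  set s : ℝ := ‖a‖ ^ p + ‖b‖ ^ p
  have hs0 : 0 ≤ s := by positivity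
  have hD := sub_nonneg.2 (norm_midpoint_rpow_le hp a b)
  by_cases hcase : ‖a - b‖ ^ p ≤ ε * s
  · have : 0 ≤ 2 ^ p / m * (s / 2 - ‖(1 / 2 : ℝ) • (a + b)‖ ^ p) := by positivity
    linarith
  push Not at hcase
  have hs : 0 < s := by
    refine hs0.lt_of_ne fun h => ?_
    have := norm_sub_rpow_le hp a b
    rw [show ‖a‖ ^ p + ‖b‖ ^ p = s from rfl, ← h] at this
    rw [← h] at hcase
    linarith
  set t : ℝ := s ^ (-p⁻¹)
  have ht : 0 < t := Real.rpow_pos_of_pos hs _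
  have htp : t ^ p = s⁻¹ := by
    rw [← Real.rpow_mul hs0, neg_mul, inv_mul_cancel₀ hp0.ne', Real.rpow_neg_one]
  have hsm : ∀ x : V, ‖t • x‖ ^ p = s⁻¹ * ‖x‖ ^ p := fun x => by
    rw [norm_smul, Real.norm_of_nonneg ht.le, Real.mul_rpow ht.le (norm_nonneg _), htp]
  have hmem : (t • a, t • b) ∈ K := by
    refine ⟨?_, ?_⟩
    · simp only [hsm]; rw [← mul_add]; exact inv_mul_cancel₀ hs.ne'
    · simp only [← smul_sub, hsm]
      rw [inv_mul_eq_div, le_div_iff₀ hs]; exact hcase.le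
  have key := hmK _ hmem
  simp only [← smul_add] at key
  rw [smul_comm, hsm, hsm, hsm, ← mul_add, mul_div_assoc, ← mul_sub, inv_mul_eq_div,
    le_div_iff₀ hs] at key
  calc ‖a - b‖ ^ p ≤ 2 ^ p * s := norm_sub_rpow_le hp a b
    _ = 2 ^ p / m * (m * s) := by field_simp
    _ ≤ 2 ^ p / m * (s / 2 - ‖(1 / 2 : ℝ) • (a + b)‖ ^ p) := by gcongr
    _ ≤ _ := le_add_of_nonneg_left (by positivity)

end UniformConvexity

section Projection

variable {V : Type*} [NormedAddCommGroup V] {p : ℝ}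
  {α : Type*} [MeasurableSpace α] {ν : Measure α}

lemma Lp_norm_rpow (hp : 1 < p) (f : Lp V (ENNReal.ofReal p) ν) :
    ‖f‖ ^ p = ∫ x, ‖f x‖ ^ p ∂ν := by
  have hp0 : 0 < p := by linarith
  rw [Lp.norm_def, (Lp.memLp f).eLpNorm_eq_integral_rpow_norm (by simpa using hp0)
    ENNReal.ofReal_ne_top, ENNReal.toReal_ofReal hp0.le, ENNReal.toReal_ofReal (by positivity),
    Real.rpow_inv_rpow (integral_nonneg fun x => by positivity) hp0.ne']

lemma Lp_integrable_norm_rpow (hp : 1 < p) (f : Lp V (ENNReal.ofReal p) ν) :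
    Integrable (fun x => ‖f x‖ ^ p) ν := by
  have := (Lp.memLp f).integrable_norm_rpow (by simpa using by linarith) ENNReal.ofReal_ne_top
  rwa [ENNReal.toReal_ofReal (by linarith)] at this

variable [NormedSpace ℝ V]

lemma exists_Lp_norm_sub_rpow_le [StrictConvexSpace ℝ V] [ProperSpace V] (hp : 1 < p) {ε : ℝ}
    (hε : 0 < ε) : ∃ C : ℝ, 0 ≤ C ∧ ∀ f g : Lp V (ENNReal.ofReal p) ν,
      ‖f - g‖ ^ p ≤ ε * (‖f‖ ^ p + ‖g‖ ^ p) +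
      C * ((‖f‖ ^ p + ‖g‖ ^ p) / 2 - ‖(1 / 2 : ℝ) • (f + g)‖ ^ p) := by
  obtain ⟨C, hC, h⟩ := exists_norm_sub_rpow_le (V := V) hp hε
  refine ⟨C, hC, fun f g => ?_⟩
  have i1 := Lp_integrable_norm_rpow hp f
  have i2 := Lp_integrable_norm_rpow hp g
  have i3 := Lp_integrable_norm_rpow hp ((1 / 2 : ℝ) • (f + g))
  have i12 : Integrable (fun x => ‖f x‖ ^ p + ‖g x‖ ^ p) ν := i1.add i2
  have i4 : Integrable (fun x => (‖f x‖ ^ p + ‖g x‖ ^ p) / 2) ν := i12.div_const 2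
  have i5 : Integrable (fun x => (‖f x‖ ^ p + ‖g x‖ ^ p) / 2 -
      ‖((1 / 2 : ℝ) • (f + g) : Lp V (ENNReal.ofReal p) ν) x‖ ^ p) ν := i4.sub i3
  rw [Lp_norm_rpow hp, Lp_norm_rpow hp f, Lp_norm_rpow hp g, Lp_norm_rpow hp (_ • _),
    ← integral_add i1 i2, ← integral_const_mul, ← integral_div, ← integral_sub i4 i3,
    ← integral_const_mul, ← integral_add (i12.const_mul ε) (i5.const_mul C)]
  refine integral_mono_ae (Lp_integrable_norm_rpow hp _)
    ((i12.const_mul ε).add (i5.const_mul C)) ?_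
  filter_upwards [Lp.coeFn_sub f g, Lp.coeFn_smul (1 / 2 : ℝ) (f + g), Lp.coeFn_add f g]
    with x h1 h2 h3
  have := h (f x) (g x)
  simpa only [h1, h2, h3, Pi.sub_apply, Pi.smul_apply, Pi.add_apply] using this

/-- A nonempty closed convex subset of `L^p` has an element of minimal norm. -/
lemma exists_norm_le_of_convex [StrictConvexSpace ℝ V] [ProperSpace V] (hp : 1 < p)
    [Fact (1 ≤ ENNReal.ofReal p)] {K : Set (Lp V (ENNReal.ofReal p) ν)} (hne : K.Nonempty)
    (hcl : IsClosed K) (hconv : Convex ℝ K) : ∃ x ∈ K, ∀ y ∈ K, ‖x‖ ≤ ‖y‖ := by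
  have hp0 : 0 < p := by linarith
  obtain ⟨u, -, hu, hmem⟩ := exists_seq_tendsto_sInf (S := norm '' K) (hne.image _)
    ⟨0, by rintro _ ⟨x, -, rfl⟩; exact norm_nonneg x⟩
  set m := sInf (norm '' K)
  have hmle : ∀ y ∈ K, m ≤ ‖y‖ := fun y hy =>
    csInf_le ⟨0, by rintro _ ⟨x, -, rfl⟩; exact norm_nonneg x⟩ ⟨y, hy, rfl⟩
  have hm0 : 0 ≤ m := le_csInf (hne.image _) (by rintro _ ⟨x, -, rfl⟩; exact norm_nonneg x)
  choose x hxK hxu using hmem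
  have ht : Tendsto (fun k => ‖x k‖ ^ p) atTop (𝓝 (m ^ p)) := by
    simp only [hxu]
    exact hu.rpow_const (Or.inr hp0.le)
  have hcau : CauchySeq x := by
    rw [Metric.cauchySeq_iff]
    intro δ hδ
    have hδp : 0 < δ ^ p := Real.rpow_pos_of_pos hδ p
    have hT : 0 ≤ m ^ p := Real.rpow_nonneg hm0 p
    obtain ⟨C, hC, hineq⟩ := exists_Lp_norm_sub_rpow_le (V := V) (ν := ν) hp
      (ε := δ ^ p / (4 * (m ^ p + 1))) (by positivity)
    have hmin : 0 < min 1 (δ ^ p / (4 * (C + 1))) := by positivity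
    have hev := ht.eventually (gt_mem_nhds (lt_add_of_pos_right (m ^ p) hmin))
    obtain ⟨N, hN⟩ := eventually_atTop.1 hev
    refine ⟨N, fun k hk l hl => ?_⟩
    have h1 := hN k hk
    have h2 := hN l hl
    have hmid : m ^ p ≤ ‖(1 / 2 : ℝ) • (x k + x l)‖ ^ p := by
      refine Real.rpow_le_rpow hm0 (hmle _ ?_) hp0.le
      rw [smul_add]
      exact hconv (hxK k) (hxK l) (by norm_num) (by norm_num) (by norm_num)
    have h3 := hineq (x k) (x l)
    have ha := min_le_left 1 (δ ^ p / (4 * (C + 1)))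
    have hb := min_le_right 1 (δ ^ p / (4 * (C + 1)))
    have h4 : δ ^ p / (4 * (m ^ p + 1)) * (‖x k‖ ^ p + ‖x l‖ ^ p) ≤ δ ^ p / 2 := by
      calc _ ≤ δ ^ p / (4 * (m ^ p + 1)) * (2 * (m ^ p + 1)) := by gcongr; linarith
        _ = δ ^ p / 2 := by field_simp; ring
    have h5 : C * ((‖x k‖ ^ p + ‖x l‖ ^ p) / 2 - ‖(1 / 2 : ℝ) • (x k + x l)‖ ^ p) ≤
        δ ^ p / 4 := by
      calc _ ≤ C * (δ ^ p / (4 * (C + 1))) := by gcongr; linarith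
        _ = (δ ^ p / 4) * (C / (C + 1)) := by field_simp
        _ ≤ (δ ^ p / 4) * 1 := by gcongr; rw [div_le_one (by positivity)]; linarith
        _ = _ := mul_one _
    rw [dist_eq_norm]
    exact (Real.rpow_lt_rpow_iff (norm_nonneg _) hδ.le hp0).1 (by linarith)
  obtain ⟨y, hy⟩ := cauchySeq_tendsto_of_complete hcau
  refine ⟨y, hcl.mem_of_tendsto hy (Eventually.of_forall hxK), fun z hz => ?_⟩
  have : Tendsto (fun k => ‖x k‖) atTop (𝓝 m) := by simpa only [hxu] using hu
  rw [tendsto_nhds_unique hy.norm this]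
  exact hmle z hz

end Projection

end PLaplaceBoundary

namespace PLaplaceBoundary

section Existence

variable {n : ℕ} {Ω : Set (EuclideanSpace ℝ (Fin n))} {p : ℝ}
  {φ : EuclideanSpace ℝ (Fin n) → ℂ}
  {U Φ : EuclideanSpace ℝ (Fin n) → EuclideanSpace ℂ (Fin n)}
  {γ : EuclideanSpace ℝ (Fin n) → ℝ} {c C : ℝ}

/-- The measure `γ dx` on `Ω`. -/
noncomputable def coeffMeasure (γ : EuclideanSpace ℝ (Fin n) → ℝ)
    (Ω : Set (EuclideanSpace ℝ (Fin n))) : Measure (EuclideanSpace ℝ (Fin n)) :=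
  (volume.restrict Ω).withDensity fun x => ENNReal.ofReal (γ x)

namespace IsBoundedCoeff

lemma coeffMeasure_le (hγ : IsBoundedCoeff γ Ω c C) (hΩ : IsOpen Ω) :
    coeffMeasure γ Ω ≤ ENNReal.ofReal C • volume.restrict Ω := by
  rw [← withDensity_const]
  refine withDensity_mono ?_
  filter_upwards [hγ.ae_bounds hΩ] with x hx using ENNReal.ofReal_le_ofReal hx.2

lemma le_coeffMeasure (hγ : IsBoundedCoeff γ Ω c C) (hΩ : IsOpen Ω) :
    volume.restrict Ω ≤ (ENNReal.ofReal c)⁻¹ • coeffMeasure γ Ω := by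
  have h : ENNReal.ofReal c • volume.restrict Ω ≤ coeffMeasure γ Ω := by
    rw [← withDensity_const]
    refine withDensity_mono ?_
    filter_upwards [hγ.ae_bounds hΩ] with x hx using ENNReal.ofReal_le_ofReal hx.1
  have hc : ENNReal.ofReal c ≠ 0 := by simpa using hγ.pos
  refine Measure.le_iff.2 fun s _ => ?_
  have := h s
  rw [Measure.smul_apply, smul_eq_mul] at this ⊢
  exact (ENNReal.mul_le_iff_le_inv hc ENNReal.ofReal_ne_top).1 this

lemma ofReal_inv_ne_top (hγ : IsBoundedCoeff γ Ω c C) : (ENNReal.ofReal c)⁻¹ ≠ ⊤ := by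
  simpa using hγ.pos

lemma energy_eq (hγ : IsBoundedCoeff γ Ω c C) (hΩ : IsOpen Ω)
    (U : EuclideanSpace ℝ (Fin n) → EuclideanSpace ℂ (Fin n)) :
    energy p γ Ω U = ∫ x, ‖U x‖ ^ p ∂coeffMeasure γ Ω := by
  rw [energy, coeffMeasure, integral_withDensity_eq_integral_toReal_smul₀
    hγ.meas.aemeasurable.ennreal_ofReal (by simp)]
  refine setIntegral_congr_fun hΩ.measurableSet fun x hx => ?_
  simp only [smul_eq_mul]
  rw [ENNReal.toReal_ofReal (hγ.pos.le.trans (hγ.lower x hx))]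

end IsBoundedCoeff

lemma tendsto_eLpNorm_of_measure_le {α F : Type*} [MeasurableSpace α] [NormedAddCommGroup F]
    {μ ν : Measure α} {q K : ENNReal} (hq : q ≠ ⊤) (hK : K ≠ ⊤) (h : μ ≤ K • ν) {f : ℕ → α → F}
    (hf : Tendsto (fun k => eLpNorm (f k) q ν) atTop (𝓝 0)) :
    Tendsto (fun k => eLpNorm (f k) q μ) atTop (𝓝 0) := by
  have hK' : K ^ (1 / q).toReal ≠ ⊤ :=
    ENNReal.rpow_ne_top_of_nonneg ENNReal.toReal_nonneg hK
  refine tendsto_of_tendsto_of_tendsto_of_le_of_le tendsto_const_nhds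
    (by simpa using ENNReal.Tendsto.const_mul hf (Or.inr hK')) (fun _ => zero_le) fun k => ?_
  refine (eLpNorm_mono_measure (f k) h).trans ?_
  rw [eLpNorm_smul_measure_of_ne_top hq, smul_eq_mul, one_div, ENNReal.toReal_inv]

/-- Existence of a minimizer of the energy with prescribed smooth boundary values. -/
lemma exists_energy_minimizer [IsFiniteMeasure (volume.restrict Ω)]
    (hγ : IsBoundedCoeff γ Ω c C) (hΩ : IsOpen Ω)
    (hp : 1 < p) {R : ℝ} (hR : 0 < R) (hb : Ω ⊆ Metric.ball 0 R) (j : Fin n)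
    (hφ : ContDiff ℝ ∞ φ) (hc : HasCompactSupport φ) :
    ∃ w W, IsSobolevZero p Ω w W ∧ ∀ ψ Ψ, IsSobolevZero p Ω ψ Ψ →
      energy p γ Ω (fun x => grad φ x + W x) ≤ energy p γ Ω (fun x => grad φ x + Ψ x) := by
  have hp1 : (1 : ENNReal) ≤ ENNReal.ofReal p := by simpa using hp.le
  have : Fact (1 ≤ ENNReal.ofReal p) := ⟨hp1⟩
  have hp0 : 0 < p := by linarith
  set μ := volume.restrict Ω
  set ν := coeffMeasure γ Ω
  have hνμ : ν ≤ ENNReal.ofReal C • μ := hγ.coeffMeasure_le hΩ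
  have hμν : μ ≤ (ENNReal.ofReal c)⁻¹ • ν := hγ.le_coeffMeasure hΩ
  have memν : ∀ {f : EuclideanSpace ℝ (Fin n) → EuclideanSpace ℂ (Fin n)},
      MemLp f (ENNReal.ofReal p) μ → MemLp f (ENNReal.ofReal p) ν := fun hf =>
    hf.of_measure_le_smul ENNReal.ofReal_ne_top hνμ
  have memμ : ∀ {f : EuclideanSpace ℝ (Fin n) → EuclideanSpace ℂ (Fin n)},
      MemLp f (ENNReal.ofReal p) ν → MemLp f (ENNReal.ofReal p) μ := fun hf =>
    hf.of_measure_le_smul hγ.ofReal_inv_ne_top hμν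
  have hgφ : MemLp (grad φ) (ENNReal.ofReal p) μ :=
    (isSobolev_of_contDiff (Ω := Ω) p hφ hc).memLp_grad
  have hmem : ∀ {ψ}, IsTestFunction Ω ψ →
      MemLp (fun x => grad φ x + grad ψ x) (ENNReal.ofReal p) ν := fun hψ =>
    memν (hgφ.add (hψ.memLp_grad _ _))
  set K₀ : Set (Lp (EuclideanSpace ℂ (Fin n)) (ENNReal.ofReal p) ν) :=
    {f | ∃ ψ, ∃ hψ : IsTestFunction Ω ψ, f = (hmem hψ).toLp _}
  have hK₀ : Convex ℝ K₀ := by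
    rintro _ ⟨ψ, hψ, rfl⟩ _ ⟨ψ', hψ', rfl⟩ a b - - hab
    refine ⟨fun x => (a : ℂ) * ψ x + (b : ℂ) * ψ' x,
      (hψ.const_mul a).add (hψ'.const_mul b), ?_⟩
    rw [← MemLp.toLp_const_smul, ← MemLp.toLp_const_smul, ← MemLp.toLp_add]
    refine MemLp.toLp_congr _ _ (ae_of_all _ fun x => ?_)
    simp only [Pi.add_apply, Pi.smul_apply]
    rw [grad_add (hψ.const_mul a).differentiable (hψ'.const_mul b).differentiable,
      grad_smul _ hψ.differentiable, grad_smul _ hψ'.differentiable, Complex.coe_smul,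
      Complex.coe_smul, smul_add, smul_add]
    have : grad φ x = a • grad φ x + b • grad φ x := by rw [← add_smul, hab, one_smul]
    conv_rhs => rw [this]
    abel
  obtain ⟨f, hfK, hfmin⟩ := exists_norm_le_of_convex (V := EuclideanSpace ℂ (Fin n)) (ν := ν) hp
    (K := closure K₀) ⟨_, subset_closure ⟨_, IsTestFunction.zero, rfl⟩⟩ isClosed_closure
    hK₀.closure
  obtain ⟨g, hgK, hgf⟩ := mem_closure_iff_seq_limit.1 hfK
  choose ψ hψ hgψ using hgK
  -- convergence of the gradients in `L^p(Ω)`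
  set W : EuclideanSpace ℝ (Fin n) → EuclideanSpace ℂ (Fin n) := fun x => f x - grad φ x
  have hW : MemLp W (ENNReal.ofReal p) μ := (memμ (Lp.memLp f)).sub hgφ
  have hconv : Tendsto (fun k => eLpNorm (fun x => W x - grad (ψ k) x) (ENNReal.ofReal p) μ)
      atTop (𝓝 0) := by
    refine tendsto_eLpNorm_of_measure_le ENNReal.ofReal_ne_top hγ.ofReal_inv_ne_top hμν ?_
    have h1 := (Lp.tendsto_Lp_iff_tendsto_eLpNorm' g f).1 hgf
    refine h1.congr fun k => ?_
    refine eLpNorm_congr_norm_ae ?_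
    have h2 := (hmem (hψ k)).coeFn_toLp
    rw [← hgψ k] at h2
    filter_upwards [h2] with x hx
    rw [Pi.sub_apply, hx, ← norm_neg]
    congr 1
    simp only [W]; abel
  -- convergence of the functions, by the Poincaré inequality
  have hψμ : ∀ k, MemLp (ψ k) (ENNReal.ofReal p) μ := fun k => (hψ k).memLp _ _
  have hGμ : ∀ k, MemLp (grad (ψ k)) (ENNReal.ofReal p) μ := fun k => (hψ k).memLp_grad _ _
  have hGlim : Tendsto (fun k => (hGμ k).toLp _) atTop (𝓝 (hW.toLp W)) := by
    rw [Lp.tendsto_Lp_iff_tendsto_eLpNorm'']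
    refine hconv.congr fun k => eLpNorm_congr_norm_ae (ae_of_all _ fun x => ?_)
    rw [Pi.sub_apply, norm_sub_rev]
  set P : ℝ := 2 * p * (2 * R)
  have hP : 0 < P := by positivity
  have hdist : ∀ k l, dist ((hψμ k).toLp _) ((hψμ l).toLp _) ≤
      P * dist ((hGμ k).toLp _) ((hGμ l).toLp _) := by
    intro k l
    rw [Lp.dist_edist, Lp.dist_edist, Lp.edist_toLp_toLp, Lp.edist_toLp_toLp,
      ← ENNReal.toReal_ofReal hP.le, ← ENNReal.toReal_mul]
    refine ENNReal.toReal_mono (ENNReal.mul_ne_top ENNReal.ofReal_ne_top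
      ((hGμ k).sub (hGμ l)).2.ne) ?_
    refine eLpNorm_le_of_integral_le hp hP.le ((hψμ k).sub (hψμ l)) ((hGμ k).sub (hGμ l)) ?_
    have := poincare hΩ hp hR hb j ((hψ k).sub (hψ l))
    simp only [grad_sub (hψ k).differentiable (hψ l).differentiable] at this
    exact this
  have hcau : CauchySeq fun k => (hψμ k).toLp _ := by
    rw [Metric.cauchySeq_iff]
    intro ε hε
    obtain ⟨N, hN⟩ := Metric.cauchySeq_iff.1 hGlim.cauchySeq (ε / P) (by positivity)
    refine ⟨N, fun k hk l hl => (hdist k l).trans_lt ?_⟩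
    have := hN k hk l hl
    rwa [lt_div_iff₀' hP] at this
  obtain ⟨w, hw⟩ := cauchySeq_tendsto_of_complete hcau
  have hwconv : Tendsto (fun k => eLpNorm (fun x => w x - ψ k x) (ENNReal.ofReal p) μ)
      atTop (𝓝 0) := by
    have h1 := (Lp.tendsto_Lp_iff_tendsto_eLpNorm' _ w).1 hw
    refine h1.congr fun k => eLpNorm_congr_norm_ae ?_
    filter_upwards [(hψμ k).coeFn_toLp] with x hx
    rw [Pi.sub_apply, hx, norm_sub_rev]
  have hwW : IsSobolevZero p Ω w W :=
    isSobolevZero_of_tendsto hp.le (Lp.memLp w) hW ψ hψ hwconv hconv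
  refine ⟨w, W, hwW, fun θ Θ hθ => ?_⟩
  have hΘ : MemLp (fun x => grad φ x + Θ x) (ENNReal.ofReal p) ν :=
    memν (hgφ.add hθ.sobolev.memLp_grad)
  have hΘK : hΘ.toLp _ ∈ closure K₀ := by
    obtain ⟨χ, hχ, -, hχ2⟩ := hθ.approx
    refine mem_closure_of_tendsto (b := atTop) (f := fun k => (hmem (hχ k)).toLp _) ?_
      (Eventually.of_forall fun k => ⟨_, hχ k, rfl⟩)
    rw [Lp.tendsto_Lp_iff_tendsto_eLpNorm'']
    refine (tendsto_eLpNorm_of_measure_le ENNReal.ofReal_ne_top ENNReal.ofReal_ne_top hνμ hχ2).congr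
      fun k => eLpNorm_congr_norm_ae (ae_of_all _ fun x => ?_)
    rw [Pi.sub_apply, ← norm_neg]; congr 1; abel
  have hle := Real.rpow_le_rpow (norm_nonneg _) (hfmin _ hΘK) hp0.le
  rw [Lp_norm_rpow hp, Lp_norm_rpow hp] at hle
  rw [hγ.energy_eq hΩ, hγ.energy_eq hΩ]
  refine le_trans (le_of_eq ?_) (hle.trans_eq ?_)
  · simp only [W, add_sub_cancel, ν]
  · exact integral_congr_ae (hΘ.coeFn_toLp.mono fun x hx => by simp only [hx])

lemma real_inner_eq_re_sum (a b : EuclideanSpace ℂ (Fin n)) :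
    inner ℝ a b = (∑ j, a j * (starRingEnd ℂ) (b j)).re := by
  rw [PiLp.inner_apply]
  simp [Complex.inner, mul_comm]

/-- The Euler–Lagrange equation (real part) of an energy minimizer. -/
lemma re_flux_eq_zero_of_minimizer (hγ : IsBoundedCoeff γ Ω c C) (hΩ : IsOpen Ω) (hp : 1 < p)
    (hU : MemLp U (ENNReal.ofReal p) (volume.restrict Ω))
    (hΦ : MemLp Φ (ENNReal.ofReal p) (volume.restrict Ω))
    (hmin : ∀ t : ℝ, energy p γ Ω U ≤ energy p γ Ω (fun x => U x + t • Φ x)) :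
    ∫ x in Ω, (∑ j, flux p γ U x j * (starRingEnd ℂ) (Φ x j)).re = 0 := by
  have hp0 : 0 < p := by linarith
  have hflux : ∀ x, γ x * (p * ‖U x‖ ^ (p - 2) * inner ℝ (U x) (Φ x)) =
      p * (∑ j, flux p γ U x j * (starRingEnd ℂ) (Φ x j)).re := by
    intro x
    rw [real_inner_eq_re_sum]
    simp only [flux, PiLp.smul_apply, smul_eq_mul, mul_assoc]
    rw [← Finset.mul_sum, Complex.re_ofReal_mul]
    ring
  have hi := (hγ.integrable_flux_mul hΩ hp hU (memLp_conjVec hΦ)).re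
  simp only [conjVec_apply, RCLike.re_to_complex] at hi
  have hbound : Integrable (fun x => C * (p * (2 ^ p * (‖U x‖ ^ p + ‖Φ x‖ ^ p) + ‖Φ x‖ ^ p)))
      (volume.restrict Ω) := by
    have h1 := integrable_norm_rpow hp hU
    have h2 := integrable_norm_rpow hp hΦ
    exact ((((h1.add h2).const_mul _).add h2).const_mul p).const_mul C
  have hder := hasDerivAt_integral_of_dominated_loc_of_deriv_le (μ := volume.restrict Ω)
    (F := fun (t : ℝ) x => γ x * ‖U x + t • Φ x‖ ^ p)
    (F' := fun (t : ℝ) x => γ x * (p * ‖U x + t • Φ x‖ ^ (p - 2) * inner ℝ (U x + t • Φ x) (Φ x)))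
    (x₀ := 0) (bound := fun x => C * (p * (2 ^ p * (‖U x‖ ^ p + ‖Φ x‖ ^ p) + ‖Φ x‖ ^ p)))
    (Metric.ball_mem_nhds 0 one_pos)
    (Eventually.of_forall fun t =>
      (hγ.integrable_energy hΩ hp (hU.add (hΦ.const_smul t))).1)
    (hγ.integrable_energy hΩ hp (hU.add (hΦ.const_smul (0 : ℝ))))
    (by simp only [zero_smul, add_zero, hflux]; exact (hi.const_mul p).1)
    (by
      filter_upwards [ae_restrict_mem hΩ.measurableSet] with x hx t ht
      have h0 : 0 ≤ γ x := hγ.pos.le.trans (hγ.lower x hx)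
      have ht' : |t| ≤ 1 := by
        rw [Metric.mem_ball, dist_zero_right] at ht; exact ht.le
      have hn : ‖t • Φ x‖ ≤ ‖Φ x‖ := by
        rw [norm_smul]; exact mul_le_of_le_one_left (norm_nonneg _) ht'
      rw [norm_mul, Real.norm_of_nonneg h0, norm_mul, norm_mul, Real.norm_of_nonneg hp0.le,
        Real.norm_of_nonneg (by positivity), mul_assoc p]
      have h1 : ‖U x + t • Φ x‖ ^ p ≤ 2 ^ p * (‖U x‖ ^ p + ‖Φ x‖ ^ p) := by
        have := norm_sub_rpow_le hp (U x) (-(t • Φ x))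
        rw [sub_neg_eq_add, norm_neg] at this
        refine this.trans ?_
        gcongr
      refine mul_le_mul (hγ.upper x hx) ?_ (by positivity) (h0.trans (hγ.upper x hx))
      refine mul_le_mul_of_nonneg_left ?_ hp0.le
      calc ‖U x + t • Φ x‖ ^ (p - 2) * ‖inner ℝ (U x + t • Φ x) (Φ x)‖
          ≤ ‖U x + t • Φ x‖ ^ (p - 2) * (‖U x + t • Φ x‖ * ‖Φ x‖) := by
            gcongr; exact norm_inner_le_norm _ _
        _ = ‖U x + t • Φ x‖ ^ (p - 1) * ‖Φ x‖ := by
            rw [← mul_assoc, rpow_sub_two_mul_self (norm_nonneg _) hp]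
        _ ≤ ‖U x + t • Φ x‖ ^ p + ‖Φ x‖ ^ p :=
            rpow_sub_one_mul_le (norm_nonneg _) (norm_nonneg _) hp
        _ ≤ _ := by gcongr)
    hbound
    (by
      refine ae_of_all _ fun x t _ => ?_
      have h1 : HasDerivAt (fun t : ℝ => U x + t • Φ x) (Φ x) t := by
        simpa using ((hasDerivAt_id t).smul_const (Φ x)).const_add (U x)
      have h2 := (hasFDerivAt_norm_rpow (U x + t • Φ x) hp).comp_hasDerivAt t h1
      exact h2.const_mul (γ x))
  have hloc : IsLocalMin (fun t : ℝ => ∫ x in Ω, γ x * ‖U x + t • Φ x‖ ^ p) 0 :=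
    Eventually.of_forall fun t => by simpa [energy] using hmin t
  have h0 := hloc.hasDerivAt_eq_zero hder.2
  simp only [zero_smul, add_zero, hflux] at h0
  rw [integral_const_mul] at h0
  exact (mul_eq_zero.1 h0).resolve_left (ne_of_gt hp0)

/-- The Dirichlet-to-Neumann pairing of smooth boundary values has a value. -/
lemma exists_isDNValue [IsFiniteMeasure (volume.restrict Ω)]
    (hγ : IsBoundedCoeff γ Ω c C) (hΩ : IsOpen Ω)
    (hp : 1 < p) {R : ℝ} (hR : 0 < R) (hb : Ω ⊆ Metric.ball 0 R) (j : Fin n)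
    (hφ : ContDiff ℝ ∞ φ) (hc : HasCompactSupport φ) : ∃ ℓ, IsDNValue p γ Ω φ φ ℓ := by
  obtain ⟨w, W, hW, hmin⟩ := exists_energy_minimizer hγ hΩ hp hR hb j hφ hc
  have hsφ : IsSobolev p Ω φ (grad φ) := isSobolev_of_contDiff p hφ hc
  have hu := hsφ.add hp.le hW.sobolev
  have hre : ∀ ψ Ψ, IsSobolevZero p Ω ψ Ψ →
      (∫ x in Ω, ∑ j, flux p γ (fun x => grad φ x + W x) x j * Ψ x j).re = 0 := by
    intro ψ Ψ hΨ
    have hi := hγ.integrable_flux_mul hΩ hp hu.memLp_grad hΨ.sobolev.memLp_grad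
    have h1 := re_flux_eq_zero_of_minimizer hγ hΩ hp hu.memLp_grad hΨ.conj.sobolev.memLp_grad
      fun t => by
        have := hmin _ _ (hW.add hp.le (hΨ.conj.const_mul (t : ℂ)))
        simpa only [Complex.coe_smul, add_assoc] using this
    simp only [conjVec_apply, Complex.conj_conj] at h1
    have h2 := integral_re hi
    simp only [RCLike.re_to_complex] at h2
    rw [← h2, h1]
  refine ⟨_, fun x => φ x + w x, φ, fun x => grad φ x + W x, grad φ, ⟨hu, ?_, W, ?_⟩, hsφ,
    ⟨grad (fun _ => 0), ?_⟩, rfl⟩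
  · intro ψ Ψ hΨ
    refine Complex.ext (hre ψ Ψ hΨ) ?_
    have h1 := hre _ _ (hΨ.const_mul Complex.I)
    have e : ∀ x, ∑ j, flux p γ (fun x => grad φ x + W x) x j * (Complex.I • Ψ x) j =
        Complex.I * ∑ j, flux p γ (fun x => grad φ x + W x) x j * Ψ x j := by
      intro x
      rw [Finset.mul_sum]
      refine Finset.sum_congr rfl fun j _ => ?_
      simp only [PiLp.smul_apply, smul_eq_mul]; ring
    simp only [e] at h1
    rw [integral_const_mul] at h1
    simpa using h1
  · simpa using hW
  · simpa using (IsTestFunction.zero (Ω := Ω)).isSobolevZero (p := p)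

end Existence

end PLaplaceBoundary

namespace PLaplaceBoundary

section BoundaryLayer

variable {d : ℕ}

/-- The point of `ℝ^{d+1}` with horizontal part `z.1` and last coordinate `z.2`. -/
noncomputable def ofSlab (z : EuclideanSpace ℝ (Fin d) × ℝ) : EuclideanSpace ℝ (Fin (d + 1)) :=
  WithLp.toLp 2 (Fin.snoc (α := fun _ => ℝ) (fun i : Fin d => z.1 i) z.2)

@[simp] lemma ofSlab_last (z : EuclideanSpace ℝ (Fin d) × ℝ) : ofSlab z (Fin.last d) = z.2 := by
  simp [ofSlab]

@[simp] lemma ofSlab_castSucc (z : EuclideanSpace ℝ (Fin d) × ℝ) (i : Fin d) :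
    ofSlab z i.castSucc = z.1 i := by
  simp [ofSlab]

lemma smul_ofSlab (c : ℝ) (z : EuclideanSpace ℝ (Fin d) × ℝ) :
    c • ofSlab z = ofSlab (c • z.1, c * z.2) := by
  ext i
  refine Fin.lastCases ?_ (fun i => ?_) i <;> simp

lemma norm_ofSlab_sq (z : EuclideanSpace ℝ (Fin d) × ℝ) : ‖ofSlab z‖ ^ 2 = ‖z.1‖ ^ 2 + z.2 ^ 2 := by
  rw [EuclideanSpace.norm_sq_eq, EuclideanSpace.norm_sq_eq, Fin.sum_univ_castSucc]
  simp

lemma norm_fst_le_ofSlab (z : EuclideanSpace ℝ (Fin d) × ℝ) : ‖z.1‖ ≤ ‖ofSlab z‖ := by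
  refine (sq_le_sq₀ (norm_nonneg _) (norm_nonneg _)).1 ?_
  rw [norm_ofSlab_sq]
  exact le_add_of_nonneg_right (sq_nonneg _)

lemma continuous_ofSlab : Continuous (ofSlab (d := d)) := by
  refine (PiLp.continuous_toLp 2 _).comp (continuous_pi fun i => ?_)
  refine Fin.lastCases ?_ (fun i => ?_) i
  · simpa using continuous_snd
  · simp only [Fin.snoc_castSucc]
    exact (PiLp.continuous_apply 2 (fun _ : Fin d => ℝ) i).comp continuous_fst

lemma ofSlab_injective : Function.Injective (ofSlab (d := d)) := by
  intro z w h
  refine Prod.ext ?_ ?_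
  · ext i; simpa using congrArg (fun x => x i.castSucc) h
  · simpa using congrArg (fun x => x (Fin.last d)) h

lemma ofSlab_zero : ofSlab ((0 : EuclideanSpace ℝ (Fin d)), (0 : ℝ)) = 0 := by
  ext i
  refine Fin.lastCases ?_ (fun i => ?_) i <;> simp

lemma measurePreserving_ofSlab : MeasurePreserving (ofSlab (d := d)) := by
  have h1 : MeasurePreserving
      (Prod.map (WithLp.ofLp : EuclideanSpace ℝ (Fin d) → _) (id : ℝ → ℝ)) :=
    (PiLp.volume_preserving_ofLp (Fin d)).prod (MeasurePreserving.id volume)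
  have h2 : MeasurePreserving (Prod.swap : (Fin d → ℝ) × ℝ → ℝ × (Fin d → ℝ)) :=
    Measure.measurePreserving_swap
  have h3 := (volume_preserving_piFinSuccAbove (fun _ : Fin (d + 1) => ℝ) (Fin.last d)).symm
  have h4 := PiLp.volume_preserving_toLp (Fin (d + 1))
  have h := h4.comp (h3.comp (h2.comp h1))
  convert h using 1
  ext z i
  refine Fin.lastCases ?_ (fun i => ?_) i <;>
    simp [MeasurableEquiv.piFinSuccAbove, Fin.insertNthEquiv]

/-- The anisotropic rescaling `(y, t) ↦ (y / m, t / ν)`. -/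
noncomputable def layerMap (m ν : ℝ) (z : EuclideanSpace ℝ (Fin d) × ℝ) :
    EuclideanSpace ℝ (Fin (d + 1)) := ofSlab (m⁻¹ • z.1, ν⁻¹ * z.2)

lemma layerMap_last (m ν : ℝ) (z : EuclideanSpace ℝ (Fin d) × ℝ) :
    layerMap m ν z (Fin.last d) = ν⁻¹ * z.2 := by simp [layerMap]

lemma smul_layerMap {m : ℝ} (hm : m ≠ 0) (ν : ℝ) (z : EuclideanSpace ℝ (Fin d) × ℝ) :
    m • layerMap m ν z = ofSlab (z.1, m / ν * z.2) := by
  rw [layerMap, smul_ofSlab, smul_smul, mul_inv_cancel₀ hm, one_smul]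
  congr 2; ring

lemma measurableEmbedding_layerMap {m ν : ℝ} (hm : m ≠ 0) (hν : ν ≠ 0) :
    MeasurableEmbedding (layerMap (d := d) m ν) := by
  refine Continuous.measurableEmbedding ?_ ?_
  · exact continuous_ofSlab.comp (by fun_prop)
  · intro z w h
    have := ofSlab_injective h
    rw [Prod.mk.injEq] at this
    exact Prod.ext (smul_right_injective _ (inv_ne_zero hm) this.1)
      (mul_right_injective₀ (inv_ne_zero hν) this.2)

lemma map_layerMap {m ν : ℝ} (hm : 0 < m) (hν : 0 < ν) :
    Measure.map (layerMap (d := d) m ν) volume = ENNReal.ofReal (m ^ d * ν) • volume := by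
  have h0 : Measure.map (Prod.map (fun y : EuclideanSpace ℝ (Fin d) => m⁻¹ • y)
      (fun t : ℝ => ν⁻¹ • t)) volume = ENNReal.ofReal (m ^ d * ν) • volume := by
    rw [Measure.volume_eq_prod, ← Measure.map_prod_map _ _ (by fun_prop) (by fun_prop),
      Measure.map_addHaar_smul _ (inv_ne_zero hm.ne'),
      Measure.map_addHaar_smul _ (inv_ne_zero hν.ne'), Measure.prod_smul_left,
      Measure.prod_smul_right, smul_smul, ← ENNReal.ofReal_mul (abs_nonneg _)]
    congr 2
    rw [finrank_euclideanSpace, Fintype.card_fin, Module.finrank_self, pow_one, inv_inv,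
      abs_of_pos hν, abs_of_pos (by positivity), inv_pow, inv_inv]
  have h1 : layerMap (d := d) m ν =
      ofSlab ∘ Prod.map (fun y => m⁻¹ • y) (fun t : ℝ => ν⁻¹ • t) := rfl
  rw [h1, ← Measure.map_map measurePreserving_ofSlab.measurable (by fun_prop), h0,
    Measure.map_smul, measurePreserving_ofSlab.map_eq]

lemma integral_layerMap {m ν : ℝ} (hm : 0 < m) (hν : 0 < ν)
    (k : EuclideanSpace ℝ (Fin (d + 1)) → ℝ) :
    ∫ z, k (layerMap m ν z) = m ^ d * ν * ∫ x, k x := by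
  rw [← (measurableEmbedding_layerMap hm.ne' hν.ne').integral_map, map_layerMap hm hν,
    integral_smul_measure, ENNReal.toReal_ofReal (by positivity), smul_eq_mul]

lemma aestronglyMeasurable_comp_layerMap {m ν : ℝ} (hm : 0 < m) (hν : 0 < ν)
    {k : EuclideanSpace ℝ (Fin (d + 1)) → ℝ} (hk : AEStronglyMeasurable k volume) :
    AEStronglyMeasurable (fun z => k (layerMap m ν z)) volume := by
  refine AEStronglyMeasurable.comp_measurable ?_
    (measurableEmbedding_layerMap hm.ne' hν.ne').measurable
  rw [map_layerMap hm hν]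
  exact hk.mono_ac Measure.smul_absolutelyContinuous

variable {N : ℕ → ℝ}

lemma tendsto_scale_atTop (hN : ∀ M : ℕ, 1 ≤ M → 0 < N M)
    (hs : Tendsto (fun M : ℕ => (M : ℝ) / N M) atTop (𝓝 0)) : Tendsto N atTop atTop := by
  refine tendsto_atTop_mono' _ ?_ (tendsto_natCast_atTop_atTop (R := ℝ))
  filter_upwards [hs.eventually (gt_mem_nhds one_pos), eventually_ge_atTop 1] with M h1 h2
  exact ((div_lt_one (hN M h2)).1 h1).le

lemma tendsto_layerMap (hN : ∀ M : ℕ, 1 ≤ M → 0 < N M)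
    (hs : Tendsto (fun M : ℕ => (M : ℝ) / N M) atTop (𝓝 0)) (z : EuclideanSpace ℝ (Fin d) × ℝ) :
    Tendsto (fun M : ℕ => layerMap M (N M) z) atTop (𝓝 0) := by
  rw [← ofSlab_zero]
  refine (continuous_ofSlab.tendsto _).comp (Tendsto.prodMk_nhds ?_ ?_)
  · simpa using (tendsto_inv_atTop_zero.comp (tendsto_natCast_atTop_atTop (R := ℝ))).smul_const z.1
  · simpa using (tendsto_inv_atTop_zero.comp (tendsto_scale_atTop hN hs)).mul_const z.2

lemma tendsto_smul_layerMap (hs : Tendsto (fun M : ℕ => (M : ℝ) / N M) atTop (𝓝 0))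
    (z : EuclideanSpace ℝ (Fin d) × ℝ) :
    Tendsto (fun M : ℕ => (M : ℝ) • layerMap M (N M) z) atTop (𝓝 (ofSlab (z.1, 0))) := by
  have h : Tendsto (fun M : ℕ => ofSlab (z.1, (M : ℝ) / N M * z.2)) atTop
      (𝓝 (ofSlab (z.1, 0))) := by
    refine (continuous_ofSlab.tendsto _).comp (tendsto_const_nhds.prodMk_nhds ?_)
    simpa using hs.mul_const z.2
  refine h.congr' ?_
  filter_upwards [eventually_ge_atTop 1] with M hM
  rw [smul_layerMap (by positivity)]

variable {Ω : Set (EuclideanSpace ℝ (Fin (d + 1)))} {r : ℝ}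

/-- Concentration of integrals in a boundary layer of width `1 / M` and depth `1 / N`. -/
lemma tendsto_integral_boundaryLayer (hΩ : IsOpen Ω) (hr : 0 < r)
    (hflat : Ω ∩ Metric.ball 0 r = {x | x ∈ Metric.ball 0 r ∧ 0 < x (Fin.last d)})
    (hN : ∀ M : ℕ, 1 ≤ M → 0 < N M)
    (hs : Tendsto (fun M : ℕ => (M : ℝ) / N M) atTop (𝓝 0)) {a : ℝ} (ha : 0 < a)
    {g : ℕ → EuclideanSpace ℝ (Fin (d + 1)) → ℝ} {G : EuclideanSpace ℝ (Fin d) → ℝ} {C R : ℝ}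
    (hmeas : ∀ᶠ M in atTop, AEStronglyMeasurable (g M) (volume.restrict Ω))
    (hbd : ∀ᶠ M in atTop, ∀ x ∈ Ω, |g M x| ≤ C)
    (hsupp : ∀ᶠ M : ℕ in atTop, ∀ x ∈ Ω, R < ‖(M : ℝ) • x‖ → g M x = 0)
    (hlim : ∀ y t, 0 < t → Tendsto (fun M : ℕ => g M (layerMap M (N M) (y, t))) atTop (𝓝 (G y))) :
    Tendsto (fun M : ℕ => (M : ℝ) ^ d * N M *
      ∫ x in Ω, g M x * Real.exp (-a * N M * x (Fin.last d))) atTop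
      (𝓝 (1 / a * ∫ y, G y)) := by
  set k : ℕ → EuclideanSpace ℝ (Fin (d + 1)) → ℝ := fun M x =>
    Ω.indicator (fun x => g M x * Real.exp (-a * N M * x (Fin.last d))) x
  have hcontE : ∀ M, Continuous fun x : EuclideanSpace ℝ (Fin (d + 1)) =>
      Real.exp (-a * N M * x (Fin.last d)) := fun M =>
    Real.continuous_exp.comp (continuous_const.mul (PiLp.continuous_apply 2 _ _))
  have hkmeas : ∀ᶠ M in atTop, AEStronglyMeasurable (k M) volume := by
    filter_upwards [hmeas] with M hM
    rw [aestronglyMeasurable_indicator_iff hΩ.measurableSet]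
    exact hM.mul (hcontE M).aestronglyMeasurable
  have hmem : ∀ x : EuclideanSpace ℝ (Fin (d + 1)), ‖x‖ < r → (x ∈ Ω ↔ 0 < x (Fin.last d)) := by
    intro x hx
    have hb : x ∈ Metric.ball (0 : EuclideanSpace ℝ (Fin (d + 1))) r := by simpa using hx
    have := Set.ext_iff.1 hflat x
    simpa [hx] using this
  have hMr : ∀ᶠ M : ℕ in atTop, R < M * r := by
    have : Tendsto (fun M : ℕ => (M : ℝ) * r) atTop atTop :=
      (tendsto_natCast_atTop_atTop (R := ℝ)).atTop_mul_const hr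
    exact this.eventually_gt_atTop R
  have hlow : ∀ᶠ M : ℕ in atTop, ∀ x, k M x ≠ 0 → x ∈ Ω ∧ ‖(M : ℝ) • x‖ ≤ R ∧
      0 < x (Fin.last d) := by
    filter_upwards [hsupp, hMr, eventually_ge_atTop 1] with M h1 h2 hM x hx
    have hxΩ : x ∈ Ω := Set.mem_of_indicator_ne_zero hx
    have h3 : ‖(M : ℝ) • x‖ ≤ R := by
      by_contra hcon
      push Not at hcon
      exact hx (by simp [k, h1 x hxΩ hcon])
    refine ⟨hxΩ, h3, (hmem x ?_).1 hxΩ⟩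
    rw [norm_smul, Real.norm_natCast] at h3
    exact lt_of_mul_lt_mul_left (h3.trans_lt h2) (Nat.cast_nonneg M)
  have hmain : Tendsto (fun M : ℕ => ∫ z : EuclideanSpace ℝ (Fin d) × ℝ,
      k M (layerMap M (N M) z)) atTop (𝓝 (∫ z : EuclideanSpace ℝ (Fin d) × ℝ,
        G z.1 * (Set.Ioi (0 : ℝ)).indicator (fun t => Real.exp (-a * t)) z.2)) := by
    refine tendsto_integral_filter_of_dominated_convergence
      (fun z => (Metric.closedBall (0 : EuclideanSpace ℝ (Fin d)) R).indicator (fun _ => |C|) z.1 *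
        (Set.Ioi (0 : ℝ)).indicator (fun t => Real.exp (-a * t)) z.2) ?_ ?_ ?_ ?_
    · filter_upwards [hkmeas, eventually_ge_atTop 1] with M hM h1
      exact aestronglyMeasurable_comp_layerMap (by positivity) (hN M h1) hM
    · filter_upwards [hlow, hbd, eventually_ge_atTop 1] with M h1 h2 hM
      refine ae_of_all _ fun z => ?_
      by_cases hz : k M (layerMap M (N M) z) = 0
      · rw [hz, norm_zero]
        exact mul_nonneg (Set.indicator_nonneg (fun _ _ => abs_nonneg C) _)
          (Set.indicator_nonneg (fun _ _ => (Real.exp_pos _).le) _)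
      obtain ⟨hxΩ, hR, hpos⟩ := h1 _ hz
      have hNM := hN M hM
      have hz2 : 0 < z.2 := by
        rw [layerMap_last] at hpos
        exact pos_of_mul_pos_right hpos (by positivity)
      have hz1 : ‖z.1‖ ≤ R := by
        rw [smul_layerMap (by positivity)] at hR
        exact (norm_fst_le_ofSlab (z.1, (M : ℝ) / N M * z.2)).trans hR
      have e : k M (layerMap M (N M) z) = g M (layerMap M (N M) z) * Real.exp (-a * z.2) := by
        simp only [k]
        rw [Set.indicator_of_mem hxΩ, layerMap_last]
        congr 2; field_simp
      rw [e, Set.indicator_of_mem (by simpa using hz1), Set.indicator_of_mem (by simpa using hz2),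
        norm_mul, Real.norm_of_nonneg (Real.exp_pos _).le]
      gcongr
      exact (h2 _ hxΩ).trans (le_abs_self C)
    · refine Integrable.mul_prod ?_ ?_
      · exact (integrable_indicator_iff Metric.isClosed_closedBall.measurableSet).2
          (integrableOn_const (isCompact_closedBall (0 : EuclideanSpace ℝ (Fin d)) R).measure_lt_top.ne)
      · exact (integrable_indicator_iff measurableSet_Ioi).2
          (integrableOn_exp_mul_Ioi (by linarith) 0)
    · refine ae_of_all _ fun z => ?_
      by_cases hz : 0 < z.2
      · rw [Set.indicator_of_mem (by simpa using hz)]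
        refine ((hlim z.1 z.2 hz).mul_const (Real.exp (-a * z.2))).congr' ?_
        have hball := (tendsto_layerMap hN hs z).eventually
          (Metric.ball_mem_nhds (0 : EuclideanSpace ℝ (Fin (d + 1))) hr)
        filter_upwards [hball, eventually_ge_atTop 1] with M h1 hM
        have hNM := hN M hM
        have hxΩ : layerMap M (N M) z ∈ Ω := by
          refine (hmem _ (by simpa using h1)).2 ?_
          rw [layerMap_last]; positivity
        simp only [k]
        rw [Set.indicator_of_mem hxΩ, layerMap_last]
        congr 2; field_simp
      · rw [Set.indicator_of_notMem (by simpa using hz), mul_zero]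
        refine tendsto_const_nhds.congr' ?_
        filter_upwards [hlow, eventually_ge_atTop 1] with M h1 hM
        by_contra hcon
        have := (h1 _ (Ne.symm hcon)).2.2
        rw [layerMap_last] at this
        have hNM := hN M hM
        exact hz (pos_of_mul_pos_right this (by positivity))
  have hval : ∫ z : EuclideanSpace ℝ (Fin d) × ℝ,
      G z.1 * (Set.Ioi (0 : ℝ)).indicator (fun t => Real.exp (-a * t)) z.2 =
      1 / a * ∫ y, G y := by
    rw [Measure.volume_eq_prod, integral_prod_mul, integral_indicator measurableSet_Ioi,
      integral_exp_mul_Ioi (by linarith)]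
    simp; ring
  rw [← hval]
  refine hmain.congr' ?_
  filter_upwards [eventually_ge_atTop 1] with M hM
  rw [integral_layerMap (by positivity) (hN M hM), integral_indicator hΩ.measurableSet]

end BoundaryLayer

end PLaplaceBoundary

namespace PLaplaceBoundary

section LayerHardy

variable {d : ℕ}

/-- A smooth cutoff, equal to one on the unit ball, which is nonincreasing in the last coordinate
on the upper half space. -/
structure IsLayerBump (ψ : EuclideanSpace ℝ (Fin (d + 1)) → ℝ) (C : ℝ) : Prop where
  smooth : ContDiff ℝ ∞ ψ
  nonneg : ∀ x, 0 ≤ ψ x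
  le_one : ∀ x, ψ x ≤ 1
  eq_one : ∀ x, ‖x‖ ≤ 1 → ψ x = 1
  eq_zero : ∀ x, 2 ≤ ‖x‖ → ψ x = 0
  deriv_bound : ∀ x, |fderiv ℝ ψ x (EuclideanSpace.single (Fin.last d) 1)| ≤ C
  deriv_nonpos : ∀ x, 0 ≤ x (Fin.last d) →
    fderiv ℝ ψ x (EuclideanSpace.single (Fin.last d) 1) ≤ 0

lemma exists_isLayerBump (d : ℕ) :
    ∃ (ψ : EuclideanSpace ℝ (Fin (d + 1)) → ℝ) (C : ℝ), IsLayerBump ψ C := by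
  set ψ : EuclideanSpace ℝ (Fin (d + 1)) → ℝ := fun x => Real.smoothTransition (4 - ‖x‖ ^ 2)
  have hsm : ContDiff ℝ ∞ ψ :=
    Real.smoothTransition.contDiff.comp (contDiff_const.sub (contDiff_norm_sq ℝ))
  have hzero : ∀ x, 2 ≤ ‖x‖ → ψ x = 0 := fun x hx =>
    Real.smoothTransition.zero_of_nonpos (by nlinarith)
  have hcomp : HasCompactSupport ψ := by
    refine HasCompactSupport.intro (isCompact_closedBall (0 : EuclideanSpace ℝ (Fin (d + 1))) 2)
      fun x hx => hzero x ?_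
    rw [Metric.mem_closedBall, dist_zero_right, not_le] at hx
    exact hx.le
  obtain ⟨C, hC⟩ := ((hsm.continuous_fderiv (by simp)).clm_apply
    (continuous_const (y := EuclideanSpace.single (Fin.last d) (1 : ℝ)))).bounded_above_of_compact_support
    (hcomp.fderiv_apply (𝕜 := ℝ) _)
  refine ⟨ψ, C, hsm, fun x => Real.smoothTransition.nonneg _, fun x => Real.smoothTransition.le_one _,
    fun x hx => Real.smoothTransition.one_of_one_le ?_, hzero, hC, fun x hx => ?_⟩
  · nlinarith [norm_nonneg x]
  · have h1 : HasDerivAt Real.smoothTransition (deriv Real.smoothTransition (4 - ‖x‖ ^ 2))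
        (4 - ‖x‖ ^ 2) :=
      ((Real.smoothTransition.contDiff (n := 1)).differentiable (by simp) _).hasDerivAt
    have h2 := h1.comp_hasFDerivAt x ((hasStrictFDerivAt_norm_sq x).hasFDerivAt.const_sub 4)
    have h3 : fderiv ℝ ψ x = _ := h2.fderiv
    have h4 : 0 ≤ deriv Real.smoothTransition (4 - ‖x‖ ^ 2) :=
      Real.smoothTransition.monotone.deriv_nonneg
    rw [h3]
    simp only [_root_.smul_apply, _root_.neg_apply, innerSL_apply_apply,
      EuclideanSpace.inner_single_right, smul_eq_mul, nsmul_eq_mul]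
    simp only [conj_trivial, one_mul]
    have : 0 ≤ deriv Real.smoothTransition (4 - ‖x‖ ^ 2) * x (Fin.last d) := by positivity
    push_cast
    linarith

variable {Ω : Set (EuclideanSpace ℝ (Fin (d + 1)))} {r p C : ℝ} {N : ℕ → ℝ}
  {ψ : EuclideanSpace ℝ (Fin (d + 1)) → ℝ}

lemma mem_iff_of_flat
    (hflat : Ω ∩ Metric.ball 0 r = {x | x ∈ Metric.ball 0 r ∧ 0 < x (Fin.last d)})
    {x : EuclideanSpace ℝ (Fin (d + 1))} (hx : ‖x‖ < r) : x ∈ Ω ↔ 0 < x (Fin.last d) := by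
  have := Set.ext_iff.1 hflat x
  simpa [hx] using this

/-- A Hardy type inequality in the boundary layer. -/
lemma layer_hardy (hΩ : IsOpen Ω)
    (hflat : Ω ∩ Metric.ball 0 r = {x | x ∈ Metric.ball 0 r ∧ 0 < x (Fin.last d)})
    (hp : 1 < p) (hψ : IsLayerBump ψ C) {a m ν : ℝ} (ha : 0 < a) (hm : 0 < m) (hν : 0 < ν)
    (hmν : m ≤ ν) (hmr : 2 < m * r) {φ : EuclideanSpace ℝ (Fin (d + 1)) → ℂ}
    (hφ : IsTestFunction Ω φ) :
    ν ^ p * ∫ x in Ω, ψ (m • x) * ‖φ x‖ ^ p * Real.exp (-a * ν * x (Fin.last d)) ≤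
      (2 * p / a) ^ p * ((a + C) / a) * ∫ x in Ω, ‖grad φ x‖ ^ p := by
  have hp0 : 0 < p := by linarith
  set e : EuclideanSpace ℝ (Fin (d + 1)) := EuclideanSpace.single (Fin.last d) 1
  set E : EuclideanSpace ℝ (Fin (d + 1)) → ℝ := fun x => Real.exp (-a * ν * x (Fin.last d))
  set F : EuclideanSpace ℝ (Fin (d + 1)) → ℝ := fun x => -(E x * ψ (m • x))
  have hlin : ContDiff ℝ 1 fun x : EuclideanSpace ℝ (Fin (d + 1)) => x (Fin.last d) :=
    (EuclideanSpace.proj (Fin.last d) : EuclideanSpace ℝ (Fin (d + 1)) →L[ℝ] ℝ).contDiff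
  have hE1 : ContDiff ℝ 1 E := Real.contDiff_exp.comp (contDiff_const.mul hlin)
  have hψ1 : ContDiff ℝ 1 fun x => ψ (m • x) :=
    (hψ.smooth.of_le (by simp)).comp (contDiff_const_smul m)
  have hF1 : ContDiff ℝ 1 F := (hE1.mul hψ1).neg
  have hC0 : 0 ≤ C := (abs_nonneg _).trans (hψ.deriv_bound 0)
  have hE0 : ∀ x, 0 < E x := fun x => Real.exp_pos _
  have hD : ∀ x, fderiv ℝ F x e =
      a * ν * (E x * ψ (m • x)) + E x * m * (-(fderiv ℝ ψ (m • x) e)) := by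
    intro x
    have h1 : HasFDerivAt (fun x : EuclideanSpace ℝ (Fin (d + 1)) => -a * ν * x (Fin.last d))
        ((-a * ν) • (EuclideanSpace.proj (Fin.last d) : EuclideanSpace ℝ (Fin (d + 1)) →L[ℝ] ℝ)) x :=
      ((EuclideanSpace.proj (Fin.last d) :
        EuclideanSpace ℝ (Fin (d + 1)) →L[ℝ] ℝ).hasFDerivAt).const_mul _
    have h2 : HasFDerivAt E _ x := h1.exp
    have h3 : HasFDerivAt (fun x => ψ (m • x)) _ x :=
      (hψ.smooth.differentiable (by simp) (m • x)).hasFDerivAt.comp x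
        ((hasFDerivAt_id x).const_smul m)
    have h4 : HasFDerivAt F _ x := (h2.mul h3).neg
    rw [h4.fderiv]
    simp [e, E]
    ring
  have hcase : ∀ x ∈ Ω, (ψ (m • x) = 0 ∧ fderiv ℝ ψ (m • x) e = 0) ∨ 0 < x (Fin.last d) := by
    intro x hx
    by_cases h : 2 ≤ ‖m • x‖
    · left
      have h0 := hψ.eq_zero _ h
      refine ⟨h0, ?_⟩
      have : IsLocalMin ψ (m • x) := Eventually.of_forall fun y => by
        rw [h0]; exact hψ.nonneg y
      rw [this.fderiv_eq_zero]; simp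
    · right
      push Not at h
      rw [norm_smul, Real.norm_of_nonneg hm.le] at h
      exact (mem_iff_of_flat hflat (lt_of_mul_lt_mul_left (h.trans hmr) hm.le)).1 hx
  have hDlow : ∀ x ∈ Ω, a * ν * (E x * ψ (m • x)) ≤ fderiv ℝ F x e := by
    intro x hx
    rw [hD]
    refine le_add_of_nonneg_right ?_
    rcases hcase x hx with h | h
    · simp [h.2]
    · have h1 : 0 ≤ (m • x) (Fin.last d) := by simpa using mul_nonneg hm.le h.le
      have h2 := neg_nonneg.2 (hψ.deriv_nonpos _ h1)
      have := hE0 x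
      positivity
  have hDup : ∀ x ∈ Ω, fderiv ℝ F x e ≤ (a + C) * ν := by
    intro x hx
    rw [hD]
    rcases hcase x hx with h | h
    · rw [h.1, h.2]; simp; positivity
    · have hE' : E x ≤ 1 := Real.exp_le_one_iff.2 (by
        have : 0 ≤ a * ν * x (Fin.last d) := by positivity
        linarith)
      have h1 : a * ν * (E x * ψ (m • x)) ≤ a * ν * (1 * 1) := by
        have := hψ.nonneg (m • x)
        have := hψ.le_one (m • x)
        gcongr
      have h2 : E x * m * (-(fderiv ℝ ψ (m • x) e)) ≤ 1 * ν * C := by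
        have hh := (neg_le_abs _).trans (hψ.deriv_bound (m • x))
        calc E x * m * (-(fderiv ℝ ψ (m • x) e)) ≤ E x * m * C :=
              mul_le_mul_of_nonneg_left hh (mul_nonneg (hE0 x).le hm.le)
          _ ≤ 1 * ν * C := by gcongr
      linarith
  have hardy := weighted_hardy hΩ hp hF1 hφ (Fin.last d) (K := 1 / (a * ν)) (by positivity)
    fun x hx => by
      have h0 : 0 ≤ E x * ψ (m • x) := mul_nonneg (hE0 x).le (hψ.nonneg _)
      rw [abs_neg, abs_of_nonneg h0, one_div, inv_mul_eq_div, le_div_iff₀ (by positivity)]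
      linarith [hDlow x hx]
  have hgs : HasCompactSupport fun x => ‖φ x‖ ^ p :=
    hφ.compact.comp_left (g := fun z : ℂ => ‖z‖ ^ p) (by simp [hp0.ne'])
  have hgc : Continuous fun x => ‖φ x‖ ^ p :=
    hφ.smooth.continuous.norm.rpow_const fun _ => Or.inr hp0.le
  have hGs : HasCompactSupport fun x => ‖grad φ x‖ ^ p :=
    (hasCompactSupport_grad hφ.compact).comp_left
      (g := fun z : EuclideanSpace ℂ (Fin (d + 1)) => ‖z‖ ^ p) (by simp [hp0.ne'])
  have hGc : Continuous fun x => ‖grad φ x‖ ^ p :=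
    (continuous_grad hφ.smooth).norm.rpow_const fun _ => Or.inr hp0.le
  have hF' : Continuous fun x => fderiv ℝ F x e :=
    (hF1.continuous_fderiv (by simp)).clm_apply continuous_const
  have i1 : Integrable (fun x => a * ν * (ψ (m • x) * ‖φ x‖ ^ p * E x)) volume :=
    (((hψ1.continuous.mul hgc).mul hE1.continuous).integrable_of_hasCompactSupport
      (hgs.mul_left.mul_right)).const_mul _
  have i2 : Integrable (fun x => fderiv ℝ F x e * ‖φ x‖ ^ p) volume :=
    (hF'.mul hgc).integrable_of_hasCompactSupport hgs.mul_left
  have i3 : Integrable (fun x => fderiv ℝ F x e * ‖grad φ x‖ ^ p) volume :=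
    (hF'.mul hGc).integrable_of_hasCompactSupport hGs.mul_left
  have i4 : Integrable (fun x => (a + C) * ν * ‖grad φ x‖ ^ p) volume :=
    (hGc.integrable_of_hasCompactSupport hGs).const_mul _
  have s1 : ∫ x in Ω, a * ν * (ψ (m • x) * ‖φ x‖ ^ p * E x) ≤
      ∫ x in Ω, fderiv ℝ F x e * ‖φ x‖ ^ p := by
    refine setIntegral_mono_on i1.integrableOn i2.integrableOn hΩ.measurableSet fun x hx => ?_
    have := mul_le_mul_of_nonneg_right (hDlow x hx) (by positivity : 0 ≤ ‖φ x‖ ^ p)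
    linarith
  have s2 : ∫ x in Ω, fderiv ℝ F x e * ‖grad φ x‖ ^ p ≤
      ∫ x in Ω, (a + C) * ν * ‖grad φ x‖ ^ p := by
    refine setIntegral_mono_on i3.integrableOn i4.integrableOn hΩ.measurableSet fun x hx => ?_
    exact mul_le_mul_of_nonneg_right (hDup x hx) (by positivity)
  rw [integral_const_mul] at s1 s2
  have hfin : a * ν * ∫ x in Ω, ψ (m • x) * ‖φ x‖ ^ p * E x ≤
      (2 * p * (1 / (a * ν))) ^ p * ((a + C) * ν * ∫ x in Ω, ‖grad φ x‖ ^ p) :=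
    s1.trans (hardy.trans (mul_le_mul_of_nonneg_left s2 (by positivity)))
  have hpow : (2 * p * (1 / (a * ν))) ^ p = (2 * p / a) ^ p / ν ^ p := by
    rw [← Real.div_rpow (by positivity) hν.le]
    congr 1; field_simp
  have hνp : 0 < ν ^ p := Real.rpow_pos_of_pos hν p
  rw [hpow, ← le_div_iff₀' (by positivity)] at hfin
  calc ν ^ p * ∫ x in Ω, ψ (m • x) * ‖φ x‖ ^ p * E x
      ≤ ν ^ p * ((2 * p / a) ^ p / ν ^ p * ((a + C) * ν * ∫ x in Ω, ‖grad φ x‖ ^ p) / (a * ν)) := by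
        gcongr
    _ = _ := by field_simp

end LayerHardy

end PLaplaceBoundary

namespace PLaplaceBoundary

section Waves

lemma grad_mul {n : ℕ} {f g : EuclideanSpace ℝ (Fin n) → ℂ} (hf : Differentiable ℝ f)
    (hg : Differentiable ℝ g) (x) :
    grad (fun x => f x * g x) x = f x • grad g x + g x • grad f x := by
  ext j
  simp only [grad, PiLp.add_apply, PiLp.smul_apply, smul_eq_mul]
  rw [fderiv_fun_mul (hf x) (hg x)]; rfl

lemma grad_comp_smul {n : ℕ} {f : EuclideanSpace ℝ (Fin n) → ℂ} (hf : Differentiable ℝ f) (c : ℝ)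
    (x) : grad (fun x => f (c • x)) x = (c : ℂ) • grad f (c • x) := by
  ext j
  have h : HasFDerivAt (fun x => f (c • x)) _ x :=
    (hf (c • x)).hasFDerivAt.comp x ((hasFDerivAt_id x).const_smul c)
  simp only [grad, PiLp.smul_apply, smul_eq_mul]
  rw [h.fderiv]
  simp

variable {d : ℕ} (β : EuclideanSpace ℝ (Fin (d + 1)))

/-- The complex vector `i s β - t eₙ`. -/
noncomputable def waveVec (s t : ℝ) : EuclideanSpace ℂ (Fin (d + 1)) :=
  WithLp.toLp 2 fun j => Complex.I * s * β j - t * if j = Fin.last d then 1 else 0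

/-- The exponential `e^{(i s β - t eₙ)·x}`. -/
noncomputable def wave (s t : ℝ) (x : EuclideanSpace ℝ (Fin (d + 1))) : ℂ :=
  Complex.exp (Complex.I * s * ∑ j, (β j : ℂ) * x j - t * x (Fin.last d))

lemma norm_wave (s t : ℝ) (x : EuclideanSpace ℝ (Fin (d + 1))) :
    ‖wave β s t x‖ = Real.exp (-t * x (Fin.last d)) := by
  rw [wave, Complex.norm_exp]
  congr 1
  have : Complex.I * s * ∑ j, (β j : ℂ) * x j = ((s * ∑ j, β j * x j : ℝ) : ℂ) * Complex.I := by
    push_cast; ring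
  rw [this, Complex.sub_re, Complex.re_ofReal_mul, ← Complex.ofReal_mul, Complex.ofReal_re]
  simp

lemma wave_mul (s t s' t' : ℝ) (x : EuclideanSpace ℝ (Fin (d + 1))) :
    wave β s t x * wave β s' t' x = wave β (s + s') (t + t') x := by
  rw [wave, wave, wave, ← Complex.exp_add]
  congr 1; push_cast; ring

lemma wave_zero (t : ℝ) (x : EuclideanSpace ℝ (Fin (d + 1))) :
    wave β 0 t x = (Real.exp (-t * x (Fin.last d)) : ℝ) := by
  rw [wave, Complex.ofReal_exp]; congr 1; push_cast; ring

lemma cexpWave_smul (s : ℝ) (x : EuclideanSpace ℝ (Fin (d + 1))) :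
    cexpWave β (s • x) = wave β s s x := by
  rw [cexpWave, wave]
  congr 1
  simp only [PiLp.smul_apply, smul_eq_mul]
  push_cast
  congr 1
  rw [Finset.mul_sum, Finset.mul_sum]
  exact Finset.sum_congr rfl fun j _ => by ring

/-- The linear exponent of `wave`. -/
noncomputable def waveExponent (s t : ℝ) : EuclideanSpace ℝ (Fin (d + 1)) →L[ℝ] ℂ :=
  ∑ j, ((EuclideanSpace.proj j : EuclideanSpace ℝ (Fin (d + 1)) →L[ℝ] ℝ).smulRight (waveVec β s t j))

lemma waveExponent_apply (s t : ℝ) (x : EuclideanSpace ℝ (Fin (d + 1))) :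
    waveExponent β s t x = ∑ j, (x j : ℂ) * waveVec β s t j := by
  simp [waveExponent]

lemma wave_eq_exp (s t : ℝ) : wave β s t = fun x => Complex.exp (waveExponent β s t x) := by
  ext x
  rw [wave, waveExponent_apply]
  congr 1
  simp only [waveVec, mul_sub, Finset.sum_sub_distrib]
  congr 1
  · rw [Finset.mul_sum]; exact Finset.sum_congr rfl fun j _ => by ring
  · rw [Finset.sum_eq_single (Fin.last d)] <;> simp +contextual [mul_comm]

lemma contDiff_wave (s t : ℝ) : ContDiff ℝ ∞ (wave β s t) := by
  rw [wave_eq_exp]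
  exact (waveExponent β s t).contDiff.cexp

lemma differentiable_wave (s t : ℝ) : Differentiable ℝ (wave β s t) :=
  (contDiff_wave β s t).differentiable (by simp)

lemma grad_wave (s t : ℝ) (x : EuclideanSpace ℝ (Fin (d + 1))) :
    grad (wave β s t) x = wave β s t x • waveVec β s t := by
  ext j
  have h : HasFDerivAt (fun x => Complex.exp (waveExponent β s t x)) _ x :=
    (waveExponent β s t).hasFDerivAt.cexp
  rw [wave_eq_exp]
  simp only [grad, PiLp.smul_apply, smul_eq_mul]
  rw [h.fderiv]
  simp only [_root_.smul_apply, smul_eq_mul, waveExponent_apply]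
  congr 1
  rw [Finset.sum_eq_single j] <;> simp +contextual

lemma conjVec_waveVec (s t : ℝ) : conjVec (waveVec β s t) = waveVec β (-s) t := by
  ext j
  simp only [conjVec_apply, waveVec, map_sub, map_mul, Complex.conj_I, Complex.conj_ofReal]
  split_ifs <;> simp

variable {β}

lemma sum_waveVec_mul (hβ : β (Fin.last d) = 0) (s t s' t' : ℝ) :
    ∑ j, waveVec β s t j * waveVec β s' t' j = ((t * t' - s * s' * ‖β‖ ^ 2 : ℝ) : ℂ) := by
  rw [EuclideanSpace.norm_sq_eq, Fin.sum_univ_castSucc, Fin.sum_univ_castSucc (n := d)]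
  have h : ∀ i : Fin d, waveVec β s t i.castSucc * waveVec β s' t' i.castSucc =
      -(s * s' * ((β i.castSucc : ℂ) ^ 2)) := by
    intro i
    have : i.castSucc ≠ Fin.last d := Fin.castSucc_ne_last i
    simp only [waveVec, this, if_false, mul_zero, sub_zero]
    linear_combination (s * s' * (β i.castSucc : ℂ) ^ 2) * Complex.I_sq
  simp only [h]
  simp only [waveVec, hβ, Real.norm_eq_abs, sq_abs]
  push_cast
  rw [Finset.sum_neg_distrib, ← Finset.mul_sum]
  simp
  ring

lemma sum_waveVec_conj (hβ : β (Fin.last d) = 0) (s t : ℝ) :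
    ‖waveVec β s t‖ ^ 2 = t ^ 2 + s ^ 2 * ‖β‖ ^ 2 := by
  have h := sum_mul_conj_self (waveVec β s t)
  have h2 : ∑ j, waveVec β s t j * (starRingEnd ℂ) (waveVec β s t j) =
      ∑ j, waveVec β s t j * waveVec β (-s) t j := by
    rw [← conjVec_waveVec]; rfl
  rw [h2, sum_waveVec_mul hβ] at h
  have := Complex.ofReal_injective h
  linarith

variable {p : ℝ}

lemma norm_waveVec_one (hβ : β (Fin.last d) = 0) (hn : ‖β‖ ^ 2 = p - 1) :
    ‖waveVec β 1 1‖ ^ 2 = p := by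
  rw [sum_waveVec_conj hβ, hn]; ring

/-- The field `e^{-ν(iβ + (p-1)eₙ)·x} (-iβ - eₙ)` is divergence free, so multiplying by a cutoff
only produces the derivatives of the cutoff. -/
lemma integral_wave_mul_grad {Ω : Set (EuclideanSpace ℝ (Fin (d + 1)))}
    (hβ : β (Fin.last d) = 0) (hn : ‖β‖ ^ 2 = p - 1) (ν : ℝ)
    {f φ : EuclideanSpace ℝ (Fin (d + 1)) → ℂ} (hf : ContDiff ℝ ∞ f) (hc : HasCompactSupport f)
    (hφ : IsTestFunction Ω φ) :
    ∫ x in Ω, f x * wave β (-ν) ((p - 1) * ν) x * ∑ j, waveVec β (-1) 1 j * grad φ x j =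
      -∫ x in Ω, (∑ j, waveVec β (-1) 1 j * grad f x j) * wave β (-ν) ((p - 1) * ν) x * φ x := by
  set k := wave β (-ν) ((p - 1) * ν)
  have hk : ContDiff ℝ ∞ k := contDiff_wave _ _ _
  have hg : ContDiff ℝ ∞ fun x => f x * k x := hf.mul hk
  have hgc : HasCompactSupport fun x => f x * k x := hc.mul_right
  have hw := (isSobolev_of_contDiff (Ω := Ω) p hg hgc).weak φ hφ
  have i1 : ∀ j, Integrable (fun x => f x * k x * grad φ x j) (volume.restrict Ω) := fun j =>
    ((hg.continuous.mul (IsSobolev.continuous_grad_coord hφ j)).integrable_of_hasCompactSupport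
      hgc.mul_right).integrableOn
  have i2 : ∀ j, Integrable (fun x => grad (fun x => f x * k x) x j * φ x)
      (volume.restrict Ω) := fun j =>
    ((((PiLp.continuous_apply 2 _ j).comp (continuous_grad hg)).mul
      hφ.smooth.continuous).integrable_of_hasCompactSupport hφ.compact.mul_left).integrableOn
  have e1 : ∀ x, f x * k x * ∑ j, waveVec β (-1) 1 j * grad φ x j =
      ∑ j, waveVec β (-1) 1 j * (f x * k x * grad φ x j) := by
    intro x; rw [Finset.mul_sum]; exact Finset.sum_congr rfl fun j _ => by ring
  have e2 : ∀ x, (∑ j, waveVec β (-1) 1 j * grad f x j) * k x * φ x =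
      ∑ j, waveVec β (-1) 1 j * (grad (fun x => f x * k x) x j * φ x) := by
    intro x
    have h0 : ∑ j, waveVec β (-1) 1 j * waveVec β (-ν) ((p - 1) * ν) j = 0 := by
      rw [sum_waveVec_mul hβ, hn, ← Complex.ofReal_zero]; congr 1; ring
    have h1 : ∀ j, grad (fun x => f x * k x) x j =
        f x * (k x * waveVec β (-ν) ((p - 1) * ν) j) + k x * grad f x j := by
      intro j
      rw [grad_mul (hf.differentiable (by simp)) (hk.differentiable (by simp)), grad_wave]
      simp [k]
    have h2 : ∑ j, waveVec β (-1) 1 j * (grad (fun x => f x * k x) x j * φ x) =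
        f x * k x * φ x * ∑ j, waveVec β (-1) 1 j * waveVec β (-ν) ((p - 1) * ν) j +
        k x * φ x * ∑ j, waveVec β (-1) 1 j * grad f x j := by
      rw [Finset.mul_sum, Finset.mul_sum, ← Finset.sum_add_distrib]
      exact Finset.sum_congr rfl fun j _ => by rw [h1]; ring
    rw [h2, h0]; ring
  simp only [e1, e2]
  rw [integral_finsetSum _ fun j _ => (i1 j).const_mul _,
    integral_finsetSum _ fun j _ => (i2 j).const_mul _, ← Finset.sum_neg_distrib]
  refine Finset.sum_congr rfl fun j _ => ?_
  rw [integral_const_mul, integral_const_mul, hw j, mul_neg]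

end Waves

section BoundaryWave

variable {d : ℕ} {p : ℝ} {η : EuclideanSpace ℝ (Fin (d + 1)) → ℝ}
  {β : EuclideanSpace ℝ (Fin (d + 1))} {N : ℕ → ℝ}

namespace IsAdmissible

lemma tsupport_subset (h : IsAdmissible p η β N) : tsupport η ⊆ Metric.closedBall 0 1 := by
  refine closure_minimal (fun x hx => ?_) Metric.isClosed_closedBall
  rw [Metric.mem_closedBall, dist_zero_right]
  by_contra hcon
  exact hx (h.eq_zero x (not_le.1 hcon).le)

lemma hasCompactSupport (h : IsAdmissible p η β N) : HasCompactSupport η :=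
  (isCompact_closedBall _ _).of_isClosed_subset (isClosed_tsupport η) h.tsupport_subset

lemma contDiff_ofReal (h : IsAdmissible p η β N) : ContDiff ℝ ∞ fun x => (η x : ℂ) :=
  Complex.ofRealCLM.contDiff.comp h.smooth

lemma hasCompactSupport_ofReal (h : IsAdmissible p η β N) :
    HasCompactSupport fun x => (η x : ℂ) :=
  h.hasCompactSupport.comp_left (g := fun t : ℝ => (t : ℂ)) (by simp)

lemma grad_eq_zero (h : IsAdmissible p η β N) {x} (hx : 1 < ‖x‖) :
    grad (fun x => (η x : ℂ)) x = 0 := by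
  have hn : (fun x => (η x : ℂ)) =ᶠ[𝓝 x] fun _ => 0 := by
    filter_upwards [(isOpen_lt continuous_const continuous_norm).mem_nhds hx] with y hy
    simp [h.eq_zero y (le_of_lt hy)]
  ext j
  simp only [grad]
  rw [hn.fderiv_eq]; simp

lemma exists_bounds (h : IsAdmissible p η β N) :
    ∃ K, 0 < K ∧ (∀ x, η x ≤ K) ∧ ∀ x, ‖grad (fun x => (η x : ℂ)) x‖ ≤ K := by
  obtain ⟨K₁, h1⟩ := h.smooth.continuous.bounded_above_of_compact_support h.hasCompactSupport
  obtain ⟨K₂, h2⟩ := (continuous_grad h.contDiff_ofReal).bounded_above_of_compact_support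
    (hasCompactSupport_grad h.hasCompactSupport_ofReal)
  refine ⟨max 1 (max K₁ K₂), by positivity, fun x => ?_, fun x => ?_⟩
  · exact (le_abs_self _).trans ((h1 x).trans ((le_max_left _ _).trans (le_max_right _ _)))
  · exact (h2 x).trans ((le_max_right _ _).trans (le_max_right _ _))

lemma normConst_eq : normConst p η =
    p ^ ((p - 2) / 2) * ∫ y : EuclideanSpace ℝ (Fin d), η (ofSlab (y, 0)) ^ p := rfl

lemma integral_pos (h : IsAdmissible p η β N) (hp : 1 < p) :
    0 < ∫ y : EuclideanSpace ℝ (Fin d), η (ofSlab (y, 0)) ^ p := by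
  have hp0 : 0 < p := by linarith
  have hc : Continuous fun y : EuclideanSpace ℝ (Fin d) => η (ofSlab (y, 0)) :=
    h.smooth.continuous.comp (continuous_ofSlab.comp (by fun_prop))
  have hcp : Continuous fun y : EuclideanSpace ℝ (Fin d) => η (ofSlab (y, 0)) ^ p :=
    hc.rpow_const fun _ => Or.inr hp0.le
  refine hcp.integral_pos_of_hasCompactSupport_nonneg_nonzero (x := 0) ?_
    (fun y => Real.rpow_nonneg (h.nonneg _) _) ?_
  · refine HasCompactSupport.intro (isCompact_closedBall (0 : EuclideanSpace ℝ (Fin d)) 1)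
      fun y hy => ?_
    rw [Metric.mem_closedBall, dist_zero_right, not_le] at hy
    rw [h.eq_zero _ (hy.le.trans (norm_fst_le_ofSlab (y, 0))), Real.zero_rpow hp0.ne']
  · rw [ofSlab_zero, h.eq_one 0 (by simp)]; simp

lemma normConst_pos (h : IsAdmissible p η β N) (hp : 1 < p) : 0 < normConst p η := by
  rw [normConst_eq]
  exact mul_pos (Real.rpow_pos_of_pos (by linarith) _) (h.integral_pos hp)

end IsAdmissible

/-- The amplitude `(M^d N^{1-p} / c_p)^{1/p}`. -/
noncomputable def amplitude (d : ℕ) (p : ℝ) (η : EuclideanSpace ℝ (Fin (d + 1)) → ℝ) (N : ℕ → ℝ)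
    (M : ℕ) : ℝ := ((M : ℝ) ^ d * N M ^ (1 - p) / normConst p η) ^ (1 / p)

lemma boundaryWave_eq (p : ℝ) (η : EuclideanSpace ℝ (Fin (d + 1)) → ℝ)
    (β : EuclideanSpace ℝ (Fin (d + 1))) (N : ℕ → ℝ) (M : ℕ) :
    boundaryWave p η β N M = fun x =>
      (amplitude d p η N M : ℂ) * ((η ((M : ℝ) • x) : ℂ) * wave β (N M) (N M) x) := by
  ext x
  rw [boundaryWave, cexpWave_smul, mul_assoc]; rfl

namespace IsAdmissible

lemma amplitude_nonneg (h : IsAdmissible p η β N) (hp : 1 < p) {M : ℕ} (hM : 1 ≤ M) :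
    0 ≤ amplitude d p η N M := by
  have := h.normConst_pos hp
  have := h.scale_pos M hM
  unfold amplitude; positivity

lemma amplitude_mul_rpow (h : IsAdmissible p η β N) (hp : 1 < p) {M : ℕ} (hM : 1 ≤ M) :
    (amplitude d p η N M * N M) ^ p = (M : ℝ) ^ d * N M / normConst p η := by
  have hc := h.normConst_pos hp
  have hN := h.scale_pos M hM
  rw [Real.mul_rpow (h.amplitude_nonneg hp hM) hN.le, amplitude, ← Real.rpow_mul (by positivity),
    one_div_mul_cancel (by linarith), Real.rpow_one, div_mul_eq_mul_div, mul_assoc,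
    ← Real.rpow_add hN]
  simp

lemma contDiff_cutoff (h : IsAdmissible p η β N) (M : ℕ) :
    ContDiff ℝ ∞ fun x => (η ((M : ℝ) • x) : ℂ) :=
  h.contDiff_ofReal.comp (contDiff_const_smul (M : ℝ))

lemma contDiff_boundaryWave (h : IsAdmissible p η β N) (M : ℕ) :
    ContDiff ℝ ∞ (boundaryWave p η β N M) := by
  rw [boundaryWave_eq]
  exact contDiff_const.mul ((h.contDiff_cutoff M).mul (contDiff_wave _ _ _))

lemma boundaryWave_eq_zero (h : IsAdmissible p η β N) (M : ℕ)
    {x : EuclideanSpace ℝ (Fin (d + 1))} (hx : 1 ≤ ‖(M : ℝ) • x‖) :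
    boundaryWave p η β N M x = 0 := by
  rw [boundaryWave_eq]; simp [h.eq_zero _ hx]

lemma hasCompactSupport_boundaryWave (h : IsAdmissible p η β N) {M : ℕ} (hM : 1 ≤ M) :
    HasCompactSupport (boundaryWave p η β N M) := by
  refine HasCompactSupport.intro (isCompact_closedBall (0 : EuclideanSpace ℝ (Fin (d + 1))) 1)
    fun x hx => h.boundaryWave_eq_zero M ?_
  rw [Metric.mem_closedBall, dist_zero_right, not_le] at hx
  rw [norm_smul, Real.norm_natCast]
  have : (1 : ℝ) ≤ M := by exact_mod_cast hM
  nlinarith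

end IsAdmissible

/-- The leading profile `η(y) b + ε ∇η(y)` of the gradient, with `b = iβ - eₙ`. -/
noncomputable def gradProfile (η : EuclideanSpace ℝ (Fin (d + 1)) → ℝ)
    (β : EuclideanSpace ℝ (Fin (d + 1))) (ε : ℝ) (y : EuclideanSpace ℝ (Fin (d + 1))) :
    EuclideanSpace ℂ (Fin (d + 1)) :=
  (η y : ℂ) • waveVec β 1 1 + (ε : ℂ) • grad (fun x => (η x : ℂ)) y

lemma waveVec_smul (ν : ℝ) : waveVec β ν ν = (ν : ℂ) • waveVec β 1 1 := by
  ext j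
  simp only [waveVec, PiLp.smul_apply, smul_eq_mul]
  push_cast; ring

lemma IsAdmissible.grad_boundaryWave (h : IsAdmissible p η β N) {M : ℕ} (hM : 1 ≤ M)
    (x : EuclideanSpace ℝ (Fin (d + 1))) :
    grad (boundaryWave p η β N M) x =
      (((amplitude d p η N M * N M : ℝ) : ℂ) * wave β (N M) (N M) x) •
        gradProfile η β (M / N M) ((M : ℝ) • x) := by
  have hN : (N M : ℂ) ≠ 0 := by exact_mod_cast (h.scale_pos M hM).ne'
  have h1 : Differentiable ℝ fun x => (η ((M : ℝ) • x) : ℂ) :=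
    (h.contDiff_cutoff M).differentiable (by simp)
  have h2 := grad_comp_smul (h.contDiff_ofReal.differentiable (by simp)) (M : ℝ) x
  have h3 : Differentiable ℝ fun x => (η ((M : ℝ) • x) : ℂ) * wave β (N M) (N M) x :=
    h1.mul (differentiable_wave _ _ _)
  rw [boundaryWave_eq, grad_smul _ h3, grad_mul h1 (differentiable_wave _ _ _), h2, grad_wave,
    waveVec_smul, gradProfile]
  ext j
  simp only [PiLp.smul_apply, PiLp.add_apply, smul_eq_mul]
  push_cast
  field_simp

lemma IsAdmissible.norm_grad_boundaryWave_rpow (h : IsAdmissible p η β N) (hp : 1 < p) {M : ℕ}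
    (hM : 1 ≤ M) (x : EuclideanSpace ℝ (Fin (d + 1))) :
    ‖grad (boundaryWave p η β N M) x‖ ^ p =
      (M : ℝ) ^ d * N M * (‖gradProfile η β (M / N M) ((M : ℝ) • x)‖ ^ p / normConst p η *
        Real.exp (-p * N M * x (Fin.last d))) := by
  have hA : 0 ≤ amplitude d p η N M * N M :=
    mul_nonneg (h.amplitude_nonneg hp hM) (h.scale_pos M hM).le
  rw [h.grad_boundaryWave hM, norm_smul, norm_mul, Complex.norm_real, Real.norm_of_nonneg hA,
    norm_wave, Real.mul_rpow (by positivity) (norm_nonneg _),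
    Real.mul_rpow hA (Real.exp_pos _).le, h.amplitude_mul_rpow hp hM, ← Real.exp_mul]
  have : -N M * x (Fin.last d) * p = -p * N M * x (Fin.last d) := by ring
  rw [this]; ring

end BoundaryWave

end PLaplaceBoundary

namespace PLaplaceBoundary

section Asymptotics

variable {d : ℕ} {p : ℝ} {η : EuclideanSpace ℝ (Fin (d + 1)) → ℝ}
  {β : EuclideanSpace ℝ (Fin (d + 1))} {N : ℕ → ℝ}
  {Ω : Set (EuclideanSpace ℝ (Fin (d + 1)))} {r c C : ℝ}
  {γ : EuclideanSpace ℝ (Fin (d + 1)) → ℝ}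

namespace IsAdmissible

lemma eventually_layerMap_mem (h : IsAdmissible p η β N) (hr : 0 < r)
    (hflat : Ω ∩ Metric.ball 0 r = {x | x ∈ Metric.ball 0 r ∧ 0 < x (Fin.last d)})
    (y : EuclideanSpace ℝ (Fin d)) {t : ℝ} (ht : 0 < t) :
    ∀ᶠ M : ℕ in atTop, layerMap M (N M) (y, t) ∈ Ω := by
  have hball := (tendsto_layerMap h.scale_pos h.scale (y, t)).eventually
    (Metric.ball_mem_nhds (0 : EuclideanSpace ℝ (Fin (d + 1))) hr)
  filter_upwards [hball, eventually_ge_atTop 1] with M h1 hM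
  have hN := h.scale_pos M hM
  refine (mem_iff_of_flat hflat (by simpa using h1)).2 ?_
  rw [layerMap_last]; positivity

lemma zero_mem_closure (h : IsAdmissible p η β N) (hr : 0 < r)
    (hflat : Ω ∩ Metric.ball 0 r = {x | x ∈ Metric.ball 0 r ∧ 0 < x (Fin.last d)}) :
    (0 : EuclideanSpace ℝ (Fin (d + 1))) ∈ closure Ω :=
  mem_closure_of_tendsto (tendsto_layerMap h.scale_pos h.scale (0, 1))
    (h.eventually_layerMap_mem hr hflat 0 one_pos)

lemma tendsto_coeff (h : IsAdmissible p η β N) (hr : 0 < r)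
    (hflat : Ω ∩ Metric.ball 0 r = {x | x ∈ Metric.ball 0 r ∧ 0 < x (Fin.last d)})
    (hγ : ContinuousOn γ (closure Ω)) (y : EuclideanSpace ℝ (Fin d)) {t : ℝ} (ht : 0 < t) :
    Tendsto (fun M : ℕ => γ (layerMap M (N M) (y, t))) atTop (𝓝 (γ 0)) := by
  have h1 : Tendsto γ (𝓝[closure Ω] 0) (𝓝 (γ 0)) := hγ 0 (h.zero_mem_closure hr hflat)
  refine h1.comp (tendsto_nhdsWithin_iff.2 ⟨tendsto_layerMap h.scale_pos h.scale (y, t), ?_⟩)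
  filter_upwards [h.eventually_layerMap_mem hr hflat y ht] with M hM using subset_closure hM

lemma tendsto_cutoff (h : IsAdmissible p η β N) (y : EuclideanSpace ℝ (Fin d)) (t : ℝ) :
    Tendsto (fun M : ℕ => η ((M : ℝ) • layerMap M (N M) (y, t))) atTop
      (𝓝 (η (ofSlab (y, 0)))) :=
  (h.smooth.continuous.tendsto _).comp (tendsto_smul_layerMap h.scale (y, t))

lemma continuous_gradProfile (h : IsAdmissible p η β N) (ε : ℝ) :
    Continuous (gradProfile η β ε) := by
  have h1 : Continuous fun y => (ε : ℂ) • grad (fun x => (η x : ℂ)) y :=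
    (continuous_grad h.contDiff_ofReal).const_smul (ε : ℂ)
  exact (h.contDiff_ofReal.continuous.smul continuous_const).add h1

lemma tendsto_gradProfile (h : IsAdmissible p η β N) (y : EuclideanSpace ℝ (Fin d)) (t : ℝ) :
    Tendsto (fun M : ℕ => gradProfile η β (M / N M) ((M : ℝ) • layerMap M (N M) (y, t))) atTop
      (𝓝 ((η (ofSlab (y, 0)) : ℂ) • waveVec β 1 1)) := by
  have h1 := (Complex.continuous_ofReal.tendsto _).comp (h.tendsto_cutoff y t)
  have h2 := ((continuous_grad h.contDiff_ofReal).tendsto _).comp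
    (tendsto_smul_layerMap h.scale (y, t))
  have h3 := (Complex.continuous_ofReal.tendsto _).comp h.scale
  have := (h1.smul_const (waveVec β 1 1)).add (h3.smul h2)
  simpa [gradProfile, Function.comp_def] using this

lemma norm_waveVec (h : IsAdmissible p η β N) : ‖waveVec β 1 1‖ = Real.sqrt p := by
  rw [← norm_waveVec_one h.last_eq h.norm_sq, Real.sqrt_sq (norm_nonneg _)]

lemma norm_waveVec_conj (h : IsAdmissible p η β N) : ‖waveVec β (-1) 1‖ = Real.sqrt p := by
  rw [← conjVec_waveVec, norm_conjVec, h.norm_waveVec]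

lemma norm_gradProfile_le (h : IsAdmissible p η β N) {K ε : ℝ} (hε0 : 0 ≤ ε) (hε : ε ≤ 1)
    (hK : ∀ x, η x ≤ K) (hK' : ∀ x, ‖grad (fun x => (η x : ℂ)) x‖ ≤ K)
    (y : EuclideanSpace ℝ (Fin (d + 1))) : ‖gradProfile η β ε y‖ ≤ K * Real.sqrt p + K := by
  have hK0 : 0 ≤ K := (h.nonneg 0).trans (hK 0)
  refine (norm_add_le _ _).trans ?_
  rw [norm_smul, norm_smul, Complex.norm_real, Complex.norm_real, Real.norm_of_nonneg (h.nonneg _),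
    Real.norm_of_nonneg hε0, h.norm_waveVec]
  have h1 := hK y
  have h2 : ε * ‖grad (fun x => (η x : ℂ)) y‖ ≤ 1 * K := by
    have := hK' y
    gcongr
  have h3 : η y * Real.sqrt p ≤ K * Real.sqrt p := by gcongr
  linarith

lemma scale_eventually (h : IsAdmissible p η β N) :
    ∀ᶠ M : ℕ in atTop, 1 ≤ M ∧ 0 < N M ∧ 0 < (M : ℝ) / N M ∧ (M : ℝ) / N M ≤ 1 := by
  filter_upwards [h.scale.eventually (gt_mem_nhds one_pos), eventually_ge_atTop 1] with M h1 hM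
  have hN := h.scale_pos M hM
  exact ⟨hM, hN, by positivity, h1.le⟩

lemma weight_mul_integral (h : IsAdmissible p η β N) (hp : 1 < p) (s : ℝ) :
    1 / p * ∫ y : EuclideanSpace ℝ (Fin d),
      s * (p ^ (p / 2) / normConst p η) * η (ofSlab (y, 0)) ^ p = s := by
  have hp0 : 0 < p := by linarith
  have hI := h.integral_pos hp
  have hc := h.normConst_pos hp
  rw [integral_const_mul]
  have e : p ^ (p / 2) = p * p ^ ((p - 2) / 2) := by
    rw [mul_comm, ← Real.rpow_add_one hp0.ne']; congr 1; ring
  have h2 : normConst p η = p ^ ((p - 2) / 2) *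
    ∫ y : EuclideanSpace ℝ (Fin d), η (ofSlab (y, 0)) ^ p := normConst_eq
  rw [e]
  have hpp : 0 < p ^ ((p - 2) / 2) := Real.rpow_pos_of_pos hp0 _
  rw [h2]
  field_simp

/-- The energy of the explicit functions converges to `γ(0)`. -/
lemma tendsto_energy_boundaryWave (h : IsAdmissible p η β N) (hp : 1 < p) (hΩ : IsOpen Ω)
    (hr : 0 < r)
    (hflat : Ω ∩ Metric.ball 0 r = {x | x ∈ Metric.ball 0 r ∧ 0 < x (Fin.last d)})
    (hγ : ContinuousOn γ (closure Ω)) (hγb : IsBoundedCoeff γ Ω c C) :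
    Tendsto (fun M => energy p γ Ω (grad (boundaryWave p η β N M))) atTop (𝓝 (γ 0)) := by
  have hp0 : 0 < p := by linarith
  have hc := h.normConst_pos hp
  obtain ⟨K, hK0, hK, hK'⟩ := h.exists_bounds
  set g : ℕ → EuclideanSpace ℝ (Fin (d + 1)) → ℝ := fun M x =>
    γ x * (‖gradProfile η β (M / N M) ((M : ℝ) • x)‖ ^ p / normConst p η)
  have key := tendsto_integral_boundaryLayer hΩ hr hflat h.scale_pos h.scale hp0 (g := g)
    (G := fun y => γ 0 * (p ^ (p / 2) / normConst p η) * η (ofSlab (y, 0)) ^ p)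
    (C := C * ((K * Real.sqrt p + K) ^ p / normConst p η)) (R := 1) ?_ ?_ ?_ ?_
  · rw [h.weight_mul_integral hp] at key
    refine key.congr' ?_
    filter_upwards [eventually_ge_atTop 1] with M hM
    rw [energy, ← integral_const_mul]
    refine integral_congr_ae (ae_of_all _ fun x => ?_)
    simp only [g]
    rw [h.norm_grad_boundaryWave_rpow hp hM]; ring
  · refine Eventually.of_forall fun M => hγb.meas.mul (Continuous.aestronglyMeasurable ?_)
    exact ((((h.continuous_gradProfile _).comp (continuous_const_smul (M : ℝ))).norm).rpow_const
      fun _ => Or.inr hp0.le).div_const _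
  · filter_upwards [h.scale_eventually] with M hM x hx
    have hγ0 : 0 ≤ γ x := hγb.pos.le.trans (hγb.lower x hx)
    have := h.norm_gradProfile_le hM.2.2.1.le hM.2.2.2 hK hK' ((M : ℝ) • x)
    have hγC := hγb.upper x hx
    have hC0 := hγ0.trans hγC
    rw [abs_of_nonneg (by positivity)]
    simp only [g]
    gcongr
  · refine Eventually.of_forall fun M x _ hx => ?_
    simp [g, gradProfile, h.eq_zero _ hx.le, h.grad_eq_zero hx, hp0.ne']
  · intro y t ht
    have h1 := h.tendsto_coeff hr hflat hγ y ht
    have h2 := ((h.tendsto_gradProfile y t).norm.rpow_const (p := p) (Or.inr hp0.le)).div_const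
      (normConst p η)
    have h3 := h1.mul h2
    have e : γ 0 * (‖(η (ofSlab (y, 0)) : ℂ) • waveVec β 1 1‖ ^ p / normConst p η) =
        γ 0 * (p ^ (p / 2) / normConst p η) * η (ofSlab (y, 0)) ^ p := by
      rw [norm_smul, Complex.norm_real, Real.norm_of_nonneg (h.nonneg _), h.norm_waveVec,
        Real.mul_rpow (h.nonneg _) (Real.sqrt_nonneg _), Real.sqrt_eq_rpow, ← Real.rpow_mul hp0.le]
      rw [one_div_mul_eq_div]; ring
    rw [e] at h3
    exact h3

end IsAdmissible

/-- The regularization `(η + ε)^{p-1} - ε^{p-1}` of `η^{p-1}`. -/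
noncomputable def smoothPow (p : ℝ) (η : EuclideanSpace ℝ (Fin (d + 1)) → ℝ) (ε : ℝ)
    (y : EuclideanSpace ℝ (Fin (d + 1))) : ℝ := (η y + ε) ^ (p - 1) - ε ^ (p - 1)

namespace IsAdmissible

lemma smoothPow_nonneg (h : IsAdmissible p η β N) (hp : 1 < p) {ε : ℝ} (hε : 0 < ε) (y) :
    0 ≤ smoothPow p η ε y :=
  sub_nonneg.2 (Real.rpow_le_rpow hε.le (by linarith [h.nonneg y]) (by linarith))

lemma smoothPow_le (h : IsAdmissible p η β N) (hp : 1 < p) {K ε : ℝ} (hε : 0 < ε) (hε1 : ε ≤ 1)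
    (hK : ∀ x, η x ≤ K) (y) : smoothPow p η ε y ≤ (K + 1) ^ (p - 1) := by
  have h1 : (η y + ε) ^ (p - 1) ≤ (K + 1) ^ (p - 1) :=
    Real.rpow_le_rpow (by linarith [h.nonneg y]) (by linarith [hK y]) (by linarith)
  have h2 : 0 ≤ ε ^ (p - 1) := by positivity
  unfold smoothPow; linarith

lemma smoothPow_eq_zero {ε : ℝ} {y} (hy : η y = 0) : smoothPow p η ε y = 0 := by
  simp [smoothPow, hy]

lemma contDiff_smoothPow (h : IsAdmissible p η β N) {ε : ℝ} (hε : 0 < ε) :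
    ContDiff ℝ ∞ (smoothPow p η ε) :=
  ((h.smooth.add contDiff_const).rpow_const_of_ne fun x => by linarith [h.nonneg x]).sub
    contDiff_const

lemma grad_smoothPow (h : IsAdmissible p η β N) {ε : ℝ} (hε : 0 < ε) (y) :
    grad (fun y => (smoothPow p η ε y : ℂ)) y =
      (((p - 1) * (η y + ε) ^ (p - 2) : ℝ) : ℂ) • grad (fun x => (η x : ℂ)) y := by
  have hd : HasFDerivAt η (fderiv ℝ η y) y := (h.smooth.differentiable (by simp) y).hasFDerivAt
  have h1 : HasFDerivAt (smoothPow p η ε) _ y :=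
    ((hd.add_const ε).rpow_const (p := p - 1) (Or.inl (by linarith [h.nonneg y]))).sub_const
      (ε ^ (p - 1))
  have h2 : HasFDerivAt (fun y => (smoothPow p η ε y : ℂ)) _ y :=
    Complex.ofRealCLM.hasFDerivAt.comp y h1
  have h3 : HasFDerivAt (fun y => (η y : ℂ)) _ y := Complex.ofRealCLM.hasFDerivAt.comp y hd
  ext j
  simp only [grad, PiLp.smul_apply, smul_eq_mul]
  rw [h2.fderiv, h3.fderiv]
  simp [show p - 1 - 1 = p - 2 by ring]

lemma norm_grad_smoothPow_le (h : IsAdmissible p η β N) (hp : 1 < p) {K ε : ℝ} (hε : 0 < ε)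
    (hε1 : ε ≤ 1) (hK : ∀ x, η x ≤ K) (hK' : ∀ x, ‖grad (fun x => (η x : ℂ)) x‖ ≤ K)
    {ψ : EuclideanSpace ℝ (Fin (d + 1)) → ℝ} {C₁ : ℝ} (hψ : IsLayerBump ψ C₁) (y) :
    ε * ‖grad (fun y => (smoothPow p η ε y : ℂ)) y‖ ≤
      (p - 1) * K * (ε ^ (p - 1) + ε * (K + 1) ^ (p - 2)) * ψ y := by
  have hK0 : 0 ≤ K := (h.nonneg 0).trans (hK 0)
  rw [h.grad_smoothPow hε]
  by_cases hy : 1 < ‖y‖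
  · rw [h.grad_eq_zero hy]
    have := hψ.nonneg y
    have : 0 < p - 1 := by linarith
    simp; positivity
  have hs : 0 < η y + ε := by linarith [h.nonneg y]
  have hpow : (η y + ε) ^ (p - 2) ≤ ε ^ (p - 2) + (K + 1) ^ (p - 2) := by
    rcases le_total p 2 with h2 | h2
    · have h1 : (η y + ε) ^ (p - 2) ≤ ε ^ (p - 2) :=
        Real.rpow_le_rpow_of_nonpos hε (by linarith [h.nonneg y]) (by linarith)
      linarith [Real.rpow_nonneg (by linarith : 0 ≤ K + 1) (p - 2)]
    · have h1 : (η y + ε) ^ (p - 2) ≤ (K + 1) ^ (p - 2) :=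
        Real.rpow_le_rpow hs.le (by linarith [hK y]) (by linarith)
      linarith [Real.rpow_nonneg hε.le (p - 2)]
  have hp1 : 0 < p - 1 := by linarith
  rw [hψ.eq_one y (not_lt.1 hy), mul_one, norm_smul, Complex.norm_real,
    Real.norm_of_nonneg (by positivity)]
  calc ε * ((p - 1) * (η y + ε) ^ (p - 2) * ‖grad (fun x => (η x : ℂ)) y‖)
      ≤ ε * ((p - 1) * (ε ^ (p - 2) + (K + 1) ^ (p - 2)) * K) := by
        have := hK' y
        gcongr
    _ = (p - 1) * K * (ε ^ (p - 2) * ε + ε * (K + 1) ^ (p - 2)) := by ring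
    _ = _ := by rw [rpow_sub_two_mul_self hε.le hp]

lemma tendsto_smoothPow (h : IsAdmissible p η β N) (hp : 1 < p)
    (y : EuclideanSpace ℝ (Fin d)) (t : ℝ) :
    Tendsto (fun M : ℕ => smoothPow p η (M / N M) ((M : ℝ) • layerMap M (N M) (y, t))) atTop
      (𝓝 (η (ofSlab (y, 0)) ^ (p - 1))) := by
  have hp1 : 0 < p - 1 := by linarith
  have h1 := ((h.tendsto_cutoff y t).add h.scale).rpow_const (p := p - 1) (Or.inr hp1.le)
  have h2 := h.scale.rpow_const (p := p - 1) (Or.inr hp1.le)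
  have := h1.sub h2
  rw [Real.zero_rpow hp1.ne', add_zero, sub_zero] at this
  exact this

/-- The limit of the pairing of the dual field with the explicit gradient. -/
lemma tendsto_dual_pairing (h : IsAdmissible p η β N) (hp : 1 < p) (hΩ : IsOpen Ω)
    (hr : 0 < r)
    (hflat : Ω ∩ Metric.ball 0 r = {x | x ∈ Metric.ball 0 r ∧ 0 < x (Fin.last d)}) (s : ℝ) :
    Tendsto (fun M : ℕ => (M : ℝ) ^ d * N M * ∫ x in Ω,
      s * (p ^ (p / 2) / normConst p η) / p * (smoothPow p η (M / N M) ((M : ℝ) • x) *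
        (∑ j, waveVec β (-1) 1 j * gradProfile η β (M / N M) ((M : ℝ) • x) j).re) *
        Real.exp (-p * N M * x (Fin.last d))) atTop (𝓝 s) := by
  have hp0 : 0 < p := by linarith
  have hc := h.normConst_pos hp
  obtain ⟨K, hK0, hK, hK'⟩ := h.exists_bounds
  set κ : ℝ := s * (p ^ (p / 2) / normConst p η) / p
  have key := tendsto_integral_boundaryLayer hΩ hr hflat h.scale_pos h.scale hp0
    (g := fun M x => κ * (smoothPow p η (M / N M) ((M : ℝ) • x) *
      (∑ j, waveVec β (-1) 1 j * gradProfile η β (M / N M) ((M : ℝ) • x) j).re))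
    (G := fun y => s * (p ^ (p / 2) / normConst p η) * η (ofSlab (y, 0)) ^ p)
    (C := |κ| * ((K + 1) ^ (p - 1) * (Real.sqrt p * (K * Real.sqrt p + K)))) (R := 1) ?_ ?_ ?_ ?_
  · rwa [h.weight_mul_integral hp] at key
  · filter_upwards [h.scale_eventually] with M hM
    refine Continuous.aestronglyMeasurable (continuous_const.mul (Continuous.mul ?_ ?_))
    · exact (h.contDiff_smoothPow hM.2.2.1).continuous.comp (continuous_const_smul (M : ℝ))
    · refine Complex.continuous_re.comp (continuous_finsetSum _ fun j _ => continuous_const.mul ?_)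
      exact (PiLp.continuous_apply 2 _ j).comp
        ((h.continuous_gradProfile _).comp (continuous_const_smul (M : ℝ)))
  · filter_upwards [h.scale_eventually] with M hM x hx
    have h1 := h.smoothPow_nonneg hp hM.2.2.1 ((M : ℝ) • x)
    have h2 := h.smoothPow_le hp hM.2.2.1 hM.2.2.2 hK ((M : ℝ) • x)
    have h3 := h.norm_gradProfile_le hM.2.2.1.le hM.2.2.2 hK hK' ((M : ℝ) • x)
    have h4 := (Complex.abs_re_le_norm _).trans
      (norm_sum_mul_le (waveVec β (-1) 1) (gradProfile η β (M / N M) ((M : ℝ) • x)))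
    rw [h.norm_waveVec_conj] at h4
    rw [abs_mul, abs_mul, abs_of_nonneg h1]
    gcongr
    exact h4.trans (by gcongr)
  · refine Eventually.of_forall fun M x _ hx => ?_
    rw [smoothPow_eq_zero (h.eq_zero _ hx.le)]; simp
  · intro y t ht
    have h1 := h.tendsto_smoothPow hp y t
    have h2 : Tendsto (fun M : ℕ => (∑ j, waveVec β (-1) 1 j *
        gradProfile η β (M / N M) ((M : ℝ) • layerMap M (N M) (y, t)) j).re) atTop
        (𝓝 (∑ j, waveVec β (-1) 1 j * ((η (ofSlab (y, 0)) : ℂ) • waveVec β 1 1) j).re) := by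
      refine (Complex.continuous_re.tendsto _).comp (tendsto_finsetSum _ fun j _ => ?_)
      exact (((PiLp.continuous_apply 2 _ j).tendsto _).comp (h.tendsto_gradProfile y t)).const_mul _
    have e1 : (∑ j, waveVec β (-1) 1 j * ((η (ofSlab (y, 0)) : ℂ) • waveVec β 1 1) j).re =
        η (ofSlab (y, 0)) * p := by
      have e2 : ∑ j, waveVec β (-1) 1 j * ((η (ofSlab (y, 0)) : ℂ) • waveVec β 1 1) j =
          (η (ofSlab (y, 0)) : ℂ) * ∑ j, waveVec β (-1) 1 j * waveVec β 1 1 j := by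
        rw [Finset.mul_sum]
        exact Finset.sum_congr rfl fun j _ => by simp only [PiLp.smul_apply, smul_eq_mul]; ring
      rw [e2, sum_waveVec_mul h.last_eq, h.norm_sq, ← Complex.ofReal_mul, Complex.ofReal_re]
      ring
    rw [e1] at h2
    have h3 := (h1.mul h2).const_mul κ
    have e : κ * (η (ofSlab (y, 0)) ^ (p - 1) * (η (ofSlab (y, 0)) * p)) =
        s * (p ^ (p / 2) / normConst p η) * η (ofSlab (y, 0)) ^ p := by
      rw [← mul_assoc (η _ ^ (p - 1)), rpow_sub_one_mul_self (h.nonneg _) hp]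
      simp only [κ]; field_simp
    rw [e] at h3
    exact h3

/-- The limit of the dual energy. -/
lemma tendsto_dual_energy (h : IsAdmissible p η β N) (hp : 1 < p) (hΩ : IsOpen Ω)
    (hr : 0 < r)
    (hflat : Ω ∩ Metric.ball 0 r = {x | x ∈ Metric.ball 0 r ∧ 0 < x (Fin.last d)})
    (hγ : ContinuousOn γ (closure Ω)) (hγb : IsBoundedCoeff γ Ω c C) (hγ0 : 0 < γ 0) :
    Tendsto (fun M : ℕ => (M : ℝ) ^ d * N M * ∫ x in Ω,
      γ x * (p ^ (p / 2) / normConst p η) *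
        (γ 0 * smoothPow p η (M / N M) ((M : ℝ) • x) / γ x) ^ (p / (p - 1)) *
        Real.exp (-p * N M * x (Fin.last d))) atTop (𝓝 (γ 0)) := by
  have hp0 : 0 < p := by linarith
  have hp1 : 0 < p - 1 := by linarith
  have hc := h.normConst_pos hp
  obtain ⟨K, hK0, hK, hK'⟩ := h.exists_bounds
  have key := tendsto_integral_boundaryLayer hΩ hr hflat h.scale_pos h.scale hp0
    (g := fun M x => γ x * (p ^ (p / 2) / normConst p η) *
        (γ 0 * smoothPow p η (M / N M) ((M : ℝ) • x) / γ x) ^ (p / (p - 1)))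
    (G := fun y => γ 0 * (p ^ (p / 2) / normConst p η) * η (ofSlab (y, 0)) ^ p)
    (C := C * (p ^ (p / 2) / normConst p η) * (γ 0 * (K + 1) ^ (p - 1) / c) ^ (p / (p - 1)))
    (R := 1) ?_ ?_ ?_ ?_
  · rwa [h.weight_mul_integral hp] at key
  · filter_upwards [h.scale_eventually] with M hM
    have hm : Continuous fun x => smoothPow p η (M / N M) ((M : ℝ) • x) :=
      (h.contDiff_smoothPow hM.2.2.1).continuous.comp (continuous_const_smul (M : ℝ))
    exact (((hγb.meas.aemeasurable.mul_const _).mul (((hm.aemeasurable.const_mul _).div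
      hγb.meas.aemeasurable).pow_const _))).aestronglyMeasurable
  · filter_upwards [h.scale_eventually] with M hM x hx
    have h1 := h.smoothPow_nonneg hp hM.2.2.1 ((M : ℝ) • x)
    have h2 := h.smoothPow_le hp hM.2.2.1 hM.2.2.2 hK ((M : ℝ) • x)
    have h3 := hγb.lower x hx
    have h4 := hγb.upper x hx
    have hc0 := hγb.pos
    have hx0 : 0 < γ x := hc0.trans_le h3
    have hC0 : 0 < C := hx0.trans_le h4
    rw [abs_of_nonneg (by positivity)]
    gcongr
  · refine Eventually.of_forall fun M x _ hx => ?_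
    rw [smoothPow_eq_zero (h.eq_zero _ hx.le), mul_zero, zero_div,
      Real.zero_rpow (by positivity), mul_zero]
  · intro y t ht
    have h1 := h.tendsto_smoothPow hp y t
    have h2 := h.tendsto_coeff hr hflat hγ y ht
    have h3 := ((h1.const_mul (γ 0)).div h2 hγ0.ne').rpow_const (p := p / (p - 1))
      (Or.inr (by positivity))
    have h4 := (h2.mul_const (p ^ (p / 2) / normConst p η)).mul h3
    have e : (γ 0 * η (ofSlab (y, 0)) ^ (p - 1) / γ 0) ^ (p / (p - 1)) =
        η (ofSlab (y, 0)) ^ p := by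
      rw [mul_div_cancel_left₀ _ hγ0.ne', ← Real.rpow_mul (h.nonneg _),
        mul_div_cancel₀ _ hp1.ne']
    rw [e] at h4
    exact h4

end IsAdmissible

end Asymptotics

end PLaplaceBoundary

namespace PLaplaceBoundary

section DualField

variable {d : ℕ} {p : ℝ} {η : EuclideanSpace ℝ (Fin (d + 1)) → ℝ}
  {β : EuclideanSpace ℝ (Fin (d + 1))} {N : ℕ → ℝ}
  {Ω : Set (EuclideanSpace ℝ (Fin (d + 1)))} {r c C : ℝ}
  {γ : EuclideanSpace ℝ (Fin (d + 1)) → ℝ}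

/-- The size `√p · A · N` of the gradient of the explicit functions. -/
noncomputable def gradSize (d : ℕ) (p : ℝ) (η : EuclideanSpace ℝ (Fin (d + 1)) → ℝ) (N : ℕ → ℝ)
    (M : ℕ) : ℝ := Real.sqrt p * (amplitude d p η N M * N M)

/-- The scalar factor of the dual field. -/
noncomputable def dualFactor (p s : ℝ) (η : EuclideanSpace ℝ (Fin (d + 1)) → ℝ) (N : ℕ → ℝ)
    (M : ℕ) (x : EuclideanSpace ℝ (Fin (d + 1))) : ℝ :=
  s * gradSize d p η N M ^ (p - 1) / Real.sqrt p * smoothPow p η (M / N M) ((M : ℝ) • x)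

/-- The pairing of the (conjugated) dual field with a vector `a` at the point `x`. -/
noncomputable def dualPairing (p s : ℝ) (η : EuclideanSpace ℝ (Fin (d + 1)) → ℝ)
    (β : EuclideanSpace ℝ (Fin (d + 1))) (N : ℕ → ℝ) (M : ℕ)
    (x : EuclideanSpace ℝ (Fin (d + 1))) (a : EuclideanSpace ℂ (Fin (d + 1))) : ℂ :=
  (dualFactor p s η N M x : ℂ) * wave β (-N M) ((p - 1) * N M) x *
    ∑ j, waveVec β (-1) 1 j * a j

lemma dualPairing_add (s : ℝ) (M : ℕ) (x) (a b : EuclideanSpace ℂ (Fin (d + 1))) :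
    dualPairing p s η β N M x (a + b) =
      dualPairing p s η β N M x a + dualPairing p s η β N M x b := by
  simp only [dualPairing, PiLp.add_apply, mul_add, Finset.sum_add_distrib]

lemma tendsto_integral_norm_rpow {n : ℕ} {Ω : Set (EuclideanSpace ℝ (Fin n))} (hp : 1 < p)
    {f : ℕ → EuclideanSpace ℝ (Fin n) → EuclideanSpace ℂ (Fin n)}
    (hf : ∀ k, MemLp (f k) (ENNReal.ofReal p) (volume.restrict Ω))
    (ht : Tendsto (fun k => eLpNorm (f k) (ENNReal.ofReal p) (volume.restrict Ω)) atTop (𝓝 0)) :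
    Tendsto (fun k => ∫ x in Ω, ‖f k x‖ ^ p) atTop (𝓝 0) := by
  have hp0 : 0 < p := by linarith
  have h1 := ((ENNReal.tendsto_toReal ENNReal.zero_ne_top).comp ht).rpow_const (p := p)
    (Or.inr hp0.le)
  rw [ENNReal.toReal_zero, Real.zero_rpow hp0.ne'] at h1
  refine h1.congr fun k => ?_
  rw [Function.comp_apply, (hf k).eLpNorm_eq_integral_rpow_norm (by simpa using hp0)
    ENNReal.ofReal_ne_top, ENNReal.toReal_ofReal hp0.le, ENNReal.toReal_ofReal (by positivity),
    Real.rpow_inv_rpow (integral_nonneg fun x => by positivity) hp0.ne']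

namespace IsAdmissible

lemma gradSize_nonneg (h : IsAdmissible p η β N) (hp : 1 < p) {M : ℕ} (hM : 1 ≤ M) :
    0 ≤ gradSize d p η N M :=
  mul_nonneg (Real.sqrt_nonneg _)
    (mul_nonneg (h.amplitude_nonneg hp hM) (h.scale_pos M hM).le)

lemma gradSize_rpow (h : IsAdmissible p η β N) (hp : 1 < p) {M : ℕ} (hM : 1 ≤ M) :
    gradSize d p η N M ^ p = p ^ (p / 2) / normConst p η * ((M : ℝ) ^ d * N M) := by
  rw [gradSize, Real.mul_rpow (Real.sqrt_nonneg _)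
    (mul_nonneg (h.amplitude_nonneg hp hM) (h.scale_pos M hM).le), h.amplitude_mul_rpow hp hM,
    Real.sqrt_eq_rpow, ← Real.rpow_mul (by linarith), one_div_mul_eq_div]
  ring

lemma contDiff_dualFactor (h : IsAdmissible p η β N) (s : ℝ) {M : ℕ} (hM : 1 ≤ M) :
    ContDiff ℝ ∞ (dualFactor p s η N M) := by
  have hN := h.scale_pos M hM
  exact contDiff_const.mul ((h.contDiff_smoothPow (by positivity)).comp
    (contDiff_const_smul (M : ℝ)))

lemma hasCompactSupport_dualFactor (h : IsAdmissible p η β N) (s : ℝ) {M : ℕ} (hM : 1 ≤ M) :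
    HasCompactSupport (dualFactor p s η N M) := by
  refine HasCompactSupport.intro (isCompact_closedBall (0 : EuclideanSpace ℝ (Fin (d + 1))) 1)
    fun x hx => ?_
  rw [Metric.mem_closedBall, dist_zero_right, not_le] at hx
  have h1 : (1 : ℝ) ≤ M := by exact_mod_cast hM
  rw [dualFactor, smoothPow_eq_zero (h.eq_zero _ ?_), mul_zero]
  rw [norm_smul, Real.norm_natCast]
  nlinarith

lemma contDiff_dualFactor_ofReal (h : IsAdmissible p η β N) (s : ℝ) {M : ℕ} (hM : 1 ≤ M) :
    ContDiff ℝ ∞ fun x => (dualFactor p s η N M x : ℂ) :=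
  Complex.ofRealCLM.contDiff.comp (h.contDiff_dualFactor s hM)

lemma hasCompactSupport_dualFactor_ofReal (h : IsAdmissible p η β N) (s : ℝ) {M : ℕ}
    (hM : 1 ≤ M) : HasCompactSupport fun x => (dualFactor p s η N M x : ℂ) :=
  (h.hasCompactSupport_dualFactor s hM).comp_left (g := fun t : ℝ => (t : ℂ)) (by simp)

lemma grad_dualFactor (h : IsAdmissible p η β N) (s : ℝ) {M : ℕ} (hM : 1 ≤ M) (x) :
    grad (fun x => (dualFactor p s η N M x : ℂ)) x =
      ((s * gradSize d p η N M ^ (p - 1) / Real.sqrt p * M : ℝ) : ℂ) •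
        grad (fun y => (smoothPow p η (M / N M) y : ℂ)) ((M : ℝ) • x) := by
  have hN := h.scale_pos M hM
  have hs : Differentiable ℝ fun y => (smoothPow p η (M / N M) y : ℂ) :=
    (Complex.ofRealCLM.contDiff.comp
      (h.contDiff_smoothPow (p := p) (ε := M / N M) (by positivity))).differentiable (by simp)
  have hs' : Differentiable ℝ fun x => (smoothPow p η (M / N M) ((M : ℝ) • x) : ℂ) :=
    hs.comp (differentiable_id.const_smul (M : ℝ))
  have e : (fun x => (dualFactor p s η N M x : ℂ)) = fun x =>
      ((s * gradSize d p η N M ^ (p - 1) / Real.sqrt p : ℝ) : ℂ) *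
        (smoothPow p η (M / N M) ((M : ℝ) • x) : ℂ) := by
    ext x; simp [dualFactor]
  rw [e, grad_smul _ hs', grad_comp_smul hs, smul_smul]
  push_cast; rfl

lemma dualPairing_eq_sum_mul (s : ℝ) (M : ℕ)
    (W : EuclideanSpace ℝ (Fin (d + 1)) → EuclideanSpace ℂ (Fin (d + 1))) (x) :
    dualPairing p s η β N M x (W x) = ∑ j, waveVec β (-1) 1 j *
      (W x j * ((dualFactor p s η N M x : ℂ) * wave β (-N M) ((p - 1) * N M) x)) := by
  rw [dualPairing, Finset.mul_sum]
  exact Finset.sum_congr rfl fun j _ => by ring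

lemma integrable_dualPairing [IsFiniteMeasure (volume.restrict Ω)] (h : IsAdmissible p η β N)
    (hp : 1 < p) (s : ℝ) {M : ℕ} (hM : 1 ≤ M)
    {W : EuclideanSpace ℝ (Fin (d + 1)) → EuclideanSpace ℂ (Fin (d + 1))}
    (hW : MemLp W (ENNReal.ofReal p) (volume.restrict Ω)) :
    Integrable (fun x => dualPairing p s η β N M x (W x)) (volume.restrict Ω) := by
  simp only [dualPairing_eq_sum_mul]
  refine integrable_finsetSum _ fun j _ => Integrable.const_mul ?_ _
  exact MemLp.integrable_mul_bounded hp.le (memLp_coord hW j)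
    ((h.contDiff_dualFactor_ofReal s hM).mul (contDiff_wave _ _ _)).continuous
    (h.hasCompactSupport_dualFactor_ofReal s hM).mul_right

lemma tendsto_integral_dualPairing [IsFiniteMeasure (volume.restrict Ω)]
    (h : IsAdmissible p η β N) (hp : 1 < p) (s : ℝ) {M : ℕ} (hM : 1 ≤ M)
    {W : EuclideanSpace ℝ (Fin (d + 1)) → EuclideanSpace ℂ (Fin (d + 1))}
    {Wk : ℕ → EuclideanSpace ℝ (Fin (d + 1)) → EuclideanSpace ℂ (Fin (d + 1))}
    (hW : MemLp W (ENNReal.ofReal p) (volume.restrict Ω))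
    (hWk : ∀ k, MemLp (Wk k) (ENNReal.ofReal p) (volume.restrict Ω))
    (ht : Tendsto (fun k => eLpNorm (fun x => W x - Wk k x) (ENNReal.ofReal p)
      (volume.restrict Ω)) atTop (𝓝 0)) :
    Tendsto (fun k => ∫ x in Ω, dualPairing p s η β N M x (Wk k x)) atTop
      (𝓝 (∫ x in Ω, dualPairing p s η β N M x (W x))) := by
  have hcont := ((h.contDiff_dualFactor_ofReal s hM).mul
    (contDiff_wave β (-N M) ((p - 1) * N M))).continuous
  have hcomp : HasCompactSupport fun x => (dualFactor p s η N M x : ℂ) *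
    wave β (-N M) ((p - 1) * N M) x := (h.hasCompactSupport_dualFactor_ofReal s hM).mul_right
  have hI : ∀ V : EuclideanSpace ℝ (Fin (d + 1)) → EuclideanSpace ℂ (Fin (d + 1)),
      MemLp V (ENNReal.ofReal p) (volume.restrict Ω) →
      ∫ x in Ω, dualPairing p s η β N M x (V x) = ∑ j, waveVec β (-1) 1 j * ∫ x in Ω,
        V x j * ((dualFactor p s η N M x : ℂ) * wave β (-N M) ((p - 1) * N M) x) := by
    intro V hV
    simp only [dualPairing_eq_sum_mul]
    rw [integral_finsetSum _ fun j _ =>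
      (MemLp.integrable_mul_bounded hp.le (memLp_coord hV j) hcont hcomp).const_mul _]
    simp only [integral_const_mul]
  rw [hI W hW]
  simp only [hI _ (hWk _)]
  refine tendsto_finsetSum _ fun j _ => Tendsto.const_mul _ ?_
  refine tendsto_setIntegral_mul hp.le (memLp_coord hW j) (fun k => memLp_coord (hWk k) j) hcont
    hcomp ?_
  exact tendsto_of_tendsto_of_tendsto_of_le_of_le tendsto_const_nhds ht
    (fun _ => zero_le) fun k => eLpNorm_mono fun x => norm_coord_le (W x - Wk k x) j

/-- Testing the dual field against gradients of test functions gives a small quantity. -/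
lemma norm_integral_dualPairing_test_le (h : IsAdmissible p η β N) (hp : 1 < p) (hΩ : IsOpen Ω)
    (hr : 0 < r)
    (hflat : Ω ∩ Metric.ball 0 r = {x | x ∈ Metric.ball 0 r ∧ 0 < x (Fin.last d)}) {s : ℝ}
    (hs : 0 ≤ s) : ∃ B : ℝ, 0 ≤ B ∧ ∃ δ : ℕ → ℝ, Tendsto δ atTop (𝓝 0) ∧
      ∀ᶠ M : ℕ in atTop, 0 ≤ δ M ∧
      ∀ φ, IsTestFunction Ω φ → ‖∫ x in Ω, dualPairing p s η β N M x (grad φ x)‖ ≤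
        δ M * (B + B * ∫ x in Ω, ‖grad φ x‖ ^ p) := by
  have hp0 : 0 < p := by linarith
  have hp1 : 0 < p - 1 := by linarith
  have hc := h.normConst_pos hp
  obtain ⟨K, hK0, hK, hK'⟩ := h.exists_bounds
  obtain ⟨ψ, C₁, hψ⟩ := exists_isLayerBump d
  have hC₁ : 0 ≤ C₁ := (abs_nonneg _).trans (hψ.deriv_bound 0)
  set a : ℝ := p * (p - 1) / 2 with ha_def
  have ha : 0 < a := by positivity
  set κ₀ : ℝ := p ^ (p / 2) / normConst p η with hκ₀
  have hκ₀' : 0 < κ₀ := by positivity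
  have hlayer := tendsto_integral_boundaryLayer hΩ hr hflat h.scale_pos h.scale
    (a := p / 2) (by positivity) (g := fun M x => ψ ((M : ℝ) • x))
    (G := fun y => ψ (ofSlab (y, 0))) (C := 1) (R := 2)
    (Eventually.of_forall fun M =>
      (hψ.smooth.continuous.comp (continuous_const_smul (M : ℝ))).aestronglyMeasurable)
    (Eventually.of_forall fun M x _ => by
      rw [abs_of_nonneg (hψ.nonneg _)]; exact hψ.le_one _)
    (Eventually.of_forall fun M x _ hx => hψ.eq_zero _ hx.le)
    (fun y t _ => (hψ.smooth.continuous.tendsto _).comp (tendsto_smul_layerMap h.scale (y, t)))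
  set L : ℝ := 1 / (p / 2) * ∫ y : EuclideanSpace ℝ (Fin d), ψ (ofSlab (y, 0))
  have hL : 0 ≤ L := mul_nonneg (by positivity) (integral_nonneg fun y => hψ.nonneg _)
  set B₂ : ℝ := (2 * p / a) ^ p * ((a + C₁) / a)
  have hB₂ : 0 ≤ B₂ := by positivity
  set κ : ℝ → ℝ := fun ε => (p - 1) * K * (ε ^ (p - 1) + ε * (K + 1) ^ (p - 2))
  refine ⟨max (κ₀ * (L + 1)) B₂, le_max_of_le_right hB₂, fun M => s * κ (M / N M), ?_, ?_⟩
  · have h1 := (((h.scale.rpow_const (p := p - 1) (Or.inr hp1.le)).add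
      (h.scale.mul_const ((K + 1) ^ (p - 2)))).const_mul ((p - 1) * K)).const_mul s
    rw [Real.zero_rpow hp1.ne'] at h1
    simpa [κ] using h1
  have hMr : ∀ᶠ M : ℕ in atTop, 2 < (M : ℝ) * r :=
    ((tendsto_natCast_atTop_atTop (R := ℝ)).atTop_mul_const hr).eventually_gt_atTop 2
  filter_upwards [h.scale_eventually, hMr, hlayer.eventually (ge_mem_nhds (lt_add_one L))]
    with M hM hM2 hML
  obtain ⟨hM1, hN, hε, hε1⟩ := hM
  have hMpos : (0 : ℝ) < M := by positivity
  have hMN : (M : ℝ) ≤ N M := (div_le_one hN).1 hε1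
  have hκ : 0 ≤ κ (M / N M) := by simp only [κ]; positivity
  refine ⟨mul_nonneg hs hκ, fun φ hφ => ?_⟩
  set τ := gradSize d p η N M
  have hτ : 0 ≤ τ := h.gradSize_nonneg hp hM1
  have hτp : τ ^ p = κ₀ * ((M : ℝ) ^ d * N M) := h.gradSize_rpow hp hM1
  have hibp := integral_wave_mul_grad h.last_eq h.norm_sq (N M)
    (h.contDiff_dualFactor_ofReal s hM1) (h.hasCompactSupport_dualFactor_ofReal s hM1) hφ
  have e1 : ∫ x in Ω, dualPairing p s η β N M x (grad φ x) = _ := hibp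
  rw [e1, norm_neg]
  set E₁ : EuclideanSpace ℝ (Fin (d + 1)) → ℝ := fun x =>
    Real.exp (-(p / 2) * N M * x (Fin.last d))
  set E₂ : EuclideanSpace ℝ (Fin (d + 1)) → ℝ := fun x => Real.exp (-a * N M * x (Fin.last d))
  have hcE : ∀ b : ℝ, Continuous fun x : EuclideanSpace ℝ (Fin (d + 1)) =>
      Real.exp (b * N M * x (Fin.last d)) := fun b =>
    Real.continuous_exp.comp (continuous_const.mul (PiLp.continuous_apply 2 _ _))
  have hψc : Continuous fun x => ψ ((M : ℝ) • x) :=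
    hψ.smooth.continuous.comp (continuous_const_smul (M : ℝ))
  have hψs : HasCompactSupport fun x => ψ ((M : ℝ) • x) := by
    refine HasCompactSupport.intro (isCompact_closedBall (0 : EuclideanSpace ℝ (Fin (d + 1))) 2)
      fun x hx => hψ.eq_zero _ ?_
    rw [Metric.mem_closedBall, dist_zero_right, not_le] at hx
    have h1 : (1 : ℝ) ≤ M := by exact_mod_cast hM1
    rw [norm_smul, Real.norm_natCast]
    nlinarith
  have hgc : Continuous fun x => ‖φ x‖ ^ p :=
    hφ.smooth.continuous.norm.rpow_const fun _ => Or.inr hp0.le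
  have i1 : IntegrableOn (fun x => ψ ((M : ℝ) • x) * E₁ x) Ω :=
    ((hψc.mul (hcE _)).integrable_of_hasCompactSupport hψs.mul_right).integrableOn
  have i2 : IntegrableOn (fun x => ψ ((M : ℝ) • x) * ‖φ x‖ ^ p * E₂ x) Ω :=
    (((hψc.mul hgc).mul (hcE _)).integrable_of_hasCompactSupport
      hψs.mul_right.mul_right).integrableOn
  have hpt : ∀ x, ‖(∑ j, waveVec β (-1) 1 j *
      grad (fun x => (dualFactor p s η N M x : ℂ)) x j) *
      wave β (-N M) ((p - 1) * N M) x * φ x‖ ≤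
      s * κ (M / N M) * (τ ^ p * (ψ ((M : ℝ) • x) * E₁ x) +
        N M ^ p * (ψ ((M : ℝ) • x) * ‖φ x‖ ^ p * E₂ x)) := by
    intro x
    have hψ0 := hψ.nonneg ((M : ℝ) • x)
    have hsq : 0 < Real.sqrt p := Real.sqrt_pos.2 hp0
    have b1 := norm_sum_mul_le (waveVec β (-1) 1)
      (grad (fun x => (dualFactor p s η N M x : ℂ)) x)
    have b2 := h.norm_grad_smoothPow_le hp hε hε1 hK hK' hψ ((M : ℝ) • x)
    have hcoef : 0 ≤ s * τ ^ (p - 1) / Real.sqrt p * M := by positivity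
    rw [h.norm_waveVec_conj, h.grad_dualFactor s hM1, norm_smul, Complex.norm_real,
      Real.norm_of_nonneg hcoef] at b1
    set G := ‖grad (fun y => (smoothPow p η (M / N M) y : ℂ)) ((M : ℝ) • x)‖
    have b3 : M * G ≤ N M * (κ (M / N M) * ψ ((M : ℝ) • x)) := by
      have h1 := mul_le_mul_of_nonneg_left b2 hN.le
      calc M * G = N M * (M / N M * G) := by field_simp
        _ ≤ _ := h1
    rw [h.grad_dualFactor s hM1, norm_mul, norm_mul, norm_wave]
    set X := x (Fin.last d)
    have y1 := rpow_sub_one_mul_le (s := τ * Real.exp (-(1 / 2) * N M * X))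
      (t := N M * ‖φ x‖ * Real.exp (-((p - 1) / 2) * N M * X)) (by positivity) (by positivity) hp
    rw [Real.mul_rpow hτ (Real.exp_pos _).le, Real.mul_rpow hτ (Real.exp_pos _).le,
      Real.mul_rpow (by positivity) (Real.exp_pos _).le, Real.mul_rpow hN.le (norm_nonneg _),
      ← Real.exp_mul, ← Real.exp_mul, ← Real.exp_mul] at y1
    have x1 : Real.exp (-(1 / 2) * N M * X * (p - 1)) * Real.exp (-((p - 1) / 2) * N M * X) =
        Real.exp (-((p - 1) * N M) * X) := by
      rw [← Real.exp_add]; congr 1; ring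
    have x2 : Real.exp (-(1 / 2) * N M * X * p) = E₁ x := by
      simp only [E₁]; congr 1; ring
    have x3 : Real.exp (-((p - 1) / 2) * N M * X * p) = E₂ x := by
      simp only [E₂, a]; congr 1; ring
    rw [x2, x3] at y1
    calc _ ≤ Real.sqrt p * (s * τ ^ (p - 1) / Real.sqrt p * M * G) *
          Real.exp (-((p - 1) * N M) * X) * ‖φ x‖ := by gcongr
      _ = s * τ ^ (p - 1) * (M * G) * Real.exp (-((p - 1) * N M) * X) * ‖φ x‖ := by
          field_simp
      _ ≤ s * τ ^ (p - 1) * (N M * (κ (M / N M) * ψ ((M : ℝ) • x))) *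
          Real.exp (-((p - 1) * N M) * X) * ‖φ x‖ := by gcongr
      _ = s * κ (M / N M) * ψ ((M : ℝ) • x) * (τ ^ (p - 1) *
          Real.exp (-(1 / 2) * N M * X * (p - 1)) *
          (N M * ‖φ x‖ * Real.exp (-((p - 1) / 2) * N M * X))) := by rw [← x1]; ring
      _ ≤ s * κ (M / N M) * ψ ((M : ℝ) • x) * (τ ^ p * E₁ x + N M ^ p * ‖φ x‖ ^ p * E₂ x) := by
          gcongr
      _ = _ := by ring
  have hint : IntegrableOn (fun x => s * κ (M / N M) * (τ ^ p * (ψ ((M : ℝ) • x) * E₁ x) +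
        N M ^ p * (ψ ((M : ℝ) • x) * ‖φ x‖ ^ p * E₂ x))) Ω :=
    ((i1.const_mul _).add (i2.const_mul _)).const_mul _
  refine (norm_integral_le_of_norm_le hint (ae_of_all _ hpt)).trans ?_
  rw [integral_const_mul, integral_add (i1.const_mul _) (i2.const_mul _), integral_const_mul,
    integral_const_mul]
  refine mul_le_mul_of_nonneg_left (add_le_add ?_ ?_) (mul_nonneg hs hκ)
  · refine le_trans ?_ (le_max_left _ _)
    rw [hτp, mul_assoc]
    gcongr
  · refine (layer_hardy hΩ hflat hp hψ ha hMpos hN hMN hM2 hφ).trans ?_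
    exact mul_le_mul_of_nonneg_right (le_max_right _ _) (integral_nonneg fun x => by positivity)

/-- Testing the dual field against gradients of `W^{1,p}_0` functions gives a small quantity. -/
lemma norm_integral_dualPairing_le [IsFiniteMeasure (volume.restrict Ω)]
    (h : IsAdmissible p η β N) (hp : 1 < p) (hΩ : IsOpen Ω) (hr : 0 < r)
    (hflat : Ω ∩ Metric.ball 0 r = {x | x ∈ Metric.ball 0 r ∧ 0 < x (Fin.last d)}) {s : ℝ}
    (hs : 0 ≤ s) : ∃ B : ℝ, 0 ≤ B ∧ ∃ δ : ℕ → ℝ, Tendsto δ atTop (𝓝 0) ∧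
      ∀ᶠ M : ℕ in atTop, 0 ≤ δ M ∧
      ∀ w W, IsSobolevZero p Ω w W → ‖∫ x in Ω, dualPairing p s η β N M x (W x)‖ ≤
        δ M * (B + B * ∫ x in Ω, ‖W x‖ ^ p) := by
  obtain ⟨B, hB, δ, hδ, hev⟩ := h.norm_integral_dualPairing_test_le hp hΩ hr hflat hs
  refine ⟨max B (B * 2 ^ p), le_max_of_le_left hB, δ, hδ, ?_⟩
  filter_upwards [hev, eventually_ge_atTop 1] with M hM hM1
  refine ⟨hM.1, fun w W hW => ?_⟩
  obtain ⟨φ, hφ, -, hφW⟩ := hW.approx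
  have hG : ∀ k, MemLp (grad (φ k)) (ENNReal.ofReal p) (volume.restrict Ω) := fun k =>
    (hφ k).memLp_grad _ _
  have hWm := hW.sobolev.memLp_grad
  have t1 := (h.tendsto_integral_dualPairing hp s hM1 hWm hG hφW).norm
  have t2 := tendsto_integral_norm_rpow hp (fun k => hWm.sub (hG k)) hφW
  have t3 := (((tendsto_const_nhds (x := ∫ x in Ω, ‖W x‖ ^ p)).add t2).const_mul
    (B * 2 ^ p)).const_add B |>.const_mul (δ M)
  rw [add_zero] at t3
  refine (le_of_tendsto_of_tendsto' t1 t3 fun k => ?_).trans ?_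
  · refine (hM.2 _ (hφ k)).trans ?_
    refine mul_le_mul_of_nonneg_left ?_ hM.1
    rw [mul_assoc]
    gcongr
    have j1 := integrable_norm_rpow hp hWm
    have j2 := integrable_norm_rpow hp (hWm.sub (hG k))
    rw [← integral_add j1 j2, ← integral_const_mul]
    refine integral_mono (integrable_norm_rpow hp (hG k)) ((j1.add j2).const_mul _) fun x => ?_
    have := norm_sub_rpow_le hp (W x) (W x - grad (φ k) x)
    rwa [sub_sub_cancel] at this
  · refine mul_le_mul_of_nonneg_left (add_le_add (le_max_left _ _) ?_) hM.1
    exact mul_le_mul_of_nonneg_right (le_max_right _ _) (integral_nonneg fun x => by positivity)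

end IsAdmissible

end DualField

end PLaplaceBoundary

namespace PLaplaceBoundary

section EnergyLimit

variable {d : ℕ} {p : ℝ} {η : EuclideanSpace ℝ (Fin (d + 1)) → ℝ}
  {β : EuclideanSpace ℝ (Fin (d + 1))} {N : ℕ → ℝ}
  {Ω : Set (EuclideanSpace ℝ (Fin (d + 1)))} {r c C : ℝ}
  {γ : EuclideanSpace ℝ (Fin (d + 1)) → ℝ}

/-- The density of the dual energy, up to the factor `M ^ d * N M`. -/
noncomputable def dualDensity (p : ℝ) (γ η : EuclideanSpace ℝ (Fin (d + 1)) → ℝ) (N : ℕ → ℝ)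
    (M : ℕ) (x : EuclideanSpace ℝ (Fin (d + 1))) : ℝ :=
  γ x * (p ^ (p / 2) / normConst p η) *
    (γ 0 * smoothPow p η (M / N M) ((M : ℝ) • x) / γ x) ^ (p / (p - 1)) *
    Real.exp (-p * N M * x (Fin.last d))

namespace IsAdmissible

/-- Young's inequality between the dual field and an arbitrary gradient. -/
lemma re_dualPairing_le (h : IsAdmissible p η β N) (hp : 1 < p) (hγ0 : 0 < γ 0) {M : ℕ}
    (hM : 1 ≤ M) {x : EuclideanSpace ℝ (Fin (d + 1))} (hx : 0 < γ x)
    (a : EuclideanSpace ℂ (Fin (d + 1))) :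
    p * (dualPairing p (γ 0) η β N M x a).re ≤
      γ x * ‖a‖ ^ p + (p - 1) * ((M : ℝ) ^ d * N M * dualDensity p γ η N M x) := by
  have hp0 : 0 < p := by linarith
  have hp1 : 0 < p - 1 := by linarith
  have hN := h.scale_pos M hM
  have hsq : 0 < Real.sqrt p := Real.sqrt_pos.2 hp0
  set τ := gradSize d p η N M with hτ_def
  have hτ : 0 ≤ τ := h.gradSize_nonneg hp hM
  have hτp : τ ^ p = p ^ (p / 2) / normConst p η * ((M : ℝ) ^ d * N M) := h.gradSize_rpow hp hM
  set Z := smoothPow p η (M / N M) ((M : ℝ) • x) with hZ_def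
  have hZ : 0 ≤ Z := h.smoothPow_nonneg hp (by positivity) _
  set X := x (Fin.last d) with hX
  set q : ℝ := γ 0 * Z / γ x with hq_def
  have hq : 0 ≤ q := by positivity
  set σ : ℝ := τ * q ^ (1 / (p - 1)) * Real.exp (-N M * X) with hσ_def
  have hσ : 0 ≤ σ := by positivity
  have hσ1 : σ ^ (p - 1) = τ ^ (p - 1) * q * Real.exp (-((p - 1) * N M) * X) := by
    rw [hσ_def, Real.mul_rpow (by positivity) (Real.exp_pos _).le, Real.mul_rpow hτ (by positivity),
      ← Real.rpow_mul hq, one_div_mul_cancel hp1.ne', Real.rpow_one, ← Real.exp_mul]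
    congr 2; ring
  have hσp : σ ^ p = τ ^ p * q ^ (p / (p - 1)) * Real.exp (-p * N M * X) := by
    rw [hσ_def, Real.mul_rpow (by positivity) (Real.exp_pos _).le, Real.mul_rpow hτ (by positivity),
      ← Real.rpow_mul hq, one_div_mul_eq_div, ← Real.exp_mul]
    congr 2; ring
  have hre : (dualPairing p (γ 0) η β N M x a).re ≤ γ x * σ ^ (p - 1) * ‖a‖ := by
    refine (Complex.re_le_norm _).trans ?_
    have hF : 0 ≤ dualFactor p (γ 0) η N M x := by
      unfold dualFactor; positivity
    rw [dualPairing, norm_mul, norm_mul, norm_wave, Complex.norm_real, Real.norm_of_nonneg hF]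
    have b1 := norm_sum_mul_le (waveVec β (-1) 1) a
    rw [h.norm_waveVec_conj] at b1
    calc _ ≤ dualFactor p (γ 0) η N M x * Real.exp (-((p - 1) * N M) * X) *
          (Real.sqrt p * ‖a‖) := by gcongr
      _ = _ := by
        rw [hσ1, dualFactor, ← hZ_def, ← hτ_def, hq_def]
        field_simp
  have ht := rpow_tangent_le hσ (norm_nonneg a) hp
  have e1 : p * σ ^ (p - 1) * (‖a‖ - σ) = p * (σ ^ (p - 1) * ‖a‖) - p * σ ^ p := by
    rw [← rpow_sub_one_mul_self hσ hp]; ring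
  rw [e1] at ht
  have e2 : (M : ℝ) ^ d * N M * dualDensity p γ η N M x = γ x * σ ^ p := by
    rw [hσp, hτp, dualDensity, ← hZ_def, ← hq_def]; ring
  rw [e2]
  have h1 := mul_le_mul_of_nonneg_left hre hp0.le
  have h2 := mul_le_mul_of_nonneg_left ht hx.le
  linarith

lemma integrable_dualDensity (h : IsAdmissible p η β N) (hp : 1 < p) (hΩ : IsOpen Ω)
    (hγb : IsBoundedCoeff γ Ω c C) (hγ0 : 0 < γ 0) {M : ℕ} (hM : 1 ≤ M) :
    Integrable (dualDensity p γ η N M) (volume.restrict Ω) := by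
  have hp0 : 0 < p := by linarith
  have hp1 : 0 < p - 1 := by linarith
  have hc := h.normConst_pos hp
  have hN := h.scale_pos M hM
  have hε : 0 < (M : ℝ) / N M := by positivity
  have hm : Continuous fun x => smoothPow p η (M / N M) ((M : ℝ) • x) :=
    (h.contDiff_smoothPow hε).continuous.comp (continuous_const_smul (M : ℝ))
  have he : Continuous fun x : EuclideanSpace ℝ (Fin (d + 1)) =>
      Real.exp (-p * N M * x (Fin.last d)) :=
    Real.continuous_exp.comp (continuous_const.mul (PiLp.continuous_apply 2 _ _))
  have hb : Integrable (fun x => C * (p ^ (p / 2) / normConst p η) *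
      (γ 0 * smoothPow p η (M / N M) ((M : ℝ) • x) / c) ^ (p / (p - 1)) *
      Real.exp (-p * N M * x (Fin.last d))) (volume.restrict Ω) := by
    refine ((Continuous.mul (continuous_const.mul
      (((continuous_const.mul hm).div_const _).rpow_const
      fun _ => Or.inr (by positivity))) he).integrable_of_hasCompactSupport ?_).integrableOn
    refine HasCompactSupport.intro (isCompact_closedBall (0 : EuclideanSpace ℝ (Fin (d + 1))) 1)
      fun x hx => ?_
    rw [Metric.mem_closedBall, dist_zero_right, not_le] at hx
    have h1 : (1 : ℝ) ≤ M := by exact_mod_cast hM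
    have h0 : smoothPow p η (M / N M) ((M : ℝ) • x) = 0 := smoothPow_eq_zero (h.eq_zero _ ?_)
    · have hq : p / (p - 1) ≠ 0 := by positivity
      simp [h0, Real.zero_rpow hq]
    rw [norm_smul, Real.norm_natCast]
    nlinarith
  refine hb.mono' ?_ ?_
  · exact (((hγb.meas.aemeasurable.mul_const _).mul (((hm.aemeasurable.const_mul _).div
      hγb.meas.aemeasurable).pow_const _)).mul he.aemeasurable).aestronglyMeasurable
  · filter_upwards [ae_restrict_mem hΩ.measurableSet] with x hx
    have h1 := h.smoothPow_nonneg hp hε ((M : ℝ) • x)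
    have h3 := hγb.lower x hx
    have h4 := hγb.upper x hx
    have hc0 := hγb.pos
    have hx0 : 0 < γ x := hc0.trans_le h3
    have hC0 : 0 < C := hx0.trans_le h4
    rw [dualDensity, Real.norm_of_nonneg (by positivity)]
    gcongr

lemma re_dualPairing_boundaryWave (h : IsAdmissible p η β N) (hp : 1 < p) (s : ℝ) {M : ℕ}
    (hM : 1 ≤ M) (x : EuclideanSpace ℝ (Fin (d + 1))) :
    (dualPairing p s η β N M x (grad (boundaryWave p η β N M) x)).re =
      (M : ℝ) ^ d * N M * (s * (p ^ (p / 2) / normConst p η) / p *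
        (smoothPow p η (M / N M) ((M : ℝ) • x) *
        (∑ j, waveVec β (-1) 1 j * gradProfile η β (M / N M) ((M : ℝ) • x) j).re) *
        Real.exp (-p * N M * x (Fin.last d))) := by
  have hp0 : 0 < p := by linarith
  have hsq : 0 < Real.sqrt p := Real.sqrt_pos.2 hp0
  have hτ : 0 ≤ gradSize d p η N M := h.gradSize_nonneg hp hM
  have hτp := h.gradSize_rpow hp hM
  have e1 : dualPairing p s η β N M x (grad (boundaryWave p η β N M) x) =
      ((dualFactor p s η N M x * (amplitude d p η N M * N M) *
        Real.exp (-p * N M * x (Fin.last d)) : ℝ) : ℂ) *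
        ∑ j, waveVec β (-1) 1 j * gradProfile η β (M / N M) ((M : ℝ) • x) j := by
    have hw := wave_mul (β := β) (-N M) ((p - 1) * N M) (N M) (N M) x
    rw [show -N M + N M = 0 by ring, wave_zero,
      show -((p - 1) * N M + N M) = -p * N M by ring] at hw
    rw [Complex.ofReal_mul _ (Real.exp _), ← hw, dualPairing, Finset.mul_sum, Finset.mul_sum]
    refine Finset.sum_congr rfl fun j _ => ?_
    rw [h.grad_boundaryWave hM, PiLp.smul_apply, smul_eq_mul]
    push_cast; ring
  rw [e1, Complex.re_ofReal_mul]
  have e2 : gradSize d p η N M ^ (p - 1) / Real.sqrt p * (amplitude d p η N M * N M) =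
      p ^ (p / 2) / normConst p η * ((M : ℝ) ^ d * N M) / p := by
    rw [← hτp, ← rpow_sub_one_mul_self hτ hp]
    have e3 : gradSize d p η N M = Real.sqrt p * (amplitude d p η N M * N M) := rfl
    have e4 : p = Real.sqrt p * Real.sqrt p := (Real.mul_self_sqrt hp0.le).symm
    have e5 : amplitude d p η N M * N M = gradSize d p η N M / Real.sqrt p := by
      rw [e3]; field_simp
    rw [e5]
    calc _ = gradSize d p η N M ^ (p - 1) * gradSize d p η N M / (Real.sqrt p * Real.sqrt p) := by
          field_simp
      _ = _ := by rw [← e4]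
  rw [dualFactor]
  linear_combination s * smoothPow p η (M / N M) ((M : ℝ) • x) *
    Real.exp (-p * N M * x (Fin.last d)) *
    (∑ j, waveVec β (-1) 1 j * gradProfile η β (M / N M) ((M : ℝ) • x) j).re * e2

/-- Lower bound for the energy by duality. -/
lemma dual_le_energy [IsFiniteMeasure (volume.restrict Ω)] (h : IsAdmissible p η β N)
    (hp : 1 < p) (hΩ : IsOpen Ω) (hγb : IsBoundedCoeff γ Ω c C) (hγ0 : 0 < γ 0) {M : ℕ}
    (hM : 1 ≤ M) {W : EuclideanSpace ℝ (Fin (d + 1)) → EuclideanSpace ℂ (Fin (d + 1))}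
    (hW : MemLp W (ENNReal.ofReal p) (volume.restrict Ω)) :
    p * ((M : ℝ) ^ d * N M * ∫ x in Ω, γ 0 * (p ^ (p / 2) / normConst p η) / p *
        (smoothPow p η (M / N M) ((M : ℝ) • x) *
        (∑ j, waveVec β (-1) 1 j * gradProfile η β (M / N M) ((M : ℝ) • x) j).re) *
        Real.exp (-p * N M * x (Fin.last d))) -
      (p - 1) * ((M : ℝ) ^ d * N M * ∫ x in Ω, dualDensity p γ η N M x) -
      p * ‖∫ x in Ω, dualPairing p (γ 0) η β N M x (W x)‖ ≤
    energy p γ Ω (fun x => grad (boundaryWave p η β N M) x + W x) := by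
  have hp0 : 0 < p := by linarith
  have hG : MemLp (grad (boundaryWave p η β N M)) (ENNReal.ofReal p) (volume.restrict Ω) :=
    (isSobolev_of_contDiff p (h.contDiff_boundaryWave M)
      (h.hasCompactSupport_boundaryWave hM)).memLp_grad
  have i1 := h.integrable_dualPairing hp (γ 0) hM hG
  have i2 := h.integrable_dualPairing hp (γ 0) hM hW
  have i3 : Integrable (fun x => γ x * ‖grad (boundaryWave p η β N M) x + W x‖ ^ p)
    (volume.restrict Ω) := hγb.integrable_energy hΩ hp (hG.add hW)
  have i4 := h.integrable_dualDensity hp hΩ hγb hγ0 hM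
  have i1' : Integrable (fun x => (dualPairing p (γ 0) η β N M x
    (grad (boundaryWave p η β N M) x)).re) (volume.restrict Ω) := i1.re
  have i2' : Integrable (fun x => (dualPairing p (γ 0) η β N M x (W x)).re)
    (volume.restrict Ω) := i2.re
  have e1 : ∫ x in Ω, (dualPairing p (γ 0) η β N M x
      (grad (boundaryWave p η β N M) x)).re = (M : ℝ) ^ d * N M * ∫ x in Ω,
        γ 0 * (p ^ (p / 2) / normConst p η) / p *
        (smoothPow p η (M / N M) ((M : ℝ) • x) *
        (∑ j, waveVec β (-1) 1 j * gradProfile η β (M / N M) ((M : ℝ) • x) j).re) *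
        Real.exp (-p * N M * x (Fin.last d)) := by
    simp only [h.re_dualPairing_boundaryWave hp _ hM]
    rw [integral_const_mul]
  have e2 : -‖∫ x in Ω, dualPairing p (γ 0) η β N M x (W x)‖ ≤
      ∫ x in Ω, (dualPairing p (γ 0) η β N M x (W x)).re := by
    have := integral_re i2
    simp only [RCLike.re_to_complex] at this
    rw [this]
    exact (abs_le.1 (Complex.abs_re_le_norm _)).1
  have key : ∫ x in Ω, p * ((dualPairing p (γ 0) η β N M x
      (grad (boundaryWave p η β N M) x)).re + (dualPairing p (γ 0) η β N M x (W x)).re) ≤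
      ∫ x in Ω, (γ x * ‖grad (boundaryWave p η β N M) x + W x‖ ^ p +
        (p - 1) * ((M : ℝ) ^ d * N M * dualDensity p γ η N M x)) := by
    refine setIntegral_mono_on ((i1'.add i2').const_mul p)
      (i3.add ((i4.const_mul _).const_mul _)) hΩ.measurableSet fun x hx => ?_
    rw [← Complex.add_re, ← dualPairing_add]
    exact h.re_dualPairing_le hp hγ0 hM (hγb.pos.trans_le (hγb.lower x hx)) _
  rw [integral_const_mul, integral_add i1' i2',
    integral_add i3 ((i4.const_mul _).const_mul _), integral_const_mul, integral_const_mul,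
    e1] at key
  have e3 := mul_le_mul_of_nonneg_left e2 hp0.le
  unfold energy
  linarith

/-- The values of the Dirichlet-to-Neumann pairing on the explicit functions converge. -/
lemma tendsto_of_isDNValue [IsFiniteMeasure (volume.restrict Ω)] (h : IsAdmissible p η β N)
    (hp : 1 < p) (hΩ : IsOpen Ω) (hr : 0 < r)
    (hflat : Ω ∩ Metric.ball 0 r = {x | x ∈ Metric.ball 0 r ∧ 0 < x (Fin.last d)})
    (hγ : ContinuousOn γ (closure Ω)) (hγb : IsBoundedCoeff γ Ω c C) (hγ0 : 0 < γ 0)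
    {ℓ : ℕ → ℂ} (hℓ : ∀ M : ℕ, 1 ≤ M →
      IsDNValue p γ Ω (boundaryWave p η β N M) (boundaryWave p η β N M) (ℓ M)) :
    Tendsto ℓ atTop (𝓝 ((γ 0 : ℝ) : ℂ)) := by
  have hp0 : 0 < p := by linarith
  have hc := hγb.pos
  have hG : ∀ M : ℕ, 1 ≤ M →
      MemLp (grad (boundaryWave p η β N M)) (ENNReal.ofReal p) (volume.restrict Ω) := fun M hM =>
    (isSobolev_of_contDiff p (h.contDiff_boundaryWave M)
      (h.hasCompactSupport_boundaryWave hM)).memLp_grad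
  obtain ⟨B, hB, δ, hδ, hev⟩ := h.norm_integral_dualPairing_le hp hΩ hr hflat hγ0.le
  have t1 := h.tendsto_energy_boundaryWave hp hΩ hr hflat hγ hγb
  have t2 := h.tendsto_dual_pairing hp hΩ hr hflat (γ 0)
  have t3 := h.tendsto_dual_energy hp hΩ hr hflat hγ hγb hγ0
  set E : ℕ → ℝ := fun M => energy p γ Ω (grad (boundaryWave p η β N M)) with hE
  have t4 := (hδ.mul (((t1.const_mul (2 ^ p * 2 / c)).const_mul B).const_add B)).const_mul p
  have t5 := ((t2.const_mul p).sub (t3.const_mul (p - 1))).sub t4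
  have e0 : p * γ 0 - (p - 1) * γ 0 - p * (0 * (B + B * (2 ^ p * 2 / c * γ 0))) = γ 0 := by ring
  rw [e0] at t5
  have hre : Tendsto (fun M => (ℓ M).re) atTop (𝓝 (γ 0)) := by
    refine tendsto_of_tendsto_of_tendsto_of_le_of_le' t5 t1 ?_ ?_
    · filter_upwards [hev, eventually_ge_atTop 1] with M hMδ hM
      obtain ⟨w, W, hW, hℓM, hmin⟩ := (hℓ M hM).exists_minimizer hγb hΩ hp
        (h.contDiff_boundaryWave M) (h.hasCompactSupport_boundaryWave hM)
      have hWm := hW.sobolev.memLp_grad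
      rw [hℓM, Complex.ofReal_re]
      refine le_trans ?_ (h.dual_le_energy hp hΩ hγb hγ0 hM hWm)
      refine sub_le_sub_left (mul_le_mul_of_nonneg_left ((hMδ.2 w W hW).trans ?_) hp0.le) _
      refine mul_le_mul_of_nonneg_left ?_ hMδ.1
      gcongr
      have hEU : energy p γ Ω (fun x => grad (boundaryWave p η β N M) x + W x) ≤ E M := by
        have := hmin _ _ ((IsTestFunction.zero (Ω := Ω)).isSobolevZero (p := p))
        refine this.trans (le_of_eq ?_)
        have hz : grad (fun _ : EuclideanSpace ℝ (Fin (d + 1)) => (0 : ℂ)) = fun _ => 0 := by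
          ext x j; simp [grad]
        simp [hz, hE]
      have i1 : Integrable (fun x => ‖grad (boundaryWave p η β N M) x + W x‖ ^ p)
        (volume.restrict Ω) := integrable_norm_rpow hp ((hG M hM).add hWm)
      have i2 := integrable_norm_rpow hp (hG M hM)
      have lower : ∀ U : EuclideanSpace ℝ (Fin (d + 1)) → EuclideanSpace ℂ (Fin (d + 1)),
          MemLp U (ENNReal.ofReal p) (volume.restrict Ω) →
          ∫ x in Ω, ‖U x‖ ^ p ≤ energy p γ Ω U / c := by
        intro U hU
        rw [le_div_iff₀ hc, mul_comm, ← integral_const_mul, energy]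
        refine setIntegral_mono_on ((integrable_norm_rpow hp hU).const_mul c)
          (hγb.integrable_energy hΩ hp hU) hΩ.measurableSet fun x hx => ?_
        exact mul_le_mul_of_nonneg_right (hγb.lower x hx) (by positivity)
      have l1 : ∫ x in Ω, ‖grad (boundaryWave p η β N M) x + W x‖ ^ p ≤ E M / c :=
        (lower _ ((hG M hM).add hWm)).trans (by gcongr; exact hEU)
      have l2 : ∫ x in Ω, ‖grad (boundaryWave p η β N M) x‖ ^ p ≤ E M / c := lower _ (hG M hM)
      calc ∫ x in Ω, ‖W x‖ ^ p
          ≤ ∫ x in Ω, 2 ^ p * (‖grad (boundaryWave p η β N M) x + W x‖ ^ p +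
            ‖grad (boundaryWave p η β N M) x‖ ^ p) := by
            refine integral_mono (integrable_norm_rpow hp hWm) ((i1.add i2).const_mul _)
              fun x => ?_
            have := norm_sub_rpow_le hp (grad (boundaryWave p η β N M) x + W x)
              (grad (boundaryWave p η β N M) x)
            rwa [add_sub_cancel_left] at this
        _ = 2 ^ p * ((∫ x in Ω, ‖grad (boundaryWave p η β N M) x + W x‖ ^ p) +
            ∫ x in Ω, ‖grad (boundaryWave p η β N M) x‖ ^ p) := by
            rw [integral_const_mul, integral_add i1 i2]
        _ ≤ 2 ^ p * (E M / c + E M / c) := by gcongr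
        _ = _ := by ring
    · filter_upwards [eventually_ge_atTop 1] with M hM
      obtain ⟨w, W, hW, hℓM, hmin⟩ := (hℓ M hM).exists_minimizer hγb hΩ hp
        (h.contDiff_boundaryWave M) (h.hasCompactSupport_boundaryWave hM)
      rw [hℓM, Complex.ofReal_re]
      have := hmin _ _ ((IsTestFunction.zero (Ω := Ω)).isSobolevZero (p := p))
      refine this.trans (le_of_eq ?_)
      have hz : grad (fun _ : EuclideanSpace ℝ (Fin (d + 1)) => (0 : ℂ)) = fun _ => 0 := by
        ext x j; simp [grad]
      simp [hz, hE]
  refine ((Complex.continuous_ofReal.tendsto _).comp hre).congr' ?_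
  filter_upwards [eventually_ge_atTop 1] with M hM
  obtain ⟨w, W, -, hℓM, -⟩ := (hℓ M hM).exists_minimizer hγb hΩ hp
    (h.contDiff_boundaryWave M) (h.hasCompactSupport_boundaryWave hM)
  rw [Function.comp_apply, hℓM, Complex.ofReal_re]

end IsAdmissible

end EnergyLimit

end PLaplaceBoundary

namespace PLaplaceBoundary

section Admissible

variable {d : ℕ} {p : ℝ} {η : EuclideanSpace ℝ (Fin (d + 1)) → ℝ}
  {β : EuclideanSpace ℝ (Fin (d + 1))} {N : ℕ → ℝ}

lemma tendsto_natCast_div_succ_sq :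
    Tendsto (fun M : ℕ => (M : ℝ) / ((M : ℝ) + 1) ^ 2) atTop (𝓝 0) := by
  refine tendsto_of_tendsto_of_tendsto_of_le_of_le tendsto_const_nhds
    (tendsto_one_div_add_atTop_nhds_zero_nat (𝕜 := ℝ)) (fun M => by positivity) fun M => ?_
  beta_reduce
  rw [div_le_div_iff₀ (by positivity) (by positivity)]
  have : (0 : ℝ) ≤ M := by positivity
  nlinarith

/-- Admissible data with `η` supported in the open unit ball exist. -/
lemma exists_isAdmissible (hd : 1 ≤ d) (hp : 1 < p) :
    ∃ (η : EuclideanSpace ℝ (Fin (d + 1)) → ℝ) (β : EuclideanSpace ℝ (Fin (d + 1)))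
      (N : ℕ → ℝ), IsAdmissible p η β N ∧ tsupport η ⊆ Metric.ball 0 1 := by
  let f : ContDiffBump (0 : EuclideanSpace ℝ (Fin (d + 1))) :=
    ⟨1 / 2, 3 / 4, by norm_num, by norm_num⟩
  refine ⟨f, EuclideanSpace.single 0 (Real.sqrt (p - 1)), fun M => ((M : ℝ) + 1) ^ 2, ?_, ?_⟩
  · exact
    { smooth := f.contDiff
      nonneg := fun x => f.nonneg
      eq_one := fun x hx => f.one_of_mem_closedBall (by
        rw [mem_closedBall_zero_iff]; exact hx)
      eq_zero := fun x hx => f.zero_of_le_dist (by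
        rw [dist_zero_right]; exact le_trans (by norm_num [f]) hx)
      norm_sq := by
        rw [PiLp.norm_single, Real.norm_of_nonneg (Real.sqrt_nonneg _),
          Real.sq_sqrt (by linarith)]
      last_eq := by
        have : Fin.last d ≠ 0 := by
          rw [Ne, Fin.ext_iff]; simp; omega
        simp [this]
      scale_pos := fun M _ => by positivity
      scale := tendsto_natCast_div_succ_sq }
  · rw [f.tsupport_eq]
    exact Metric.closedBall_subset_ball (by norm_num [f])

namespace IsAdmissible

lemma support_boundaryWave_subset (h : IsAdmissible p η β N) {M : ℕ} (hM : 1 ≤ M) :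
    Function.support (boundaryWave p η β N M) ⊆ Metric.closedBall 0 (1 / (M : ℝ)) := by
  intro x hx
  have hM0 : (0 : ℝ) < M := by positivity
  rw [Metric.mem_closedBall, dist_zero_right, le_div_iff₀ hM0]
  by_contra hcon
  refine hx (h.boundaryWave_eq_zero M ?_)
  rw [norm_smul, Real.norm_natCast]
  linarith

lemma tsupport_boundaryWave_subset_ball (hη : tsupport η ⊆ Metric.ball 0 1) {M : ℕ}
    (hM : 1 ≤ M) :
    closure (Function.support (boundaryWave p η β N M)) ⊆ Metric.ball 0 (1 / (M : ℝ)) := by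
  have hM0 : (0 : ℝ) < M := by positivity
  have h1 : closure (Function.support (boundaryWave p η β N M)) ⊆
      (fun x => (M : ℝ) • x) ⁻¹' tsupport η := by
    refine closure_minimal (fun x hx => subset_closure ?_)
      ((isClosed_tsupport η).preimage (continuous_const_smul (M : ℝ)))
    intro h0
    exact hx (by simp [boundaryWave, h0])
  intro x hx
  have := hη (h1 hx)
  rw [Metric.mem_ball, dist_zero_right, norm_smul, Real.norm_natCast] at this
  rw [Metric.mem_ball, dist_zero_right, lt_div_iff₀ hM0]
  linarith

end IsAdmissible

lemma isDNValue_dnPairing {n : ℕ} {γ : EuclideanSpace ℝ (Fin n) → ℝ}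
    {Ω : Set (EuclideanSpace ℝ (Fin n))} {f g : EuclideanSpace ℝ (Fin n) → ℂ}
    (h : ∃ ℓ, IsDNValue p γ Ω f g ℓ) : IsDNValue p γ Ω f g (dnPairing p γ Ω f g) :=
  Classical.epsilon_spec h

end Admissible

end PLaplaceBoundary

theorem proposition2p5 (d : ℕ) (hd : 1 ≤ d) (p : ℝ) (hp : 1 < p) :
    (∃ (η : EuclideanSpace ℝ (Fin (d + 1)) → ℝ) (β : EuclideanSpace ℝ (Fin (d + 1)))
        (N : ℕ → ℝ),
      PLaplaceBoundary.IsAdmissible p η β N ∧ tsupport η ⊆ Metric.ball 0 1) ∧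
    ∀ (η : EuclideanSpace ℝ (Fin (d + 1)) → ℝ) (β : EuclideanSpace ℝ (Fin (d + 1)))
      (N : ℕ → ℝ), PLaplaceBoundary.IsAdmissible p η β N →
      (∀ M : ℕ, 1 ≤ M →
        ContDiff ℝ ∞ (PLaplaceBoundary.boundaryWave p η β N M) ∧
        HasCompactSupport (PLaplaceBoundary.boundaryWave p η β N M)) ∧
      ∀ (Ω : Set (EuclideanSpace ℝ (Fin (d + 1)))) (r : ℝ)
        (γ : EuclideanSpace ℝ (Fin (d + 1)) → ℝ),
        IsOpen Ω → Bornology.IsBounded Ω → 0 < r →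
        Ω ∩ Metric.ball 0 r = {x | x ∈ Metric.ball 0 r ∧ 0 < x (Fin.last d)} →
        ContinuousOn γ (closure Ω) → (∀ x ∈ closure Ω, 0 < γ x) →
        (∀ M : ℕ, 1 ≤ M →
          closure (Function.support (PLaplaceBoundary.boundaryWave p η β N M) ∩ frontier Ω) ⊆
            Metric.closedBall 0 (1 / (M : ℝ)) ∩ frontier Ω) ∧
        (tsupport η ⊆ Metric.ball 0 1 → ∀ M : ℕ, 1 ≤ M →
          closure (Function.support (PLaplaceBoundary.boundaryWave p η β N M) ∩ frontier Ω) ⊆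
            Metric.ball 0 (1 / (M : ℝ)) ∩ frontier Ω) ∧
        (∀ M : ℕ, 1 ≤ M → ∃! ℓ : ℂ,
          PLaplaceBoundary.IsDNValue p γ Ω (PLaplaceBoundary.boundaryWave p η β N M)
            (PLaplaceBoundary.boundaryWave p η β N M) ℓ) ∧
        Tendsto (fun M : ℕ =>
          PLaplaceBoundary.dnPairing p γ Ω (PLaplaceBoundary.boundaryWave p η β N M)
            (PLaplaceBoundary.boundaryWave p η β N M)) atTop (𝓝 ((γ 0 : ℝ) : ℂ)) := by
  refine ⟨PLaplaceBoundary.exists_isAdmissible hd hp, fun η β N h => ⟨fun M hM =>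
    ⟨h.contDiff_boundaryWave M, h.hasCompactSupport_boundaryWave hM⟩, ?_⟩⟩
  intro Ω r γ hΩ hb hr hflat hγ hpos
  have hfr : ∀ A : Set (EuclideanSpace ℝ (Fin (d + 1))),
      closure (A ∩ frontier Ω) ⊆ closure A ∩ frontier Ω := fun A =>
    (closure_inter_subset_inter_closure A (frontier Ω)).trans (by rw [isClosed_frontier.closure_eq])
  have h0 := h.zero_mem_closure hr hflat
  have hne : Ω.Nonempty := closure_nonempty_iff.1 ⟨0, h0⟩
  obtain ⟨c, C, hγb⟩ := PLaplaceBoundary.exists_isBoundedCoeff hΩ hb hne hγ hpos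
  obtain ⟨R, hR, hΩR⟩ := hb.subset_ball_lt 0 0
  have : IsFiniteMeasure (volume.restrict Ω) := ⟨by
    rw [Measure.restrict_apply_univ]; exact hb.measure_lt_top⟩
  have hex : ∀ M : ℕ, 1 ≤ M → ∃ ℓ : ℂ,
      PLaplaceBoundary.IsDNValue p γ Ω (PLaplaceBoundary.boundaryWave p η β N M)
        (PLaplaceBoundary.boundaryWave p η β N M) ℓ := fun M hM =>
    PLaplaceBoundary.exists_isDNValue hγb hΩ hp hR hΩR 0 (h.contDiff_boundaryWave M)
      (h.hasCompactSupport_boundaryWave hM)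
  refine ⟨fun M hM => (hfr _).trans (Set.inter_subset_inter_left _
      (closure_minimal (h.support_boundaryWave_subset hM) Metric.isClosed_closedBall)),
    fun hη M hM => (hfr _).trans (Set.inter_subset_inter_left _
      (PLaplaceBoundary.IsAdmissible.tsupport_boundaryWave_subset_ball hη hM)),
    fun M hM => ?_, ?_⟩
  · obtain ⟨ℓ, hℓ⟩ := hex M hM
    exact ⟨ℓ, hℓ, fun ℓ' hℓ' => hℓ'.unique hγb hΩ hp (h.contDiff_boundaryWave M)
      (h.hasCompactSupport_boundaryWave hM) hℓ⟩
  · exact h.tendsto_of_isDNValue hp hΩ hr hflat hγ hγb (hpos 0 h0) fun M hM =>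
      PLaplaceBoundary.isDNValue_dnPairing (hex M hM)
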